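/- **Setting.** Let $T$ be a finite tree embedded in a disk $D^2$ so that a vertex lies on the boundary circle if and only if it is a leaf (a vertex of degree one), and suppose that every other (*interior*) vertex has degree at least $3$. Let $V^o$ be the set of interior vertices. A *face* of $T$ is a connected component of $D^2\setminus T$; a *corner* is a pair $(v,F)$ of an interior vertex $v$ and a face $F$ whose closure contains $v$. For vertices $u,v$ let $[u,v]$ be the path between them. An *arc* (resp. a *segment*) is a path $[u,v]$ between two distinct leaves (resp. two distinct interior vertices) such that any two consecutive edges are incident to a common face. An arc contains the corner $(v,F)$ if it uses the two edges at $v$ that are incident to $F$ at this corner. An arc $p$ divides $D^2$ into two components, hence the set of faces into two *regions*; $\mathrm{Reg}(p,F)$ is the one containing $F$. Arcs $p,q$ *cross* if they contain a common segment and no region of $p$ is contained in or contains a region of $q$. An arc is a *boundary arc* if its vertices all lie on a common face. A *facet* is a maximal set of pairwise noncrossing non-boundary arcs. An arc $p$ of a facet $\mathcal F$ is *marked* at a corner $(v,F)$ contained in $p$ if $\mathrm{Reg}(q,F)\subseteq \mathrm{Reg}(p,F)$ for all $q\in\mathcal F$ containing $(v,F)$. **Oriented flip graph.** The vertices of $\overrightarrow{FG}(T)$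 are the facets. There is an edge $\mathcal F_1\xrightarrow{s}\mathcal F_2$ if $\mathcal F_2=(\mathcal F_1\setminus\{p\})\cup\{q\}$ for arcs $p\in\mathcal F_1$, $q\notin\mathcal F_1$ such that $p$ is marked in $\mathcal F_1$ at two distinct corners $(u,F),(v,G)$, the arc $q$ is marked in $\mathcal F_2$ at the corners immediately clockwise from $(u,F)$ around $u$ and from $(v,G)$ around $v$, and $s=[u,v]$. Write $\mathcal F\le\mathcal G$ if there is a directed path from $\mathcal F$ to $\mathcal G$. Let $\lambda_\downarrow(\mathcal F)$ and $\lambda^\uparrow(\mathcal F)$ be the sets of labels of the edges ending, respectively starting, at $\mathcal F$. **Shard intersection order.** Let $\psi(\mathcal F)$ be the set of labels of all covering relations $\mathcal W\lessdot\mathcal Z$ with $\bigwedge\{\mathcal F':\mathcal F'\lessdot\mathcal F\}\le\mathcal W\lessdot\mathcal Z\le\mathcal F$, and let $\Psi(\overrightarrow{FG}(T))=\{\psi(\mathcal F)\}$, ordered by inclusion. **Noncrossing tree partitions.** Fix a small $\epsilon>0$. For each corner $(v,F)$ let $z(v,F)$ be a point of $F$ at distance $\epsilon$ from $v$. A *red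 admissible curve* for a segment $s=[u,v]$ is a simple curve in $D^2$ that crosses no edge of $T$ other than edges of $s$, stays at distance at least $\epsilon$ from all interior vertices, and joins $z(u,F)$ to $z(v,G)$, where $(u,F)$ (resp. $(v,G)$) is the corner immediately to the right of the edge of $s$ at $u$ (resp. $v$), this edge being directed away from $u$ (resp. $v$). Two segments are *noncrossing* if they admit red admissible curves that do not intersect, not even in their endpoints. For $B\subseteq V^o$ let $\mathrm{Seg}(B)$ be the set of inclusion-minimal segments with both endpoints in $B$; $B$ is *segment-connected* if any two of its elements are joined by a sequence of elements of $B$ in which consecutive ones are the endpoints of a segment of $\mathrm{Seg}(B)$. For a set partition $\mathbf B$ of $V^o$ let $\mathrm{Seg}(\mathbf B)$ be the union of the sets $\mathrm{Seg}(B)$ over the blocks $B$. $\mathrm{NCP}(T)$ is the set of the partitions $\mathbf B$ of $V^o$ all of whose blocks are segment-connected and such that any two distinct segments of $\mathrm{Seg}(\mathbf B)$ are noncrossing, ordered by refinement ($\mathbf B\le\mathbf B'$ if each block of $\mathbf B$ is contained in a block of $\mathbf B'$). For a facet $\mathcal F$ let $\rho(\mathcal F)$ be the partition of $V^o$ into the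 connected components of the graph with edge set $\lambda_\downarrow(\mathcal F)$, each segment being an edge between its endpoints. **Theorem.** With the order $\le$, $\overrightarrow{FG}(T)$ is a lattice whose covering relations are exactly the edges of $\overrightarrow{FG}(T)$, and each edge has exactly one label, which is a segment. The map $\psi:\overrightarrow{FG}(T)\to\Psi(\overrightarrow{FG}(T))$ is a bijection, $\rho$ is a bijection from $\overrightarrow{FG}(T)$ onto $\mathrm{NCP}(T)$ with $\mathrm{Seg}(\rho(\mathcal F))=\lambda_\downarrow(\mathcal F)$ for all $\mathcal F$, and $$\rho\circ\psi^{-1}:\Psi(\overrightarrow{FG}(T))\to\mathrm{NCP}(T)$$ is an isomorphism of posets. Moreover this isomorphism commutes with Kreweras complementation: for every facet $\mathcal F$ there is a unique facet $\mathrm{Kr}(\mathcal F)$ with $\lambda_\downarrow(\mathrm{Kr}(\mathcal F))=\lambda^\uparrow(\mathcal F)$, and $\mathrm{Kr}$ is a bijection; there are well-defined bijections $\mathrm{Kr}$ of $\Psi(\overrightarrow{FG}(T))$, given by $\mathrm{Kr}(\psi(\mathcal F))=\psi(\mathrm{Kr}(\mathcal F))$, and of $\mathrm{NCP}(T)$,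 where $\mathrm{Kr}(\rho(\mathcal F))$ is the unique $\mathbf B'\in\mathrm{NCP}(T)$ with $\mathrm{Seg}(\mathbf B')=\lambda^\uparrow(\mathcal F)$; and $(\rho\circ\psi^{-1})(\mathrm{Kr}(X))=\mathrm{Kr}((\rho\circ\psi^{-1})(X))$ for all $X\in\Psi(\overrightarrow{FG}(T))$. -/

import Mathlib

/-- A finite tree embedded in a disk, with leaves on the boundary circle and all other vertices
in the interior of the disk, up to isotopy.  The embedding is recorded by its rotation system:
`cw v` sends a neighbour of `v` to the next neighbour of `v` in the clockwise order around `v`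
(only its values on neighbours of `v` matter).  Every rotation system on a tree is planar.
Every interior (non-leaf) vertex has degree at least three. -/
structure PlaneTree (V : Type*) where
  G : SimpleGraph V
  isTree : G.IsTree
  cw : V → Equiv.Perm V
  cw_cycle : ∀ v, (cw v).IsCycleOn (G.neighborSet v)
  three_le_degree : ∀ v, (G.neighborSet v).ncard ≠ 1 → 3 ≤ (G.neighborSet v).ncard

namespace PlaneTree

variable {V : Type*} (T : PlaneTree V)

/-- Leaves are the vertices on the boundary of the disk. -/
def IsLeaf (v : V) : Prop := (T.G.neighborSet v).ncard = 1

/-- The set of interior vertices. -/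
def Interior : Type _ := {v : V // ¬ T.IsLeaf v}

/-! ### Faces and corners -/

/-- The dart `d = (v, w)` is followed by the dart `e = (w, x)` along the boundary of the region
to the right of `d`; this happens only at interior vertices `w`, since the boundary of a face
is interrupted at the leaves (which lie on the boundary circle). -/
def FollowsOnRight (d e : T.G.Dart) : Prop :=
  ¬ T.IsLeaf d.snd ∧ e.fst = d.snd ∧ T.cw d.snd e.snd = d.fst

/-- A face, i.e. a connected component of the complement of the tree in the disk, is recorded by
the set of all darts which have it on their right-hand side. -/
def Face : Type _ := Quot T.FollowsOnRight

/-- The face to the right of a dart.  The face to the left of `d` is the one right of `d.symm`. -/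
def rightFace (d : T.G.Dart) : T.Face := Quot.mk _ d

/-- A vertex lies on (the closure of) a face. -/
def OnFace (v : V) (F : T.Face) : Prop :=
  ∃ d : T.G.Dart, T.rightFace d = F ∧ (v = d.fst ∨ v = d.snd)

/-- A corner at an interior vertex `v`: the sector at `v` between the edge to `w` and the
clockwise next edge at `v`, recorded by the dart `(v, w)`. -/
def Corner : Type _ := {d : T.G.Dart // ¬ T.IsLeaf d.fst}

variable {T} in
/-- The vertex of a corner. -/
def Corner.vertex (c : T.Corner) : V := c.1.fst

variable {T} in
/-- The face of a corner. -/
def Corner.face (c : T.Corner) : T.Face := T.rightFace c.1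

variable {T} in
/-- The corner immediately clockwise from a given corner. -/
def Corner.clockwise (c : T.Corner) : T.Corner :=
  ⟨⟨(c.1.fst, T.cw c.1.fst c.1.snd), (T.cw_cycle c.1.fst).1.mapsTo c.1.adj⟩, c.2⟩

/-! ### Paths, arcs and segments (identified with their sets of vertices) -/

/-- The vertex set of the acyclic path `[u, v]`. -/
def path (u v : V) : Set V := {x | ∃ p : T.G.Walk u v, p.IsPath ∧ x ∈ p.support}

/-- Any two consecutive edges of the path are incident to a common face, i.e. they are
neighbours in the cyclic order at their common vertex. -/
def Sharp (A : Set V) : Prop :=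
  ∀ y ∈ A, ∀ x ∈ A, ∀ z ∈ A, T.G.Adj y x → T.G.Adj y z → x ≠ z → T.cw y x = z ∨ T.cw y z = x

/-- Arcs: acyclic paths between two distinct leaves turning sharply at every vertex. -/
def IsArc (p : Set V) : Prop :=
  ∃ u v, u ≠ v ∧ T.IsLeaf u ∧ T.IsLeaf v ∧ p = T.path u v ∧ T.Sharp p

/-- Segments: acyclic paths between two distinct interior vertices turning sharply at every
vertex. -/
def IsSegment (s : Set V) : Prop :=
  ∃ u v, u ≠ v ∧ ¬ T.IsLeaf u ∧ ¬ T.IsLeaf v ∧ s = T.path u v ∧ T.Sharp s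

/-- An arc traverses a corner if it uses the two edges bounding the corner. -/
def ContainsCorner (p : Set V) (c : T.Corner) : Prop :=
  c.1.fst ∈ p ∧ c.1.snd ∈ p ∧ T.cw c.1.fst c.1.snd ∈ p

/-! ### The noncrossing complex -/

/-- Two faces are separated by an edge which is not an edge of `p`. -/
def AdjacentOff (p : Set V) (F F' : T.Face) : Prop :=
  ∃ d : T.G.Dart, ¬ (d.fst ∈ p ∧ d.snd ∈ p) ∧ T.rightFace d = F ∧ T.rightFace d.symm = F'

/-- `Reg(p, F)`: the faces which lie in the same component of the complement of `p` as `F`,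
i.e. which can be reached from `F` without crossing `p`. -/
def reg (p : Set V) (F : T.Face) : Set T.Face := {F' | Relation.EqvGen (T.AdjacentOff p) F F'}

/-- The regions defined by an arc. -/
def regions (p : Set V) : Set (Set T.Face) := Set.range (T.reg p)

/-- The arcs `p` and `q` cross (along some segment). -/
def ArcsCross (p q : Set V) : Prop :=
  ∃ s, T.IsSegment s ∧ s ⊆ p ∧ s ⊆ q ∧
    ∀ P ∈ T.regions p, ∀ Q ∈ T.regions q, ¬ P ⊆ Q ∧ ¬ Q ⊆ P

/-- Boundary arcs: all vertices lie on a common face. -/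
def IsBoundaryArc (p : Set V) : Prop := T.IsArc p ∧ ∃ F, ∀ v ∈ p, T.OnFace v F

/-- The simplices of the reduced noncrossing complex. -/
def IsReducedFace (S : Set (Set V)) : Prop :=
  (∀ p ∈ S, T.IsArc p ∧ ¬ T.IsBoundaryArc p) ∧ ∀ p ∈ S, ∀ q ∈ S, ¬ T.ArcsCross p q

/-- The facets of the reduced noncrossing complex, i.e. the vertices of the flip graph. -/
def Facet : Type _ := {S : Set (Set V) // Maximal T.IsReducedFace S}

/-- `p` is marked at the corner `c` in the collection of arcs `S`: it is the largest arc of `S`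
through `c` with respect to inclusion of `Reg( · , c.face)`. -/
def Marked (S : Set (Set V)) (p : Set V) (c : T.Corner) : Prop :=
  p ∈ S ∧ T.ContainsCorner p c ∧
    ∀ q ∈ S, T.ContainsCorner q c → T.reg q c.face ⊆ T.reg p c.face

variable {T} in
/-- The labelled oriented edge `F₁ —s→ F₂` of the oriented flip graph: `F₂` is obtained from `F₁`
by replacing an arc `p` by another arc `q`, where `p` is marked in `F₁` at two distinct corners
`c, c'`, and `q` is marked in `F₂` at the two corners immediately clockwise from them.  The label
`s` is the path between the vertices of the two corners. -/
def Facet.Flip (F₁ : T.Facet) (s : Set V) (F₂ : T.Facet) : Prop :=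
  ∃ p q : Set V, p ∈ F₁.1 ∧ q ∉ F₁.1 ∧ F₂.1 = insert q (F₁.1 \ {p}) ∧
    ∃ c c' : T.Corner, c ≠ c' ∧ T.Marked F₁.1 p c ∧ T.Marked F₁.1 p c' ∧
      T.Marked F₂.1 q c.clockwise ∧ T.Marked F₂.1 q c'.clockwise ∧
      s = T.path c.vertex c'.vertex

/-- `F ≤ G` in the oriented flip graph if `G` can be reached from `F` along oriented edges. -/
instance : Preorder T.Facet where
  le := Relation.ReflTransGen (fun F G => ∃ s, F.Flip s G)
  le_refl _ := Relation.ReflTransGen.refl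
  le_trans _ _ _ h h' := h.trans h'

variable {T} in
/-- The labels of the edges of the oriented flip graph ending at `F`. -/
def Facet.lowerLabels (F : T.Facet) : Set (Set V) := {s | ∃ F' : T.Facet, F'.Flip s F}

variable {T} in
/-- The labels of the edges of the oriented flip graph starting at `F`. -/
def Facet.upperLabels (F : T.Facet) : Set (Set V) := {s | ∃ F' : T.Facet, F.Flip s F'}

/-! ### The shard intersection order -/

variable {T} in
/-- The set of the labels of all covering relations `w ⋖ z` in the interval `[m, F]`, where `m` is
the meet of all elements covered by `F`. -/
def Facet.shardSet (F : T.Facet) : Set (Set V) :=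
  {s | ∃ m w z : T.Facet, IsGLB {F' | F' ⋖ F} m ∧ m ≤ w ∧ w ⋖ z ∧ z ≤ F ∧ w.Flip s z}

/-- The shard intersection order: the sets `shardSet F`, ordered by inclusion. -/
abbrev ShardOrder : Type _ := {X : Set (Set V) // ∃ F : T.Facet, F.shardSet = X}

/-- The map `ψ` from the oriented flip graph onto the shard intersection order. -/
def psi (F : T.Facet) : T.ShardOrder := ⟨F.shardSet, F, rfl⟩

/-! ### Noncrossing tree partitions -/

/-- `y` is an endpoint of the path `s`. -/
def IsEndpoint (s : Set V) (y : V) : Prop := ∃ z, s = T.path y z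

/-- A red admissible curve for a segment `s`.  Such a curve runs along `s`, may cross the edges of
`s` but no other edge of the tree, and stays at distance at least `ε` from the interior vertices.
Up to isotopy it therefore passes each vertex `y` of `s` other than its endpoints through the
corner between the two edges of `s` at `y`; at an endpoint `y` it ends at the
marked point at distance `ε` in the corner to the right of the edge of `s` at `y`, seen from `y`.
So the curve is recorded by the distances `d y` at which it passes the vertices `y` of `s`, in the
unit `ε`. -/
def IsRedCurve (s : Set V) (d : V → ℝ) : Prop :=
  ∀ y ∈ s, (T.IsEndpoint s y → d y = 1) ∧ (¬ T.IsEndpoint s y → 1 < d y)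

open Classical in
/-- For adjacent vertices `y, x` of the segment `s`, the signed distance, positive to the right of
the edge from `y` to `x`, at which the red curve for `s` with distances `d` passes (or ends at) `y`.
The curve is on the right if `y` is an endpoint of `s`, or if the corner of `s` at `y` is the one
clockwise from the edge from `y` to `x`. -/
noncomputable def offset (s : Set V) (d : V → ℝ) (y x : V) : ℝ :=
  if T.IsEndpoint s y ∨ T.cw y x ∈ s then d y else - d y

/-- Two segments are noncrossing as red segments if they admit red admissible curves that do not
meet.  Curves can meet only along common edges, and two curves are disjoint along a common edge
`{y, x}` when the same one of them is strictly to the right of the other one (going from `y` to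
`x`) at both ends of this edge.  In particular curves ending at the same corner do meet. -/
def RedNoncrossing (s t : Set V) : Prop :=
  ∃ d e : V → ℝ, T.IsRedCurve s d ∧ T.IsRedCurve t e ∧
    ∀ y x, y ∈ s → x ∈ s → y ∈ t → x ∈ t → T.G.Adj y x →
      (T.offset s d y x < T.offset t e y x ∧ T.offset t e x y < T.offset s d x y) ∨
      (T.offset t e y x < T.offset s d y x ∧ T.offset s d x y < T.offset t e x y)

/-- `Seg(B)`: the inclusion-minimal segments with both endpoints in `B`. -/
def segs (B : Set T.Interior) : Set (Set V) :=
  {s | Minimal (fun s => T.IsSegment s ∧ ∃ u ∈ B, ∃ v ∈ B, s = T.path u.1 v.1) s}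

/-- `B` is segment-connected. -/
def SegmentConnected (B : Set T.Interior) : Prop :=
  ∀ u ∈ B, ∀ v ∈ B,
    Relation.ReflTransGen (fun a b => a ∈ B ∧ b ∈ B ∧ T.path a.1 b.1 ∈ T.segs B) u v

/-- `Seg` of a set partition of the interior vertices: the union of `Seg(B)` over all blocks. -/
def partSegs (P : Setoid T.Interior) : Set (Set V) := ⋃ B ∈ P.classes, T.segs B

/-- Noncrossing tree partitions.  Set partitions are given as equivalence relations. -/
def IsNCP (P : Setoid T.Interior) : Prop :=
  (∀ s ∈ T.partSegs P, ∀ t ∈ T.partSegs P, s ≠ t → T.RedNoncrossing s t) ∧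
    ∀ B ∈ P.classes, T.SegmentConnected B

/-- The poset of noncrossing tree partitions; the order on `Setoid` is refinement: `P ≤ Q` if every
block of `P` is contained in a block of `Q`. -/
abbrev NCP : Type _ := {P : Setoid T.Interior // T.IsNCP P}

/-- The map `ρ`: the partition of the interior vertices into the connected components of the graph
whose edges join the endpoints of the labels of the edges ending at `F`. -/
def rho (F : T.Facet) : Setoid T.Interior :=
  Relation.EqvGen.setoid (fun u v => T.path u.1 v.1 ∈ F.lowerLabels)

/-! ### Kreweras complementation -/

variable {T} in
/-- `Kr(F) = G` in the oriented flip graph. -/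
def Facet.Kreweras (F G : T.Facet) : Prop := F.upperLabels = G.lowerLabels

/-- `Kr(X) = Y` in the shard intersection order, transported along `ψ`. -/
def ShardKreweras (X Y : T.ShardOrder) : Prop :=
  ∃ F G : T.Facet, T.psi F = X ∧ T.psi G = Y ∧ F.Kreweras G

/-- `Kr(P) = Q` for noncrossing tree partitions: `Seg(Q)` is the set of labels of the edges of the
oriented flip graph starting at the facet `F` with `ρ(F) = P`. -/
def NCPKreweras (P Q : T.NCP) : Prop :=
  ∃ F : T.Facet, T.rho F = P.1 ∧ T.partSegs Q.1 = F.upperLabels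

end PlaneTree

/-! Segments behave like string modules. A common subpath `w` of `s` and `t` which `s` leaves to the
left at its ends (`Quo w s`) and `t` to the right (`Sub w t`) plays the role of the image of a
nonzero map from `s` to `t`; its existence is `Hom s t`. A torsion pair consists of two sets `X`,
`Y` of segments that are mutual `Hom`-orthogonals, and everything in the theorem is translated into
torsion pairs ordered by inclusion of `X`, which clearly form a lattice. Reflecting the tree
exchanges `X` with `Y` and `Quo` with `Sub`, so half of the arguments come for free.

Facets. Two arcs cross exactly when there is a `Hom` between them in some direction
(`arcsCross_iff`). The non-boundary arcs orthogonal to a torsion pair form a facet, and every facet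
arises from exactly one torsion pair (`facetSet_maximal`, `toFacet_injective`,
`toFacet_surjective`). Starting at a corner and turning left after segments of `X` and right after
segments of `Y` gives a compatible arc, the largest one at that corner; this describes the marked
arcs (`marked_iff`). Across a covering relation of torsion pairs the larger `X` meets the smaller
`Y` in a single segment (`exists_label`), and flips are exactly these covering relations with this
label (`flip_iff`).

Labels. The labels below a torsion pair are pairwise `Hom`-orthogonal, i.e. form a semibrick, and
each semibrick is the set of lower labels of exactly one torsion pair (`lowerLab_ofX`,
`lowerLab_injective`). Disjointness of red curves is again `Hom`-orthogonality
(`redNoncrossing_iff`), and a semibrick and its partition into components determine each other, so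
noncrossing tree partitions are semibricks. Hence `rho` is a bijection.

Shards. If `m` is the meet of the lower covers of `τ`, the labels in `[m, τ]` are the segments in
`τ.X ∩ m.Y`, and these are the segments that are concatenations of lower labels (`IsCore.isConcat`,
`IsCore.mem_of_isConcat`). So the shard set consists of all segments joining vertices of one block
of `rho`, and inclusion of shard sets is refinement of partitions. Finally, upper labels also form a
semibrick, by reflection, hence are the lower labels of a unique facet: the Kreweras complement. -/

namespace PlaneTree

variable {V : Type*} (T : PlaneTree V)

/-! ### Paths in trees -/

lemma exists_isPath (u v : V) : ∃ p : T.G.Walk u v, p.IsPath :=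
  (T.isTree.existsUnique_path u v).exists

lemma walk_unique {u v : V} {p q : T.G.Walk u v} (hp : p.IsPath) (hq : q.IsPath) : p = q :=
  (T.isTree.existsUnique_path u v).unique hp hq

lemma mem_path_iff_support {u v x : V} {p : T.G.Walk u v} (hp : p.IsPath) :
    x ∈ T.path u v ↔ x ∈ p.support := by
  constructor
  · rintro ⟨q, hq, hx⟩
    rwa [T.walk_unique hp hq]
  · exact fun h => ⟨p, hp, h⟩

lemma length_eq_dist {u v : V} {p : T.G.Walk u v} (hp : p.IsPath) : p.length = T.G.dist u v := by
  obtain ⟨q, hq, hl⟩ := (T.isTree.connected u v).exists_path_of_dist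
  rw [T.walk_unique hp hq, hl]

lemma dist_tri (u v w : V) : T.G.dist u w ≤ T.G.dist u v + T.G.dist v w :=
  T.isTree.connected.dist_triangle

lemma dist_eq_zero {u v : V} : T.G.dist u v = 0 ↔ u = v :=
  T.isTree.connected.dist_eq_zero_iff

lemma dist_adj {u v : V} (h : T.G.Adj u v) : T.G.dist u v = 1 :=
  SimpleGraph.dist_eq_one_iff_adj.2 h

lemma left_mem (u v : V) : u ∈ T.path u v := by
  obtain ⟨p, hp⟩ := T.exists_isPath u v
  exact ⟨p, hp, p.start_mem_support⟩

lemma right_mem (u v : V) : v ∈ T.path u v := by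
  obtain ⟨p, hp⟩ := T.exists_isPath u v
  exact ⟨p, hp, p.end_mem_support⟩

lemma path_comm (u v : V) : T.path u v = T.path v u := by
  ext x
  constructor
  · rintro ⟨p, hp, hx⟩
    exact ⟨p.reverse, hp.reverse, by simpa using hx⟩
  · rintro ⟨p, hp, hx⟩
    exact ⟨p.reverse, hp.reverse, by simpa using hx⟩

lemma mem_path_iff {u v x : V} :
    x ∈ T.path u v ↔ T.G.dist u x + T.G.dist x v = T.G.dist u v := by
  classical
  constructor
  · rintro ⟨p, hp, hx⟩
    have h := congrArg SimpleGraph.Walk.length (p.take_spec hx)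
    rw [SimpleGraph.Walk.length_append, T.length_eq_dist hp,
      T.length_eq_dist (hp.takeUntil hx), T.length_eq_dist (hp.dropUntil hx)] at h
    exact h
  · intro h
    obtain ⟨p, hp, hpl⟩ := (T.isTree.connected u x).exists_path_of_dist
    obtain ⟨q, hq, hql⟩ := (T.isTree.connected x v).exists_path_of_dist
    have hl : (p.append q).length = T.G.dist u v := by
      rw [SimpleGraph.Walk.length_append, hpl, hql, h]
    refine ⟨p.append q, SimpleGraph.Walk.isPath_of_length_eq_dist _ hl, ?_⟩
    simp

lemma mem_path_split {u v x y : V} (hx : x ∈ T.path u v) (hy : y ∈ T.path u v) :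
    y ∈ T.path u x ∨ y ∈ T.path x v := by
  classical
  obtain ⟨p, hp, hx⟩ := hx
  rw [T.mem_path_iff_support hp] at hy
  rw [← p.take_spec hx, SimpleGraph.Walk.mem_support_append_iff] at hy
  exact hy.imp (fun h => ⟨_, hp.takeUntil hx, h⟩) (fun h => ⟨_, hp.dropUntil hx, h⟩)

lemma mem_path_of_inter {u v m : V} (h : ∀ x ∈ T.path u m, x ∈ T.path m v → x = m) :
    m ∈ T.path u v := by
  obtain ⟨p, hp⟩ := T.exists_isPath u m
  obtain ⟨q, hq⟩ := T.exists_isPath m v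
  refine ⟨p.append q, ?_, by simp⟩
  rw [SimpleGraph.Walk.isPath_def, SimpleGraph.Walk.support_append, List.nodup_append]
  refine ⟨hp.support_nodup, hq.support_nodup.sublist (List.tail_sublist _), ?_⟩
  rintro a ha b hb rfl
  have ham := h a ⟨p, hp, ha⟩ ⟨q, hq, List.mem_of_mem_tail hb⟩
  have := hq.support_nodup
  rw [← SimpleGraph.Walk.cons_tail_support] at this
  exact (List.nodup_cons.1 this).1 (ham ▸ hb)

variable {T}

lemma path_self_eq {u x : V} (h : x ∈ T.path u u) : x = u := by
  rw [mem_path_iff, SimpleGraph.dist_self] at h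
  exact (T.dist_eq_zero.1 (by omega)).symm

lemma mem_path_comm {u v x : V} : x ∈ T.path u v ↔ x ∈ T.path v u := by rw [path_comm]

/-- If `u, y, x, v` lie in this order. -/
lemma btw_left {u v x y : V} (hx : x ∈ T.path u v) (hy : y ∈ T.path u x) :
    y ∈ T.path u v ∧ x ∈ T.path y v := by
  simp only [mem_path_iff] at *
  have := T.dist_tri y x v
  have := T.dist_tri u y v
  omega

lemma btw_right {u v x y : V} (hx : x ∈ T.path u v) (hy : y ∈ T.path x v) :
    y ∈ T.path u v ∧ x ∈ T.path u y := by
  simp only [mem_path_iff] at *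
  have := T.dist_tri u x y
  have := T.dist_tri u y v
  omega

lemma btw_antisymm {u x y : V} (hx : x ∈ T.path u y) (hy : y ∈ T.path u x) : x = y := by
  rw [mem_path_iff] at *
  rw [SimpleGraph.dist_comm (u := y)] at hy
  exact T.dist_eq_zero.1 (by omega)

lemma btw_inter {u v x y : V} (hx : x ∈ T.path u v) (hy : y ∈ T.path u x)
    (hy' : y ∈ T.path x v) : y = x :=
  btw_antisymm hy (btw_right hx hy').2

lemma btw_total {u v x y : V} (hx : x ∈ T.path u v) (hy : y ∈ T.path u v) :
    x ∈ T.path u y ∨ y ∈ T.path u x :=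
  (T.mem_path_split hx hy).symm.imp (fun h => (btw_right hx h).2) id

lemma btw_eq_of_dist {u v x y : V} (hx : x ∈ T.path u v) (hy : y ∈ T.path u v)
    (h : T.G.dist u x = T.G.dist u y) : x = y := by
  rcases btw_total hx hy with h' | h' <;> rw [mem_path_iff] at h'
  · exact T.dist_eq_zero.1 (by omega)
  · exact (T.dist_eq_zero.1 (by omega)).symm

lemma btw_of_dist_le {u v x y : V} (hx : x ∈ T.path u v) (hy : y ∈ T.path u v)
    (h : T.G.dist u x ≤ T.G.dist u y) : x ∈ T.path u y := by
  rcases btw_total hx hy with h' | h'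
  · exact h'
  · have h2 := h'
    rw [mem_path_iff] at h2
    rw [T.dist_eq_zero.1 (show T.G.dist y x = 0 by omega)]
    exact T.right_mem _ _

lemma path_union {u v x : V} (hx : x ∈ T.path u v) :
    T.path u v = T.path u x ∪ T.path x v := by
  ext y
  exact ⟨fun hy => T.mem_path_split hx hy,
    fun hy => hy.elim (fun h => (btw_left hx h).1) (fun h => (btw_right hx h).1)⟩

/-- Convexity. -/
lemma path_subset {u v x y : V} (hx : x ∈ T.path u v) (hy : y ∈ T.path u v) :
    T.path x y ⊆ T.path u v := by
  intro z hz
  rcases btw_total hx hy with h | h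
  · exact (btw_left hy (btw_right h hz).1).1
  · exact (btw_left hx (btw_right h (mem_path_comm.1 hz)).1).1

lemma path_subset_left {u v x : V} (hx : x ∈ T.path u v) : T.path u x ⊆ T.path u v :=
  path_subset (T.left_mem _ _) hx

lemma path_subset_right {u v x : V} (hx : x ∈ T.path u v) : T.path x v ⊆ T.path u v :=
  path_subset hx (T.right_mem _ _)

lemma mem_path_adj {u v x : V} (h : T.G.Adj u v) : x ∈ T.path u v ↔ x = u ∨ x = v := by
  constructor
  · intro hx
    rw [mem_path_iff, T.dist_adj h] at hx
    rcases Nat.eq_zero_or_pos (T.G.dist u x) with h0 | h0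
    · exact .inl (T.dist_eq_zero.1 h0).symm
    · exact .inr (T.dist_eq_zero.1 (by omega))
  · rintro (rfl | rfl)
    exacts [T.left_mem _ _, T.right_mem _ _]

lemma adj_dichotomy {u w : V} (h : T.G.Adj u w) (v : V) : w ∈ T.path u v ∨ u ∈ T.path w v := by
  rw [mem_path_iff, mem_path_iff, T.dist_adj h, T.dist_adj h.symm]
  have := T.isTree.dist_eq_dist_add_one_of_adj v h
  rw [SimpleGraph.dist_comm (u := v), SimpleGraph.dist_comm (u := v)] at this
  omega

lemma adj_not_both {u w : V} (h : T.G.Adj u w) (v : V) (h1 : w ∈ T.path u v)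
    (h2 : u ∈ T.path w v) : False := by
  rw [mem_path_iff, T.dist_adj h] at h1
  rw [mem_path_iff, T.dist_adj h.symm] at h2
  omega

variable (T) in
lemma exists_next {u v : V} (h : u ≠ v) : ∃ w, T.G.Adj u w ∧ w ∈ T.path u v := by
  obtain ⟨p, hp⟩ := T.exists_isPath u v
  cases p with
  | nil => exact absurd rfl h
  | cons hadj q => exact ⟨_, hadj, _, hp, by simp⟩

open Classical in
variable (T) in
/-- The vertex following `u` on the path from `u` to `v`. -/
noncomputable def nx (u v : V) : V :=
  -- With the value `u` when `u = v`, membership of `nx u v` in the path needs no hypothesis.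
  if h : u ≠ v then (T.exists_next h).choose else u

lemma nx_adj {u v : V} (h : u ≠ v) : T.G.Adj u (T.nx u v) := by
  rw [nx, dif_pos h]
  exact (T.exists_next h).choose_spec.1

lemma nx_mem (u v : V) : T.nx u v ∈ T.path u v := by
  by_cases h : u = v
  · rw [nx, dif_neg (by simpa using h)]
    exact T.left_mem _ _
  · rw [nx, dif_pos h]
    exact (T.exists_next h).choose_spec.2

lemma nx_unique {u v x : V} (h : T.G.Adj u x) (hx : x ∈ T.path u v) : x = T.nx u v := by
  have huv : u ≠ v := by
    rintro rfl
    exact h.ne (path_self_eq hx).symm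
  exact btw_eq_of_dist hx (nx_mem _ _) (by rw [T.dist_adj h, T.dist_adj (nx_adj huv)])

lemma nx_of_adj {u x : V} (h : T.G.Adj u x) : T.nx u x = x :=
  (nx_unique h (T.right_mem _ _)).symm

lemma nx_eq_of_mem {u v x : V} (hx : x ∈ T.path u v) (h : x ≠ u) : T.nx u x = T.nx u v :=
  nx_unique (nx_adj h.symm) (btw_left hx (nx_mem _ _)).1

/-- Together with `nx_ne`, this reduces betweenness to a comparison of first steps, the form in
which turns and divergences of paths are handled below. -/
lemma mem_of_nx_ne {m u v : V} (h : T.nx m u ≠ T.nx m v) : m ∈ T.path u v := by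
  apply T.mem_path_of_inter
  intro x hx hx'
  by_contra hxm
  exact h ((nx_eq_of_mem (mem_path_comm.1 hx) hxm).symm.trans (nx_eq_of_mem hx' hxm))

lemma nx_ne {m u v : V} (h : m ∈ T.path u v) (hu : m ≠ u) : T.nx m u ≠ T.nx m v := by
  intro he
  have h1 : T.nx m u ∈ T.path u m := mem_path_comm.1 (nx_mem _ _)
  have h2 : T.nx m u ∈ T.path m v := he ▸ nx_mem _ _
  exact (nx_adj hu).ne (btw_inter h h1 h2).symm

lemma nx_ne_self {u v : V} (h : u ≠ v) : T.nx u v ≠ u := (nx_adj h).ne'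

/-- Neighbours of a vertex within a path. -/
lemma nbr_in_path {u v y x : V} (hy : y ∈ T.path u v) (hx : x ∈ T.path u v) (h : T.G.Adj y x) :
    (y ≠ u ∧ x = T.nx y u) ∨ (y ≠ v ∧ x = T.nx y v) := by
  rcases T.mem_path_split hy hx with h' | h'
  · left
    refine ⟨?_, nx_unique h (mem_path_comm.1 h')⟩
    rintro rfl
    exact h.ne (path_self_eq h').symm
  · right
    refine ⟨?_, nx_unique h h'⟩
    rintro rfl
    exact h.ne (path_self_eq h').symm

lemma nx_mem_left {u v y : V} (hy : y ∈ T.path u v) : T.nx y u ∈ T.path u v :=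
  path_subset_left hy (mem_path_comm.1 (nx_mem _ _))

lemma nx_mem_right {u v y : V} (hy : y ∈ T.path u v) : T.nx y v ∈ T.path u v :=
  path_subset_right hy (nx_mem _ _)

lemma path_extend {u v z : V} (h : T.G.Adj v z) (hv : v ∈ T.path u z) :
    T.path u z = insert z (T.path u v) := by
  rw [path_union hv]
  ext y
  simp only [Set.mem_union, Set.mem_insert_iff, mem_path_adj h]
  constructor
  · rintro (h | rfl | rfl)
    exacts [.inr h, .inr (T.right_mem _ _), .inl rfl]
  · rintro (rfl | h)
    exacts [.inr (.inr rfl), .inl h]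

/-- The last common vertex of two paths starting at `u`. -/
lemma exists_median (u v w : V) : ∃ m, m ∈ T.path u v ∧ m ∈ T.path u w ∧ m ∈ T.path v w := by
  have hfin : ∃ n, ∃ m, m ∈ T.path u v ∧ m ∈ T.path u w ∧ T.G.dist m v = n :=
    ⟨_, u, T.left_mem _ _, T.left_mem _ _, rfl⟩
  classical
  obtain ⟨m, h1, h2, h3⟩ := Nat.find_spec hfin
  refine ⟨m, h1, h2, T.mem_path_of_inter ?_⟩
  intro x hx hx'
  have hx := mem_path_comm.1 hx
  have a1 := btw_right h1 hx
  have a2 := btw_right h2 hx'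
  have := Nat.find_min' hfin ⟨x, a1.1, a2.1, rfl⟩
  rw [mem_path_iff] at hx
  exact (T.dist_eq_zero.1 (by omega)).symm

lemma mem_and_endpoint {u v a b : V} (ha : a ∈ T.path u v) (hb : b ∈ T.path u v)
    (hu : u ∈ T.path a b) : u = a ∨ u = b := by
  rcases btw_total ha hb with h | h
  · left
    rw [mem_path_iff] at h hu
    rw [SimpleGraph.dist_comm (u := a)] at hu
    exact (T.dist_eq_zero.1 (by omega))
  · right
    rw [mem_path_iff] at h hu
    have := SimpleGraph.dist_comm (G := T.G) (u := a) (v := u)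
    have := SimpleGraph.dist_comm (G := T.G) (u := a) (v := b)
    exact (T.dist_eq_zero.1 (by omega))

lemma path_endpoints {u v a b : V} (h : T.path u v = T.path a b) :
    (u = a ∧ v = b) ∨ (u = b ∧ v = a) := by
  have hv : v ∈ T.path a b := h ▸ T.right_mem _ _
  have ha : a ∈ T.path u v := h ▸ T.left_mem _ _
  have hb : b ∈ T.path u v := h ▸ T.right_mem _ _
  rcases mem_and_endpoint ha hb (h ▸ T.left_mem _ _) with rfl | rfl
  · exact .inl ⟨rfl, btw_antisymm hv hb⟩
  · exact .inr ⟨rfl, btw_antisymm (mem_path_comm.1 hv) ha⟩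

/-- A nonempty convex subset of a path is a path. -/
lemma exists_path_of_convex [Finite V] {u v : V} {C : Set V} (hC : C ⊆ T.path u v)
    (hne : C.Nonempty) (hconv : ∀ x ∈ C, ∀ y ∈ C, T.path x y ⊆ C) :
    ∃ a b, a ∈ T.path u b ∧ b ∈ T.path u v ∧ C = T.path a b := by
  obtain ⟨a, ha, hmin⟩ := Set.exists_min_image C (fun x => T.G.dist u x) (Set.toFinite _) hne
  obtain ⟨b, hb, hmax⟩ := Set.exists_max_image C (fun x => T.G.dist u x) (Set.toFinite _) hne
  have hab := btw_of_dist_le (hC ha) (hC hb) (hmin b hb)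
  refine ⟨a, b, hab, hC hb, Set.Subset.antisymm ?_ (hconv _ ha _ hb)⟩
  intro x hx
  have h1 := btw_of_dist_le (hC hx) (hC hb) (hmax x hx)
  have h2 := btw_of_dist_le (hC ha) (hC hx) (hmin x hx)
  exact (btw_left h1 h2).2

lemma path_order {u v x y : V} (hx : x ∈ T.path u v) (hy : y ∈ T.path u v) :
    ∃ a b, a ∈ T.path u b ∧ b ∈ T.path u v ∧ T.path x y = T.path a b ∧
      ((a = x ∧ b = y) ∨ (a = y ∧ b = x)) := by
  rcases btw_total hx hy with h | h
  · exact ⟨x, y, h, hy, rfl, .inl ⟨rfl, rfl⟩⟩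
  · exact ⟨y, x, h, hx, path_comm .., .inr ⟨rfl, rfl⟩⟩

lemma inter_convex {u v u' v' : V} : ∀ x ∈ T.path u v ∩ T.path u' v',
    ∀ y ∈ T.path u v ∩ T.path u' v', T.path x y ⊆ T.path u v ∩ T.path u' v' :=
  fun _ hx _ hy => Set.subset_inter (path_subset hx.1 hy.1) (path_subset hx.2 hy.2)

/-! ### Rotations at vertices -/

lemma cw_adj {y x : V} (h : T.G.Adj y x) : T.G.Adj y (T.cw y x) :=
  (T.cw_cycle y).1.mapsTo h

lemma cw_pow_adj {y x : V} (h : T.G.Adj y x) (k : ℕ) : T.G.Adj y ((T.cw y ^ k) x) := by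
  induction k with
  | zero => exact h
  | succ k ih =>
    rw [pow_succ', Equiv.Perm.mul_apply]
    exact cw_adj ih

lemma exists_cw_pow [Finite V] {y x z : V} (hx : T.G.Adj y x) (hz : T.G.Adj y z) :
    ∃ k : ℕ, (T.cw y ^ k) x = z := by
  obtain ⟨k, hk⟩ := ((T.cw_cycle y).2 hx hz).exists_nat_pow_eq
  exact ⟨k, hk⟩

lemma exists_cw_eq {y x : V} (h : T.G.Adj y x) : ∃ z, T.G.Adj y z ∧ T.cw y z = x := by
  obtain ⟨z, hz, he⟩ := (T.cw_cycle y).1.surjOn h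
  exact ⟨z, hz, he⟩

lemma cw_ne [Finite V] {y x : V} (hy : ¬ T.IsLeaf y) (h : T.G.Adj y x) : T.cw y x ≠ x := by
  intro he
  have hs : T.G.neighborSet y ⊆ {x} := by
    intro z hz
    obtain ⟨k, rfl⟩ := exists_cw_pow h hz
    induction k with
    | zero => rfl
    | succ k ih =>
      rw [pow_succ', Equiv.Perm.mul_apply, Set.mem_singleton_iff.1 (ih (cw_pow_adj h k))]
      exact he
  have h1 := T.three_le_degree y hy
  have h2 := Set.ncard_le_ncard hs
  rw [Set.ncard_singleton] at h2
  omega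

/-- This is where degree three is needed rather than two: otherwise the rotation orbit `{x, cw y x}`
would contain every neighbour. -/
lemma cw_cw_ne [Finite V] {y x : V} (hy : ¬ T.IsLeaf y) (h : T.G.Adj y x) :
    T.cw y (T.cw y x) ≠ x := by
  intro he
  have hs : T.G.neighborSet y ⊆ {x, T.cw y x} := by
    intro z hz
    obtain ⟨k, rfl⟩ := exists_cw_pow h hz
    clear hz
    induction k with
    | zero => simp
    | succ k ih =>
      rw [pow_succ', Equiv.Perm.mul_apply]
      rcases ih with ih | ih
      · rw [ih]; simp
      · rw [Set.mem_singleton_iff.1 ih, he]; simp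
  have h1 := T.three_le_degree y hy
  have h2 := Set.ncard_le_ncard hs
  have h3 := Set.ncard_insert_le x {T.cw y x}
  rw [Set.ncard_singleton] at h3
  omega

lemma not_leaf_of_two {y x z : V} (hx : T.G.Adj y x) (hz : T.G.Adj y z) (h : x ≠ z) :
    ¬ T.IsLeaf y := by
  intro hl
  obtain ⟨w, hw⟩ := Set.ncard_eq_one.1 hl
  have h1 : x ∈ T.G.neighborSet y := hx
  have h2 : z ∈ T.G.neighborSet y := hz
  rw [hw] at h1 h2
  exact h (h1.trans h2.symm)

/-- A sharp turn is either a left turn or a right turn, never both. Most contradictions below end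
here. -/
lemma turn_not_both [Finite V] {y x z : V} (hx : T.G.Adj y x) (hz : T.G.Adj y z) (hne : x ≠ z)
    (h1 : T.cw y x = z) (h2 : T.cw y z = x) : False :=
  cw_cw_ne (not_leaf_of_two hx hz hne) hx (by rw [h1, h2])

lemma not_leaf_of_mem {u v y : V} (h : y ∈ T.path u v) (hu : y ≠ u) (hv : y ≠ v) :
    ¬ T.IsLeaf y :=
  not_leaf_of_two (nx_adj hu) (nx_adj hv) (nx_ne h hu)

/-! ### The mirror image -/

variable (T) in
/-- The mirror image of a plane tree. -/
def mirror : PlaneTree V where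
  G := T.G
  isTree := T.isTree
  cw v := (T.cw v)⁻¹
  cw_cycle v := (T.cw_cycle v).inv
  three_le_degree := T.three_le_degree

lemma mirror_cw {y x z : V} : T.mirror.cw y x = z ↔ T.cw y z = x := by
  change (T.cw y)⁻¹ x = z ↔ _
  rw [Equiv.Perm.inv_eq_iff_eq, eq_comm]

lemma mirror_path (u v : V) : T.mirror.path u v = T.path u v := rfl

lemma mirror_nx (u v : V) : T.mirror.nx u v = T.nx u v := rfl

lemma mirror_sharp {A : Set V} : T.mirror.Sharp A ↔ T.Sharp A := by
  simp only [Sharp, mirror_cw]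
  constructor <;> intro h y hy x hx z hz h1 h2 h3 <;> exact (h y hy x hx z hz h1 h2 h3).symm

lemma mirror_isSegment {s : Set V} : T.mirror.IsSegment s ↔ T.IsSegment s := by
  simp only [IsSegment, mirror_sharp]
  rfl

lemma mirror_isArc {s : Set V} : T.mirror.IsArc s ↔ T.IsArc s := by
  simp only [IsArc, mirror_sharp]
  rfl

/-! ### Sharp paths -/

lemma Sharp.mono {A B : Set V} (h : T.Sharp B) (hAB : A ⊆ B) : T.Sharp A :=
  fun y hy x hx z hz => h y (hAB hy) x (hAB hx) z (hAB hz)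

lemma sharp_path_iff {u v : V} : T.Sharp (T.path u v) ↔ ∀ y ∈ T.path u v, y ≠ u → y ≠ v →
    T.cw y (T.nx y u) = T.nx y v ∨ T.cw y (T.nx y v) = T.nx y u := by
  constructor
  · intro h y hy hu hv
    exact h y hy _ (nx_mem_left hy) _ (nx_mem_right hy) (nx_adj hu) (nx_adj hv) (nx_ne hy hu)
  · intro h y hy x hx z hz hyx hyz hxz
    rcases nbr_in_path hy hx hyx with ⟨h1, rfl⟩ | ⟨h1, rfl⟩ <;>
    rcases nbr_in_path hy hz hyz with ⟨h2, rfl⟩ | ⟨h2, rfl⟩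
    · exact absurd rfl hxz
    · exact h y hy h1 h2
    · exact (h y hy h2 h1).symm
    · exact absurd rfl hxz

lemma IsSegment.not_leaf {s : Set V} (h : T.IsSegment s) {y : V} (hy : y ∈ s) :
    ¬ T.IsLeaf y := by
  obtain ⟨u, v, -, hu, hv, rfl, -⟩ := h
  by_cases h1 : y = u
  · rwa [h1]
  by_cases h2 : y = v
  · rwa [h2]
  exact not_leaf_of_mem hy h1 h2

lemma IsSegment.sharp {s : Set V} (h : T.IsSegment s) : T.Sharp s := by
  obtain ⟨u, v, -, -, -, -, h⟩ := h
  exact h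

lemma isSegment_path {u v : V} : T.IsSegment (T.path u v) ↔
    u ≠ v ∧ ¬ T.IsLeaf u ∧ ¬ T.IsLeaf v ∧ T.Sharp (T.path u v) := by
  constructor
  · intro h
    refine ⟨?_, h.not_leaf (T.left_mem _ _), h.not_leaf (T.right_mem _ _), h.sharp⟩
    rintro rfl
    obtain ⟨a, b, hab, -, -, he, -⟩ := h
    rcases path_endpoints he with ⟨rfl, rfl⟩ | ⟨rfl, rfl⟩ <;> exact hab rfl
  · rintro ⟨h1, h2, h3, h4⟩
    exact ⟨u, v, h1, h2, h3, rfl, h4⟩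

lemma IsSegment.ne {u v : V} (h : T.IsSegment (T.path u v)) : u ≠ v := (isSegment_path.1 h).1

/-- Subpaths of segments are segments. -/
lemma IsSegment.sub {s : Set V} (h : T.IsSegment s) {x y : V} (hx : x ∈ s) (hy : y ∈ s)
    (hxy : x ≠ y) : T.IsSegment (T.path x y) := by
  have hs : T.path x y ⊆ s := by
    obtain ⟨u, v, -, -, -, rfl, -⟩ := h
    exact path_subset hx hy
  exact isSegment_path.2 ⟨hxy, h.not_leaf hx, h.not_leaf hy, h.sharp.mono hs⟩

lemma exists_isSegment_ends {s : Set V} (h : T.IsSegment s) : ∃ u v, u ≠ v ∧ s = T.path u v := by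
  obtain ⟨u, v, hne, -, -, rfl, -⟩ := h
  exact ⟨u, v, hne, rfl⟩

lemma segment_in_path {w : Set V} (hw : T.IsSegment w) {u v : V} (h : w ⊆ T.path u v) :
    ∃ a b, a ≠ b ∧ a ∈ T.path u b ∧ b ∈ T.path u v ∧ w = T.path a b := by
  obtain ⟨x, y, hne, rfl⟩ := exists_isSegment_ends hw
  obtain ⟨a, b, h1, h2, h3, h4⟩ := path_order (h (T.left_mem x y)) (h (T.right_mem x y))
  refine ⟨a, b, ?_, h1, h2, h3⟩
  rcases h4 with ⟨rfl, rfl⟩ | ⟨rfl, rfl⟩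
  exacts [hne, hne.symm]

/-! ### Quotient and sub subpaths -/

variable (T) in
/-- `s` leaves its subpath `w` to the left at every end of `w` which is not an end of `s`. -/
def Quo (w s : Set V) : Prop :=
  w ⊆ s ∧ ∀ y ∈ w, ∀ x ∈ w, ∀ z ∈ s, z ∉ w → T.G.Adj y x → T.G.Adj y z → T.cw y x = z

variable (T) in
/-- `s` leaves its subpath `w` to the right at every end of `w` which is not an end of `s`. -/
def Sub (w s : Set V) : Prop :=
  w ⊆ s ∧ ∀ y ∈ w, ∀ x ∈ w, ∀ z ∈ s, z ∉ w → T.G.Adj y x → T.G.Adj y z → T.cw y z = x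

variable (T) in
/-- There is a subpath common to `s` and `t` which `s` leaves to the left and `t` to the right. -/
def Hom (s t : Set V) : Prop := ∃ w, T.IsSegment w ∧ T.Quo w s ∧ T.Sub w t

lemma mirror_quo {w s : Set V} : T.mirror.Quo w s ↔ T.Sub w s := by
  simp only [Quo, Sub, mirror_cw]
  rfl

lemma mirror_sub {w s : Set V} : T.mirror.Sub w s ↔ T.Quo w s := by
  simp only [Quo, Sub, mirror_cw]
  rfl

lemma mirror_hom {s t : Set V} : T.mirror.Hom s t ↔ T.Hom t s := by
  simp only [Hom, mirror_quo, mirror_sub, mirror_isSegment]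
  exact exists_congr fun w => ⟨fun h => ⟨h.1, h.2.2, h.2.1⟩, fun h => ⟨h.1, h.2.2, h.2.1⟩⟩

lemma Quo.refl (w : Set V) : T.Quo w w :=
  ⟨subset_rfl, fun _ _ _ _ _ h h' => absurd h h'⟩

lemma Sub.refl (w : Set V) : T.Sub w w :=
  ⟨subset_rfl, fun _ _ _ _ _ h h' => absurd h h'⟩

lemma Quo.trans {w s t : Set V} (h : T.Quo w s) (h' : T.Quo s t) : T.Quo w t := by
  refine ⟨h.1.trans h'.1, fun y hy x hx z hz hzw hyx hyz => ?_⟩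
  by_cases hzs : z ∈ s
  · exact h.2 y hy x hx z hzs hzw hyx hyz
  · exact h'.2 y (h.1 hy) x (h.1 hx) z hz hzs hyx hyz

lemma Sub.trans {w s t : Set V} (h : T.Sub w s) (h' : T.Sub s t) : T.Sub w t :=
  mirror_quo.1 ((mirror_quo.2 h).trans (mirror_quo.2 h'))

lemma Quo.restrict {w s t : Set V} (h : T.Quo w t) (hs : s ⊆ t) (hw : w ⊆ s) : T.Quo w s :=
  ⟨hw, fun y hy x hx z hz => h.2 y hy x hx z (hs hz)⟩

lemma Sub.restrict {w s t : Set V} (h : T.Sub w t) (hs : s ⊆ t) (hw : w ⊆ s) : T.Sub w s :=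
  ⟨hw, fun y hy x hx z hz => h.2 y hy x hx z (hs hz)⟩

/-- Precomposition with the quotient map from `s` to `s'`. -/
lemma Hom.of_quo {s s' t : Set V} (h : T.Quo s' s) (h' : T.Hom s' t) : T.Hom s t := by
  obtain ⟨w, h1, h2, h3⟩ := h'
  exact ⟨w, h1, h2.trans h, h3⟩

lemma Hom.of_sub {s t' t : Set V} (h : T.Sub t' t) (h' : T.Hom s t') : T.Hom s t := by
  obtain ⟨w, h1, h2, h3⟩ := h'
  exact ⟨w, h1, h2, h3.trans h⟩

lemma Hom.refl {s : Set V} (h : T.IsSegment s) : T.Hom s s := ⟨s, h, .refl _, .refl _⟩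

/-- A proper subpath is left by some edge. -/
lemma exists_leaving {w : Set V} {u v a : V} (ha : a ∈ w) (hw : w ⊆ T.path u v)
    (hne : w ≠ T.path u v) : ∃ y ∈ w, ∃ z ∈ T.path u v, z ∉ w ∧ T.G.Adj y z := by
  obtain ⟨b, hb, hbw⟩ : ∃ b ∈ T.path u v, b ∉ w := by
    by_contra hcon
    push Not at hcon
    exact hne (hw.antisymm hcon)
  obtain ⟨n, hn⟩ : ∃ n, n = T.G.dist a b := ⟨_, rfl⟩
  induction n generalizing a with
  | zero => exact absurd (T.dist_eq_zero.1 hn.symm ▸ ha) hbw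
  | succ n ih =>
    have hab : a ≠ b := fun h => hbw (h ▸ ha)
    have hmem := nx_mem (T := T) a b
    by_cases h : T.nx a b ∈ w
    · refine ih h ?_
      rw [mem_path_iff, T.dist_adj (nx_adj hab)] at hmem
      omega
    · exact ⟨a, ha, _, path_subset (hw ha) hb hmem, h, nx_adj hab⟩

lemma exists_nbr_mem {w : Set V} (hw : T.IsSegment w) {y : V} (hy : y ∈ w) :
    ∃ x ∈ w, T.G.Adj y x := by
  obtain ⟨u, v, hne, rfl⟩ := exists_isSegment_ends hw
  by_cases h : y = u
  · subst h
    exact ⟨_, nx_mem _ _, nx_adj hne⟩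
  · exact ⟨_, nx_mem_left hy, nx_adj h⟩

/-- A common subpath which is both left to the left and to the right is the whole path. -/
lemma quo_sub_eq [Finite V] {w : Set V} {u v : V} (hw : T.IsSegment w)
    (h1 : T.Quo w (T.path u v)) (h2 : T.Sub w (T.path u v)) : w = T.path u v := by
  by_contra hne
  obtain ⟨a, b, -, rfl⟩ := exists_isSegment_ends hw
  obtain ⟨y, hy, z, hz, hzw, hyz⟩ := exists_leaving (T.left_mem _ _) h1.1 hne
  obtain ⟨x, hx, hyx⟩ := exists_nbr_mem hw hy
  exact turn_not_both hyx hyz (fun h => hzw (h ▸ hx)) (h1.2 y hy x hx z hz hzw hyx hyz)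
    (h2.2 y hy x hx z hz hzw hyx hyz)

/-- Only the two ends of the subpath carry a condition, since an edge of the long path that leaves
the subpath must start at one of them. -/
lemma quo_path_iff {u v a b : V} (ha : a ∈ T.path u b) (hb : b ∈ T.path u v) (hab : a ≠ b) :
    T.Quo (T.path a b) (T.path u v) ↔ (a ≠ u → T.cw a (T.nx a b) = T.nx a u) ∧
      (b ≠ v → T.cw b (T.nx b a) = T.nx b v) := by
  have hav := btw_left hb ha
  constructor
  · intro h
    constructor
    · intro hau
      refine h.2 a (T.left_mem _ _) _ (nx_mem _ _) _ (nx_mem_left hav.1) ?_ (nx_adj hab)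
        (nx_adj hau)
      intro hmem
      exact nx_ne ha hau (nx_unique (nx_adj hau) hmem)
    · intro hbv
      refine h.2 b (T.right_mem _ _) _ (mem_path_comm.1 (nx_mem _ _)) _ (nx_mem_right hb) ?_
        (nx_adj hab.symm) (nx_adj hbv)
      intro hmem
      exact nx_ne hav.2 hab.symm (nx_unique (nx_adj hbv) (mem_path_comm.1 hmem)).symm
  · rintro ⟨h1, h2⟩
    refine ⟨path_subset hav.1 hb, fun y hy x hx z hz hzw hyx hyz => ?_⟩
    have hyuv := path_subset hav.1 hb hy
    rcases nbr_in_path hyuv hz hyz with ⟨hyu, rfl⟩ | ⟨hyv, rfl⟩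
    · have hya : y = a := by
        by_contra hya
        apply hzw
        rw [← nx_eq_of_mem (mem_path_comm.1 (btw_right ha hy).2) (Ne.symm hya)]
        exact nx_mem_left hy
      subst hya
      rw [nx_unique hyx hx]
      exact h1 hyu
    · have hyb : y = b := by
        by_contra hyb
        apply hzw
        rw [← nx_eq_of_mem (btw_left hav.2 hy).2 (Ne.symm hyb)]
        exact nx_mem_right hy
      subst hyb
      rw [nx_unique hyx (mem_path_comm.1 hx)]
      exact h2 hyv

lemma sub_path_iff {u v a b : V} (ha : a ∈ T.path u b) (hb : b ∈ T.path u v) (hab : a ≠ b) :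
    T.Sub (T.path a b) (T.path u v) ↔ (a ≠ u → T.cw a (T.nx a u) = T.nx a b) ∧
      (b ≠ v → T.cw b (T.nx b v) = T.nx b a) := by
  have h := quo_path_iff (T := T.mirror) ha hb hab
  simp only [mirror_cw, mirror_nx, mirror_quo, mirror_path] at h
  exact h

/-- A subpath split at one of its inner vertices. -/
lemma split_quo_sub {a b v : V} (hs : T.Sharp (T.path a b)) (hv : v ∈ T.path a b) (hva : v ≠ a)
    (hvb : v ≠ b) :
    (T.Quo (T.path a v) (T.path a b) ∧ T.Sub (T.path v b) (T.path a b)) ∨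
    (T.Sub (T.path a v) (T.path a b) ∧ T.Quo (T.path v b) (T.path a b)) := by
  rw [quo_path_iff (T.left_mem a v) hv hva.symm, sub_path_iff (T.left_mem a v) hv hva.symm,
    quo_path_iff hv (T.right_mem a b) hvb, sub_path_iff hv (T.right_mem a b) hvb]
  rcases sharp_path_iff.1 hs v hv hva hvb with h | h <;> simp [h]

/-! ### Torsion pairs of segments -/

variable (T) in
/-- A pair of sets of segments which are orthogonal complements of each other for `Hom`. -/
@[ext] structure TorsionPair where
  X : Set (Set V)
  Y : Set (Set V)
  mem_X : ∀ s, s ∈ X ↔ T.IsSegment s ∧ ∀ t ∈ Y, ¬ T.Hom s t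
  mem_Y : ∀ t, t ∈ Y ↔ T.IsSegment t ∧ ∀ s ∈ X, ¬ T.Hom s t

namespace TorsionPair

/-- The mirror image exchanges the two parts of a torsion pair. -/
def mirror (τ : T.TorsionPair) : T.mirror.TorsionPair where
  X := τ.Y
  Y := τ.X
  mem_X s := by simpa only [mirror_isSegment, mirror_hom] using τ.mem_Y s
  mem_Y s := by simpa only [mirror_isSegment, mirror_hom] using τ.mem_X s

/-- The inverse of `mirror`. -/
def ofMirror (τ : T.mirror.TorsionPair) : T.TorsionPair where
  X := τ.Y
  Y := τ.X
  mem_X s := by simpa only [mirror_isSegment, mirror_hom] using τ.mem_Y s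
  mem_Y s := by simpa only [mirror_isSegment, mirror_hom] using τ.mem_X s

variable {τ τ' σ : T.TorsionPair} {s t w : Set V}

lemma seg_X (h : s ∈ τ.X) : T.IsSegment s := ((τ.mem_X s).1 h).1

lemma seg_Y (h : s ∈ τ.Y) : T.IsSegment s := ((τ.mem_Y s).1 h).1

lemma not_hom (hs : s ∈ τ.X) (ht : t ∈ τ.Y) : ¬ T.Hom s t := ((τ.mem_X s).1 hs).2 t ht

lemma disj (hs : s ∈ τ.X) (ht : s ∈ τ.Y) : False := not_hom hs ht (.refl (seg_X hs))

lemma quo_mem (hs : s ∈ τ.X) (hw : T.IsSegment w) (h : T.Quo w s) : w ∈ τ.X :=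
  (τ.mem_X w).2 ⟨hw, fun _ ht h' => not_hom hs ht (h'.of_quo h)⟩

lemma sub_mem (hs : s ∈ τ.Y) (hw : T.IsSegment w) (h : T.Sub w s) : w ∈ τ.Y :=
  (τ.mem_Y w).2 ⟨hw, fun _ ht h' => not_hom ht hs (h'.of_sub h)⟩

/-- The image of a nonzero map from `s` to an element of `Y` is a quotient of `s`, and it lies in
`Y` because `Y` is closed under subs. -/
lemma exists_quo (hs : T.IsSegment s) (h : s ∉ τ.X) : ∃ w ∈ τ.Y, T.Quo w s := by
  by_contra hcon
  push Not at hcon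
  refine h ((τ.mem_X s).2 ⟨hs, ?_⟩)
  rintro t ht ⟨w, hw, h1, h2⟩
  exact hcon w (sub_mem ht hw h2) h1

lemma exists_sub (hs : T.IsSegment s) (h : s ∉ τ.Y) : ∃ w ∈ τ.X, T.Sub w s := by
  obtain ⟨w, hw, h1⟩ := exists_quo (τ := τ.mirror) (mirror_isSegment.2 hs) h
  exact ⟨w, hw, mirror_quo.1 h1⟩

/-- The part `X` of a torsion pair is closed under concatenation. -/
lemma concat_X {u v x : V} (hx : x ∈ T.path u v) (h1 : T.path u x ∈ τ.X)
    (h2 : T.path x v ∈ τ.X) (hs : T.IsSegment (T.path u v)) : T.path u v ∈ τ.X := by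
  refine (τ.mem_X _).2 ⟨hs, ?_⟩
  rintro t ht ⟨w, hw, hq, hsub⟩
  obtain ⟨a, b, hab, ha, hb, rfl⟩ := segment_in_path hw hq.1
  have hau := (btw_left hb ha).1
  have hbv := (btw_left hb ha).2
  have hq' := (quo_path_iff ha hb hab).1 hq
  by_cases hbx : b ∈ T.path u x
  · exact not_hom h1 ht ⟨_, hw, hq.restrict (path_subset_left hx)
      (path_subset (btw_left hbx ha).1 hbx), hsub⟩
  have hxb : x ∈ T.path u b := (btw_total hx hb).resolve_right hbx
  by_cases hxa : x ∈ T.path u a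
  · exact not_hom h2 ht ⟨_, hw, hq.restrict (path_subset_right hx)
      (path_subset (btw_left hau hxa).2 (btw_left hb hxb).2), hsub⟩
  have hax : a ∈ T.path u x := (btw_total hau hx).resolve_right hxa
  have hxab : x ∈ T.path a b := (btw_left hxb hax).2
  have hxa' : x ≠ a := fun h => hxa (h ▸ T.right_mem _ _)
  have hxb' : x ≠ b := fun h => hbx (h ▸ T.right_mem _ _)
  -- Now `w` runs across `x`. One of its halves at `x` is a sub of `w`, hence of `t`. Within its
  -- factor this half ends at the endpoint `x`, so it is also a quotient of that factor, which gives
  -- a forbidden map.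
  rcases split_quo_sub hw.sharp hxab hxa' hxb' with ⟨-, h⟩ | ⟨h, -⟩
  · refine not_hom h2 ht ⟨T.path x b, hw.sub hxab (T.right_mem _ _) hxb', ?_, h.trans hsub⟩
    rw [quo_path_iff (T.left_mem _ _) (btw_left hb hxb).2 hxb']
    refine ⟨fun h => absurd rfl h, fun h' => ?_⟩
    rw [← hq'.2 h', ← nx_eq_of_mem (mem_path_comm.1 hxab) hxb']
  · refine not_hom h1 ht ⟨T.path a x, hw.sub (T.left_mem _ _) hxab hxa'.symm, ?_, h.trans hsub⟩
    rw [quo_path_iff hax (T.right_mem _ _) hxa'.symm]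
    refine ⟨fun h' => ?_, fun h => absurd rfl h⟩
    rw [← hq'.1 h', ← nx_eq_of_mem hxab hxa']

lemma concat_Y {u v x : V} (hx : x ∈ T.path u v) (h1 : T.path u x ∈ τ.Y)
    (h2 : T.path x v ∈ τ.Y) (hs : T.IsSegment (T.path u v)) : T.path u v ∈ τ.Y :=
  concat_X (τ := τ.mirror) hx h1 h2 (mirror_isSegment.2 hs)

/-! ### The lattice of torsion pairs -/

lemma Y_subset_of_X (h : τ.X ⊆ τ'.X) : τ'.Y ⊆ τ.Y := fun t ht =>
  (τ.mem_Y t).2 ⟨seg_Y ht, fun _ hs => not_hom (h hs) ht⟩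

lemma X_subset_of_Y (h : τ'.Y ⊆ τ.Y) : τ.X ⊆ τ'.X := fun t ht =>
  (τ'.mem_X t).2 ⟨seg_X ht, fun _ hs => not_hom ht (h hs)⟩

lemma eq_of_X (h : τ.X = τ'.X) : τ = τ' :=
  TorsionPair.ext h ((Y_subset_of_X h.ge).antisymm (Y_subset_of_X h.le))

instance : PartialOrder T.TorsionPair :=
  PartialOrder.lift (fun τ => τ.X) (fun _ _ h => eq_of_X h)

lemma le_iff : τ ≤ τ' ↔ τ.X ⊆ τ'.X := Iff.rfl

lemma le_iff_Y : τ ≤ τ' ↔ τ'.Y ⊆ τ.Y := ⟨Y_subset_of_X, X_subset_of_Y⟩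

instance [Finite V] : Finite T.TorsionPair :=
  Finite.of_injective (fun τ => τ.X) (fun _ _ h => eq_of_X h)

/-- A segment of `τ.X` outside `τ'.X` has a quotient in `τ'.Y`, which stays in `τ.X`. This is the
source of the labels. -/
lemma exists_inter (h : ¬ τ ≤ τ') : ∃ w, w ∈ τ.X ∧ w ∈ τ'.Y := by
  obtain ⟨s, hs, hs'⟩ := Set.not_subset.1 h
  obtain ⟨w, hw, hq⟩ := exists_quo (seg_X hs) hs'
  exact ⟨w, quo_mem hs (seg_Y hw) hq, hw⟩

/-- The largest torsion pair whose part `Y` contains `S`. -/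
def ofY (S : Set (Set V)) (hS : ∀ s ∈ S, T.IsSegment s) : T.TorsionPair where
  X := {s | T.IsSegment s ∧ ∀ t ∈ S, ¬ T.Hom s t}
  Y := {t | T.IsSegment t ∧ ∀ s, T.IsSegment s ∧ (∀ t ∈ S, ¬ T.Hom s t) → ¬ T.Hom s t}
  mem_X s := ⟨fun h => ⟨h.1, fun _ ht => ht.2 s h⟩, fun h => ⟨h.1, fun t ht =>
    h.2 t ⟨hS t ht, fun _ hs' => hs'.2 t ht⟩⟩⟩
  mem_Y _ := Iff.rfl

lemma le_ofY {S : Set (Set V)} {hS : ∀ s ∈ S, T.IsSegment s} : τ ≤ ofY S hS ↔ S ⊆ τ.Y := by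
  constructor
  · exact fun h t ht => le_iff_Y.1 h ⟨hS t ht, fun s hs => hs.2 t ht⟩
  · exact fun h s hs => ⟨seg_X hs, fun t ht => not_hom hs (h ht)⟩

lemma subset_ofY {S : Set (Set V)} {hS : ∀ s ∈ S, T.IsSegment s} : S ⊆ (ofY S hS).Y :=
  le_ofY.1 le_rfl

/-- The smallest torsion pair whose part `X` contains `S`. -/
def ofX (S : Set (Set V)) (hS : ∀ s ∈ S, T.IsSegment s) : T.TorsionPair :=
  ofMirror (ofY (T := T.mirror) S fun s hs => mirror_isSegment.2 (hS s hs))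

lemma ofX_le {S : Set (Set V)} {hS : ∀ s ∈ S, T.IsSegment s} : ofX S hS ≤ τ ↔ S ⊆ τ.X := by
  rw [le_iff_Y]
  exact le_ofY (τ := τ.mirror) (hS := fun s hs => mirror_isSegment.2 (hS s hs))

lemma subset_ofX {S : Set (Set V)} {hS : ∀ s ∈ S, T.IsSegment s} : S ⊆ (ofX S hS).X :=
  ofX_le.1 le_rfl

lemma mem_ofX_Y {S : Set (Set V)} {hS : ∀ s ∈ S, T.IsSegment s} :
    t ∈ (ofX S hS).Y ↔ T.IsSegment t ∧ ∀ s ∈ S, ¬ T.Hom s t := by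
  change (T.mirror.IsSegment t ∧ ∀ s ∈ S, ¬ T.mirror.Hom t s) ↔ _
  simp only [mirror_isSegment, mirror_hom]

/-- A segment orthogonal to the union of all the `Y` is one lying in all the `X`, so meets are
computed by intersecting the parts `X`. -/
lemma exists_isGLB (S : Set T.TorsionPair) :
    ∃ m, IsGLB S m ∧ ∀ s, s ∈ m.X ↔ T.IsSegment s ∧ ∀ τ ∈ S, s ∈ τ.X := by
  refine ⟨ofY (⋃ τ ∈ S, τ.Y) ?_, ⟨?_, ?_⟩, ?_⟩
  · simp only [Set.mem_iUnion]
    rintro s ⟨τ, -, h⟩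
    exact seg_Y h
  · intro τ hτ
    exact le_iff_Y.2 ((Set.subset_biUnion_of_mem (u := fun τ : T.TorsionPair => τ.Y) hτ).trans
      subset_ofY)
  · intro τ hτ
    rw [le_ofY]
    exact Set.iUnion₂_subset fun σ hσ => le_iff_Y.1 (hτ hσ)
  · intro s
    simp only [ofY, Set.mem_iUnion, Set.mem_ofPred_eq]
    refine and_congr_right fun hs => ⟨fun h τ hτ => (τ.mem_X s).2 ⟨hs, fun t ht =>
      h t ⟨τ, hτ, ht⟩⟩, ?_⟩
    rintro h t ⟨τ, hτ, ht⟩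
    exact not_hom (h τ hτ) ht

lemma exists_isLUB (S : Set T.TorsionPair) : ∃ m, IsLUB S m := by
  refine ⟨ofX (⋃ τ ∈ S, τ.X) ?_, ?_, ?_⟩
  · simp only [Set.mem_iUnion]
    rintro s ⟨τ, -, h⟩
    exact seg_X h
  · intro τ hτ
    exact le_iff.2 ((Set.subset_biUnion_of_mem (u := fun τ : T.TorsionPair => τ.X) hτ).trans
      subset_ofX)
  · intro τ hτ
    rw [ofX_le]
    exact Set.iUnion₂_subset fun σ hσ => hτ hσ

lemma mirror_le : τ'.mirror ≤ τ.mirror ↔ τ ≤ τ' := le_iff_Y.symm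

lemma mirror_covBy (h : τ ⋖ τ') : τ'.mirror ⋖ τ.mirror := by
  rw [covBy_iff_lt_and_eq_or_eq, lt_iff_le_not_ge] at h ⊢
  simp only [mirror_le]
  refine ⟨h.1, fun σ h1 h2 => ?_⟩
  exact (h.2 (ofMirror σ) (mirror_le.1 h2) (mirror_le.1 h1)).symm.imp
    (congrArg mirror) (congrArg mirror)

/-- The torsion pair generated by those `t ∈ τ.Y` that receive no map from `w` lies between `τ` and
`τ'` and has `w` in its part `X`, so it is `τ'`. Hence `w` must map to `s`, and the image cannot be
a proper quotient of `w`, as it would lie in both `τ.X` and `τ.Y`. -/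
lemma sub_of_covBy (h : τ ⋖ τ') (hw : w ∈ τ'.X)
    (hmin : ∀ w', T.IsSegment w' → T.Quo w' w → w' ≠ w → w' ∈ τ.X) (hwX : w ∉ τ.X)
    (hs : s ∈ τ'.X) (hs' : s ∈ τ.Y) : T.Sub w s := by
  by_contra hns
  have hseg : ∀ t ∈ τ.Y ∩ {t | ¬ T.Hom w t}, T.IsSegment t := fun t ht => seg_Y ht.1
  have h1 : τ ≤ ofY _ hseg := le_ofY.2 Set.inter_subset_left
  have hY : τ'.Y ⊆ τ.Y := le_iff_Y.1 h.le
  have h2 : ofY _ hseg ≤ τ' :=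
    le_iff_Y.2 fun t ht => subset_ofY ⟨hY ht, not_hom hw ht⟩
  have h3 : w ∈ (ofY _ hseg).X := ⟨seg_X hw, fun t ht => ht.2⟩
  rcases (covBy_iff_lt_and_eq_or_eq.1 h).2 _ h1 h2 with h4 | h4
  · rw [h4] at h3
    exact hwX h3
  · rw [← h4] at hs
    by_cases hh : T.Hom w s
    · obtain ⟨w', hw', hq, hsub⟩ := hh
      by_cases he : w' = w
      · exact hns (he ▸ hsub)
      · exact disj (hmin w' hw' hq he) (sub_mem hs' hw' hsub)
    · exact not_hom hs (subset_ofY ⟨hs', hh⟩) (.refl (seg_Y hs'))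

/-- Covering relations of torsion pairs are labelled by segments. -/
lemma exists_label [Finite V] (h : τ ⋖ τ') : ∃ s, τ'.X ∩ τ.Y = {s} := by
  have hne : (τ'.X ∩ τ.Y).Nonempty := exists_inter h.lt.not_ge
  -- For a common segment with fewest vertices, minimality forces the proper quotients into `τ.X`
  -- and the proper subs into `τ'.Y`.
  obtain ⟨w, ⟨hwX, hwY⟩, hmin⟩ := Set.exists_min_image _ Set.ncard (Set.toFinite _) hne
  have hlt : ∀ {w' : Set V}, w' ⊆ w → w' ≠ w → w' ∈ τ'.X → w' ∈ τ.Y → False :=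
    fun h1 h2 h3 h4 => (hmin _ ⟨h3, h4⟩).not_gt
      (Set.ncard_lt_ncard (LE.le.ssubset_of_ne h1 h2))
  have hq : ∀ w', T.IsSegment w' → T.Quo w' w → w' ≠ w → w' ∈ τ.X := by
    intro w' hw' h1 h2
    by_contra h3
    obtain ⟨w'', h4, h5⟩ := exists_quo hw' h3
    refine hlt (h5.1.trans h1.1) ?_ (quo_mem hwX (seg_Y h4) (h5.trans h1)) h4
    rintro rfl
    exact h2 (h1.1.antisymm h5.1)
  have hs : ∀ w', T.IsSegment w' → T.Sub w' w → w' ≠ w → w' ∈ τ'.Y := by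
    intro w' hw' h1 h2
    by_contra h3
    obtain ⟨w'', h4, h5⟩ := exists_sub hw' h3
    refine hlt (h5.1.trans h1.1) ?_ h4 (sub_mem hwY (seg_X h4) (h5.trans h1))
    rintro rfl
    exact h2 (h1.1.antisymm h5.1)
  refine ⟨w, Set.Subset.antisymm ?_ (Set.singleton_subset_iff.2 ⟨hwX, hwY⟩)⟩
  rintro s ⟨hsX, hsY⟩
  -- Any other common segment `s` contains `w` both as a sub and, by reflection, as a quotient,
  -- which leaves only `s = w`.
  have h1 := sub_of_covBy h hwX hq (fun h' => disj h' hwY) hsX hsY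
  have h2 := sub_of_covBy (mirror_covBy h) (s := s) (w := w) hwY
    (fun w' h3 h4 h5 => hs w' (mirror_isSegment.1 h3) (mirror_quo.1 h4) h5)
    (fun h' => disj hwX h') hsY hsX
  rw [mirror_sub] at h2
  obtain ⟨u, v, -, rfl⟩ := exists_isSegment_ends (seg_X hsX)
  exact (quo_sub_eq (seg_X hwX) h2 h1).symm

/-- An element strictly in between would have common segments with both ends of the interval; each
of them would be `s`, so `s` would lie in both of its parts. -/
lemma covBy_of_label (h : τ ≤ τ') (hs : τ'.X ∩ τ.Y = {s}) : τ ⋖ τ' := by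
  have hmem : s ∈ τ'.X ∩ τ.Y := hs ▸ rfl
  refine ⟨lt_of_le_not_ge h fun h' => disj (h' hmem.1) hmem.2, fun σ h1 h2 => ?_⟩
  obtain ⟨w, hw, hw'⟩ := exists_inter h1.not_ge
  obtain ⟨z, hz, hz'⟩ := exists_inter h2.not_ge
  have e1 : w = s := hs.subset ⟨h2.le hw, hw'⟩
  have e2 : z = s := hs.subset ⟨hz, le_iff_Y.1 h1.le hz'⟩
  subst e1 e2
  exact disj hw hz'

/-- Every segment in the part `Y` of `τ` is the label of a covering relation above `τ`. -/
lemma exists_covBy_of_mem_Y [Finite V] (hs : s ∈ τ.Y) : ∃ w z : T.TorsionPair, τ ≤ w ∧ w ⋖ z ∧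
    z.X ∩ w.Y = {s} ∧ (∀ σ, τ ≤ σ → s ∈ σ.X → z ≤ σ) ∧ w.X = {x ∈ z.X | ¬ T.Hom x s} := by
  have hsegz : ∀ t ∈ τ.Y ∩ {t | ¬ T.Hom s t}, T.IsSegment t := fun t ht => seg_Y ht.1
  -- `z` is the smallest torsion pair above `τ` with `s` in `X`; below it, `w` is the largest one
  -- with `s` in `Y`.
  set z := ofY _ hsegz with hz
  have hsegw : ∀ t ∈ z.Y ∪ {s}, T.IsSegment t := by
    rintro t (ht | rfl)
    exacts [seg_Y ht, seg_Y hs]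
  set w := ofY _ hsegw with hw
  have hτz : τ ≤ z := le_ofY.2 Set.inter_subset_left
  have hτw : τ ≤ w := le_ofY.2 (Set.union_subset (le_iff_Y.1 hτz) (Set.singleton_subset_iff.2 hs))
  have hwz : w ≤ z := le_iff_Y.2 (Set.subset_union_left.trans subset_ofY)
  have hwX : w.X = {x ∈ z.X | ¬ T.Hom x s} := by
    ext x
    constructor
    · exact fun hx => ⟨hwz hx, hx.2 s (.inr rfl)⟩
    · rintro ⟨h1, h2⟩
      refine ⟨seg_X h1, ?_⟩
      rintro t (ht | rfl)
      exacts [not_hom h1 ht, h2]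
  have hsz : s ∈ z.X := ⟨seg_Y hs, fun t ht => ht.2⟩
  have hsw : s ∈ w.Y := subset_ofY (.inr rfl)
  have hlab : z.X ∩ w.Y = {s} := by
    refine Set.Subset.antisymm ?_ (Set.singleton_subset_iff.2 ⟨hsz, hsw⟩)
    rintro t ⟨htX, htY⟩
    have h1 : T.Hom s t := by
      by_contra hcon
      exact htX.2 t ⟨le_iff_Y.1 hτw htY, hcon⟩ (.refl (seg_Y htY))
    -- The image `s'` of a map from `s` to `t` maps back to `s`; the image of that map is a quotient
    -- and a sub of `s`, so `s' = s`. The same argument with a map from `t` to `s` gives `t = s`.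
    obtain ⟨s', hs', hq, hsub⟩ := h1
    have h2 : s' ∉ w.X := fun h => disj h (sub_mem htY hs' hsub)
    have h3 : T.Hom s' s := by
      by_contra hcon
      exact h2 (hwX ▸ ⟨quo_mem hsz hs' hq, hcon⟩)
    have hss' : s' = s := by
      obtain ⟨s'', h4, h5, h6⟩ := h3
      obtain ⟨u, v, -, rfl⟩ := exists_isSegment_ends (seg_Y hs)
      have := quo_sub_eq h4 (h5.trans hq) h6
      exact hq.1.antisymm (this ▸ h5.1)
    subst hss'
    have h4 : T.Hom t s' := by
      by_contra hcon
      exact disj (hwX ▸ ⟨htX, hcon⟩ : t ∈ w.X) htY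
    obtain ⟨t', h5, h6, h7⟩ := h4
    obtain ⟨u, v, -, rfl⟩ := exists_isSegment_ends (seg_Y htY)
    have := quo_sub_eq h5 h6 (h7.trans hsub)
    exact (this ▸ h7.1).antisymm hsub.1
  refine ⟨w, z, hτw, covBy_of_label hwz hlab, hlab, fun σ h1 h2 => ?_, hwX⟩
  exact le_iff_Y.2 fun t ht => subset_ofY ⟨le_iff_Y.1 h1 ht, not_hom h2 ht⟩

end TorsionPair

/-! ### Labels of covering relations and semibricks -/

variable (T) in
/-- A set of pairwise `Hom`-orthogonal segments. -/
def IsSemibrick (D : Set (Set V)) : Prop :=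
  (∀ s ∈ D, T.IsSegment s) ∧ ∀ s ∈ D, ∀ t ∈ D, s ≠ t → ¬ T.Hom s t

lemma mirror_isSemibrick {D : Set (Set V)} : T.mirror.IsSemibrick D ↔ T.IsSemibrick D := by
  simp only [IsSemibrick, mirror_isSegment, mirror_hom]
  exact and_congr_right fun _ => ⟨fun h s hs t ht hst => h t ht s hs hst.symm,
    fun h s hs t ht hst => h t ht s hs hst.symm⟩

namespace TorsionPair

variable {τ τ' σ σ' m : T.TorsionPair} {s t w : Set V} {D : Set (Set V)}

/-- The labels of the covering relations below `τ`. -/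
def lowerLab (τ : T.TorsionPair) : Set (Set V) := {s | ∃ σ, σ ⋖ τ ∧ τ.X ∩ σ.Y = {s}}

/-- The labels of the covering relations above `τ`. -/
def upperLab (τ : T.TorsionPair) : Set (Set V) := {s | ∃ σ, τ ⋖ σ ∧ σ.X ∩ τ.Y = {s}}

lemma mirror_lowerLab : τ.mirror.lowerLab = τ.upperLab := by
  ext s
  constructor
  · rintro ⟨σ, h1, h2⟩
    refine ⟨ofMirror σ, ?_, ?_⟩
    · exact covBy_of_label (mirror_le.1 h1.le) (by rw [Set.inter_comm]; exact h2)
    · rw [Set.inter_comm]; exact h2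
  · rintro ⟨σ, h1, h2⟩
    exact ⟨σ.mirror, mirror_covBy h1, by rw [Set.inter_comm]; exact h2⟩

/-- A quotient of `t` in `σ.Y` exists because `t ∉ σ.X`; it stays in `τ.X`, so it can only be the
label. -/
lemma quo_of_not_mem (h : τ.X ∩ σ.Y = {s}) (ht : t ∈ τ.X) (ht' : t ∉ σ.X) : T.Quo s t := by
  obtain ⟨w, hw, hq⟩ := exists_quo (seg_X ht) ht'
  obtain rfl : w = s := h.subset ⟨quo_mem ht (seg_Y hw) hq, hw⟩
  exact hq

lemma label_mem (h : τ.X ∩ σ.Y = {s}) : s ∈ τ.X ∧ s ∈ σ.Y := (h ▸ rfl : s ∈ τ.X ∩ σ.Y)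

/-- If a label `[a, b]` were a quotient of another label `[u, v]` with `a ≠ u`, the initial piece
`[u, a]` would be a sub of `[u, v]`, hence in `σ'.Y`. It is shown to lie in `τ.X` too, so it would
be a second label of the pair `σ'`, `τ`. -/
lemma lowerLab_orthogonal_aux {u v a b : V} (hσ : σ ⋖ τ) (hs : τ.X ∩ σ.Y = {T.path a b})
    (ht : τ.X ∩ σ'.Y = {T.path u v}) (hq : T.Quo (T.path a b) (T.path u v))
    (ha : a ∈ T.path u b) (hb : b ∈ T.path u v) (hab : a ≠ b) (hau : a ≠ u) : False := by
  have hsm := label_mem hs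
  have htm := label_mem ht
  have hseg := seg_X htm.1
  have hauv := (btw_left hb ha).1
  have habv := (btw_left hb ha).2
  have hq' := (quo_path_iff ha hb hab).1 hq
  have hk : T.IsSegment (T.path u a) := hseg.sub (T.left_mem _ _) hauv hau.symm
  have hkY : T.path u a ∈ σ'.Y := by
    refine sub_mem htm.2 hk ?_
    rw [sub_path_iff (T.left_mem _ _) hauv hau.symm]
    refine ⟨fun h => absurd rfl h, fun _ => ?_⟩
    rw [← nx_eq_of_mem habv hab.symm, hq'.1 hau]
  have hkX : T.path u a ∈ τ.X := by
    by_contra hcon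
    obtain ⟨w, hw, hwq⟩ := exists_quo hk hcon
    obtain ⟨e, f, hef, he, hf, rfl⟩ := segment_in_path (seg_Y hw) hwq.1
    have hwq' := (quo_path_iff he hf hef).1 hwq
    have hfuv := btw_left hauv hf
    -- A quotient `[e, f]` of `[u, a]` lying in `τ.Y` is excluded as follows. If it ends at `a`,
    -- then `[e, b]` is a quotient of `[u, v]` and a concatenation of elements of `σ.Y`, so it would
    -- be a second label of `σ ⋖ τ`. Otherwise it is a quotient of `[u, v]` itself and lies in
    -- `τ.X`.
    by_cases hfa : f = a
    · subst hfa
      have heb := btw_left ha he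
      have hr : T.IsSegment (T.path e b) :=
        hseg.sub (btw_left hfuv.1 he).1 hb (fun h => hef (btw_antisymm he (h ▸ ha)))
      have hrX : T.path e b ∈ τ.X := by
        refine quo_mem htm.1 hr ?_
        rw [quo_path_iff heb.1 hb hr.ne]
        constructor
        · intro h
          rw [← nx_eq_of_mem heb.2 hef.symm, hwq'.1 h]
        · intro h
          rw [← nx_eq_of_mem (mem_path_comm.1 heb.2) hab, hq'.2 h]
      have hrY : T.path e b ∈ σ.Y :=
        concat_Y heb.2 (le_iff_Y.1 hσ.le hw) hsm.2 hr
      rcases path_endpoints (hs.subset ⟨hrX, hrY⟩) with ⟨h, -⟩ | ⟨-, h⟩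
      · exact hef h
      · exact hab h.symm
    · refine disj (quo_mem htm.1 (seg_Y hw) ?_) hw
      rw [quo_path_iff he hfuv.1 hef]
      refine ⟨hwq'.1, fun _ => ?_⟩
      rw [hwq'.2 hfa, nx_eq_of_mem hfuv.2 (Ne.symm hfa)]
  rcases path_endpoints (ht.subset ⟨hkX, hkY⟩) with ⟨-, h⟩ | ⟨h, -⟩
  · subst h
    exact hab (btw_antisymm ha hb)
  · exact hseg.ne h

/-- A map from `t` to `s` puts `t` outside `σ.X`, so `s` is a proper quotient of `t`; it misses an
end of `t`, and the auxiliary lemma applies after possibly reversing both paths. -/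
lemma lowerLab_orthogonal (hs : s ∈ τ.lowerLab) (ht : t ∈ τ.lowerLab) (hst : s ≠ t) :
    ¬ T.Hom t s := by
  intro hh
  obtain ⟨σ, hσ, hs⟩ := hs
  obtain ⟨σ', -, ht⟩ := ht
  have hq := quo_of_not_mem hs (label_mem ht).1 (fun h => not_hom h (label_mem hs).2 hh)
  obtain ⟨u, v, huv, rfl⟩ := exists_isSegment_ends (seg_X (label_mem ht).1)
  obtain ⟨a, b, hab, ha, hb, rfl⟩ := segment_in_path (seg_X (label_mem hs).1) hq.1
  by_cases hau : a = u
  · subst hau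
    have hbv : b ≠ v := by
      rintro rfl
      exact hst rfl
    have h1 := btw_left hb ha
    rw [T.path_comm a b, T.path_comm a v] at hq
    rw [T.path_comm a b] at hs
    rw [T.path_comm a v] at ht
    exact lowerLab_orthogonal_aux hσ hs ht hq (mem_path_comm.1 hb) (T.right_mem _ _)
      hab.symm hbv
  · exact lowerLab_orthogonal_aux hσ hs ht hq ha hb hab hau

lemma lowerLab_isSemibrick : T.IsSemibrick τ.lowerLab :=
  ⟨fun _ ⟨_, _, h⟩ => seg_X (label_mem h).1, fun _ hs _ ht hst =>
    lowerLab_orthogonal ht hs hst.symm⟩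

lemma lowerLab_subset_X : τ.lowerLab ⊆ τ.X := fun _ ⟨_, _, h⟩ => (label_mem h).1

/-- A torsion pair is generated by its lower labels: otherwise the generated pair lies below some
lower cover `ρ` of `τ`, whose label would then belong to `ρ.X` as well as to `ρ.Y`. -/
lemma le_of_lowerLab_subset [Finite V] (h : τ.lowerLab ⊆ σ.X) : τ ≤ σ := by
  have h1 : ofX τ.lowerLab lowerLab_isSemibrick.1 ≤ τ := ofX_le.2 lowerLab_subset_X
  rcases h1.eq_or_lt with h2 | h2
  · rw [← h2]
    exact ofX_le.2 h
  · obtain ⟨ρ, h3, h4⟩ := exists_le_covBy_of_lt h2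
    obtain ⟨s, hs⟩ := exists_label h4
    exact (disj (h3 (subset_ofX ⟨ρ, h4, hs⟩)) (label_mem hs).2).elim

lemma lowerLab_injective [Finite V] : Function.Injective (lowerLab (T := T)) := fun _ _ h =>
  le_antisymm (le_of_lowerLab_subset (h ▸ lowerLab_subset_X))
    (le_of_lowerLab_subset (h ▸ lowerLab_subset_X))

/-- For `s ∈ D`, the torsion pair obtained by adding `s` to `τ.Y` keeps all other elements of `D` in
its part `X`, by orthogonality; so the smallest pair above it that recovers `s` is `τ`, and `s`
labels a cover below `τ`. Conversely, the label of a lower cover is a quotient of an element of `D`;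
both are lower labels, so orthogonality makes them equal. -/
lemma lowerLab_ofX [Finite V] (hD : T.IsSemibrick D) : (ofX D hD.1).lowerLab = D := by
  set τ := ofX D hD.1 with hτ
  have hDX : D ⊆ τ.X := subset_ofX
  have hsub : D ⊆ τ.lowerLab := by
    intro s hs
    have hseg : ∀ t ∈ τ.Y ∪ {s}, T.IsSegment t := by
      rintro t (ht | rfl)
      exacts [seg_Y ht, hD.1 _ hs]
    have h1 : ofY _ hseg ≤ τ := le_iff_Y.2 (Set.subset_union_left.trans subset_ofY)
    obtain ⟨w, z, h2, h3, h4, h5, -⟩ :=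
      exists_covBy_of_mem_Y (τ := ofY _ hseg) (subset_ofY (.inr rfl))
    have h6 : z = τ := by
      refine le_antisymm (h5 τ h1 (hDX hs)) (ofX_le.2 fun d hd => ?_)
      by_cases hds : d = s
      · exact hds ▸ (label_mem h4).1
      · refine (h2.trans h3.le) ⟨hD.1 d hd, ?_⟩
        rintro t (ht | rfl)
        · exact not_hom (hDX hd) ht
        · exact hD.2 d hd _ hs hds
    exact ⟨w, h6 ▸ h3, h6 ▸ h4⟩
  refine Set.Subset.antisymm ?_ hsub
  intro t ht
  have ht' := ht
  obtain ⟨σ, h1, h2⟩ := ht'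
  obtain ⟨d, hd, hdσ⟩ : ∃ d ∈ D, d ∉ σ.X := by
    by_contra hcon
    push Not at hcon
    exact h1.lt.not_ge (ofX_le.2 hcon)
  by_contra htD
  have hq := quo_of_not_mem h2 (hDX hd) hdσ
  refine lowerLab_orthogonal ht (hsub hd) (fun h => htD (h ▸ hd)) ?_
  exact ⟨t, seg_X (label_mem h2).1, hq, .refl _⟩

lemma upperLab_isSemibrick : T.IsSemibrick τ.upperLab := by
  rw [← mirror_lowerLab, ← mirror_isSemibrick]
  exact lowerLab_isSemibrick

lemma upperLab_injective [Finite V] : Function.Injective (upperLab (T := T)) := by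
  intro τ σ h
  rw [← mirror_lowerLab, ← mirror_lowerLab] at h
  exact congrArg ofMirror (lowerLab_injective h)

/-! ### The intervals below an element spanned by its lower covers -/

/-- An element of `τ.X` missing from the lower cover `σ` has the label of `σ` as a quotient.
Nonemptiness matters: the meet of the empty set of lower covers is the top element, not `τ`. -/
lemma isGLB_X [Finite V] (hm : IsGLB {σ | σ ⋖ τ} m) (h : τ.lowerLab.Nonempty) :
    m.X = {x ∈ τ.X | ∀ d ∈ τ.lowerLab, ¬ T.Hom x d} := by
  obtain ⟨m', hm', hX⟩ := exists_isGLB {σ | σ ⋖ τ}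
  rw [hm.unique hm']
  ext x
  rw [hX]
  constructor
  · rintro ⟨h1, h2⟩
    obtain ⟨-, σ, hσ, -⟩ := h
    refine ⟨hσ.le (h2 σ hσ), ?_⟩
    rintro d ⟨ρ, hρ, hd⟩
    exact not_hom (h2 ρ hρ) (label_mem hd).2
  · rintro ⟨h1, h2⟩
    refine ⟨seg_X h1, fun σ hσ => ?_⟩
    by_contra hcon
    obtain ⟨d, hd⟩ := exists_label hσ
    exact h2 d ⟨σ, hσ, hd⟩ ⟨d, seg_X (label_mem hd).1, quo_of_not_mem hd h1 hcon, .refl _⟩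

/-- Without lower labels `τ` lies below every torsion pair, in particular below the one whose part
`Y` contains all segments. -/
lemma lowerLab_nonempty [Finite V] (hs : s ∈ τ.X) : τ.lowerLab.Nonempty := by
  by_contra hcon
  rw [Set.not_nonempty_iff_eq_empty] at hcon
  have h := le_of_lowerLab_subset (σ := ofY {t | T.IsSegment t} fun _ h => h)
    (hcon ▸ Set.empty_subset _)
  exact disj (h hs) (subset_ofY (seg_X hs))

/-- `m` is the meet of the lower covers of `τ`. -/
structure IsCore (τ m : T.TorsionPair) : Prop where
  X_eq : m.X = {x ∈ τ.X | ∀ d ∈ τ.lowerLab, ¬ T.Hom x d}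
  lowerLab_subset : τ.lowerLab ⊆ m.Y

lemma IsCore.le (h : IsCore τ m) : m ≤ τ := by
  rw [le_iff, h.X_eq]
  exact fun _ hx => hx.1

lemma isCore_of_isGLB [Finite V] (hm : IsGLB {σ | σ ⋖ τ} m) (h : τ.lowerLab.Nonempty) :
    IsCore τ m := by
  refine ⟨isGLB_X hm h, ?_⟩
  rintro s ⟨σ, hσ, hs⟩
  exact le_iff_Y.1 (hm.1 hσ) (label_mem hs).2

/-- For the converse, take the smallest torsion pair above `m` whose part `X` contains `s`: it lies
below `τ` because `s ∈ τ.X`, and it covers an element with label `s`. -/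
lemma shard_mem_iff [Finite V] (hm : IsCore τ m) :
    (∃ w z : T.TorsionPair, m ≤ w ∧ w ⋖ z ∧ z ≤ τ ∧ z.X ∩ w.Y = {s}) ↔
      s ∈ τ.X ∧ s ∈ m.Y := by
  constructor
  · rintro ⟨w, z, h1, -, h2, h3⟩
    exact ⟨h2 (label_mem h3).1, le_iff_Y.1 h1 (label_mem h3).2⟩
  · rintro ⟨h1, h2⟩
    obtain ⟨w, z, h3, h4, h5, h6, -⟩ := exists_covBy_of_mem_Y h2
    exact ⟨w, z, h3, h4, h6 τ hm.le h1, h5⟩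

/-! ### Concatenations of labels -/

end TorsionPair

variable (T) in
/-- The path from `u` to `v` is a concatenation of elements of `D`. -/
inductive IsConcat (D : Set (Set V)) : V → V → Prop
  | refl (u : V) : IsConcat D u u
  | cons {u x v : V} (h : T.path u x ∈ D) (hx : x ∈ T.path u v) (h' : IsConcat D x v) :
      IsConcat D u v

lemma IsConcat.append {D : Set (Set V)} {u a v : V} (h : T.IsConcat D u a)
    (h' : T.IsConcat D a v) (ha : a ∈ T.path u v) : T.IsConcat D u v := by
  induction h with
  | refl => exact h'
  | cons h1 hx _ ih =>
    have := btw_left ha hx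
    exact .cons h1 this.1 (ih h' this.2)

namespace TorsionPair

variable {τ τ' σ σ' m : T.TorsionPair} {s t w : Set V} {D : Set (Set V)}

/-- Since `τ` is generated by its lower labels, some label `d` maps to `s`. The image lies in `m.Y`,
hence not in `m.X`, so it maps on to a label. By orthogonality that label is `d` again, which forces
the image to be all of `d`. -/
lemma IsCore.exists_sub [Finite V] (hm : IsCore τ m) (hX : s ∈ τ.X) (hY : s ∈ m.Y) :
    ∃ d ∈ τ.lowerLab, T.Sub d s := by
  have h1 : s ∉ (ofX τ.lowerLab lowerLab_isSemibrick.1).Y := by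
    have h2 : τ ≤ ofX τ.lowerLab lowerLab_isSemibrick.1 := le_of_lowerLab_subset subset_ofX
    exact fun h => disj (h2 hX) h
  rw [mem_ofX_Y] at h1
  push Not at h1
  obtain ⟨d, hd, w, hw, hq, hsub⟩ := h1 (seg_X hX)
  have hwX : w ∉ m.X := fun h => disj h (sub_mem hY hw hsub)
  rw [hm.X_eq] at hwX
  have h3 : ∃ d' ∈ τ.lowerLab, T.Hom w d' := by
    by_contra hcon
    push Not at hcon
    exact hwX ⟨quo_mem (lowerLab_subset_X hd) hw hq, hcon⟩
  obtain ⟨d', hd', hh⟩ := h3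
  have hdd : d = d' := by
    by_contra hne
    exact lowerLab_isSemibrick.2 d hd d' hd' hne (hh.of_quo hq)
  subst hdd
  obtain ⟨w', hw', h4, h5⟩ := hh
  obtain ⟨u, v, -, rfl⟩ := exists_isSegment_ends (seg_X (lowerLab_subset_X hd))
  have := quo_sub_eq hw' (h4.trans hq) h5
  have hwd : w = T.path u v := hq.1.antisymm (this ▸ h4.1)
  exact ⟨_, hd, hwd ▸ hsub⟩

/-- As `s ∉ m.X`, it maps to a label `d`. The image again lies in `τ.X ∩ m.Y`, so it has a label as
a sub; this label is a sub of `d` and therefore equals `d`. -/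
lemma IsCore.exists_quo [Finite V] (hm : IsCore τ m) (hX : s ∈ τ.X) (hY : s ∈ m.Y) :
    ∃ d ∈ τ.lowerLab, T.Quo d s := by
  have h1 : s ∉ m.X := fun h => disj h hY
  rw [hm.X_eq] at h1
  have h3 : ∃ d ∈ τ.lowerLab, T.Hom s d := by
    by_contra hcon
    push Not at hcon
    exact h1 ⟨hX, hcon⟩
  obtain ⟨d, hd, w, hw, hq, hsub⟩ := h3
  obtain ⟨d', hd', h4⟩ := hm.exists_sub (quo_mem hX hw hq)
    (sub_mem (hm.lowerLab_subset hd) hw hsub)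
  have hdd : d = d' := by
    by_contra hne
    exact lowerLab_isSemibrick.2 d' hd' d hd (Ne.symm hne)
      ⟨d', seg_X (lowerLab_subset_X hd'), .refl _, h4.trans hsub⟩
  subst hdd
  exact ⟨d, hd, hsub.1.antisymm h4.1 ▸ hq⟩

/-- What remains before a label split off as a sub is a quotient of `[u, v]`, hence in `τ.X`. If it
were not in `m.Y`, it would have a sub `[e, f]` in `m.X`. When `f ≠ a` this is a sub of `[u, v]`,
hence in `m.Y`, a contradiction; the case `f = a` is the heart of the proof. -/
lemma IsCore.initial_mem [Finite V] (hm : IsCore τ m) {u v a b : V}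
    (hX : T.path u v ∈ τ.X) (hY : T.path u v ∈ m.Y) (hd : T.path a b ∈ τ.lowerLab)
    (hsub : T.Sub (T.path a b) (T.path u v)) (ha : a ∈ T.path u b) (hb : b ∈ T.path u v)
    (hab : a ≠ b) (hau : a ≠ u) : T.path u a ∈ τ.X ∧ T.path u a ∈ m.Y := by
  have hseg := seg_X hX
  have hauv := (btw_left hb ha).1
  have habv := (btw_left hb ha).2
  have hs' := (sub_path_iff ha hb hab).1 hsub
  have hk : T.IsSegment (T.path u a) := hseg.sub (T.left_mem _ _) hauv hau.symm
  have hdX := lowerLab_subset_X hd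
  refine ⟨?_, ?_⟩
  · refine quo_mem hX hk ?_
    rw [quo_path_iff (T.left_mem _ _) hauv hau.symm]
    refine ⟨fun h => absurd rfl h, fun _ => ?_⟩
    rw [← nx_eq_of_mem habv hab.symm, hs'.1 hau]
  by_contra hcon
  obtain ⟨w, hw, hws⟩ := TorsionPair.exists_sub hk hcon
  obtain ⟨e, f, hef, he, hf, rfl⟩ := segment_in_path (seg_X hw) hws.1
  have hws' := (sub_path_iff he hf hef).1 hws
  have hfuv := btw_left hauv hf
  have hwm := hw
  rw [hm.X_eq] at hwm
  by_cases hfa : f = a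
  · subst hfa
    have heb := btw_left ha he
    have heuv := (btw_left hfuv.1 he).1
    have hr : T.IsSegment (T.path e b) :=
      hseg.sub heuv hb (fun h => hef (btw_antisymm he (h ▸ ha)))
    have hrX : T.path e b ∈ τ.X := concat_X heb.2 hwm.1 hdX hr
    have hrY : T.path e b ∈ m.Y := by
      refine sub_mem hY hr ?_
      rw [sub_path_iff heb.1 hb hr.ne]
      constructor
      · intro h
        rw [hws'.1 h, ← nx_eq_of_mem heb.2 hef.symm]
      · intro h
        rw [← nx_eq_of_mem (mem_path_comm.1 heb.2) hab, hs'.2 h]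
    -- The concatenation `[e, b]` of `[e, a]` with the label lies in `τ.X ∩ m.Y` and so has a label
    -- `d₁` as a quotient. If `d₁` is contained in `[e, a]`, then an element of `m.X` maps to a
    -- label. Otherwise the overlap of `d₁` with `[a, b]` gives a map between two distinct labels.
    obtain ⟨d₁, hd₁, hq₁⟩ := hm.exists_quo hrX hrY
    obtain ⟨f', g, hfg, hf', hg, rfl⟩ := segment_in_path (seg_X (lowerLab_subset_X hd₁)) hq₁.1
    have hfeb := btw_left hg hf'
    have hq₁' := (quo_path_iff hf' hg hfg).1 hq₁
    have hdr : T.Sub (T.path f b) (T.path e b) :=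
      hsub.restrict (path_subset heuv hb) (path_subset_right heb.2)
    have hdr' := (sub_path_iff heb.2 (T.right_mem _ _) hab).1 hdr
    by_cases hge : g ∈ T.path e f
    · exact hwm.2 _ hd₁ ⟨_, seg_X (lowerLab_subset_X hd₁),
        hq₁.restrict (path_subset_left heb.2) (path_subset (btw_left hge hf').1 hge), .refl _⟩
    have hfeg : f ∈ T.path e g := (btw_total heb.2 hg).resolve_right hge
    have hgf : f ≠ g := fun h => hge (h ▸ T.right_mem _ _)
    have hne : T.path f b ≠ T.path f' g := by
      intro heq
      have := quo_sub_eq (seg_X hdX) (heq ▸ hq₁) hdr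
      rcases path_endpoints this with ⟨h, -⟩ | ⟨-, h⟩
      · exact hef h.symm
      · exact hr.ne h.symm
    refine lowerLab_isSemibrick.2 _ hd _ hd₁ hne ?_
    have hgfb := (btw_left hg hfeg)
    by_cases hff : f' ∈ T.path e f
    · have hffg := (btw_left hfeg hff).2
      refine ⟨T.path f g, hr.sub heb.2 hg hgf, ?_, ?_⟩
      · rw [quo_path_iff (T.left_mem _ _) hgfb.2 hgf]
        refine ⟨fun h => absurd rfl h, fun h => ?_⟩
        rw [nx_eq_of_mem (mem_path_comm.1 hffg) hgf, hq₁'.2 h]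
      · rw [sub_path_iff hffg (T.right_mem _ _) hgf]
        refine ⟨fun h => ?_, fun h => absurd rfl h⟩
        rw [nx_eq_of_mem (mem_path_comm.1 hff) h.symm, hdr'.1 hef.symm,
          nx_eq_of_mem hgfb.2 hgf.symm]
    · have hff' : f ∈ T.path e f' := (btw_total heb.2 hfeb.1).resolve_right hff
      have hsub' : T.path f' g ⊆ T.path f b :=
        path_subset (btw_left hfeb.1 hff').2 hgfb.2
      exact ⟨_, seg_X (lowerLab_subset_X hd₁),
        hq₁.restrict (path_subset_right heb.2) hsub', .refl _⟩
  · refine disj hw (sub_mem hY (seg_X hw) ?_)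
    rw [sub_path_iff he hfuv.1 hef]
    refine ⟨hws'.1, fun _ => ?_⟩
    rw [← hws'.2 hfa, nx_eq_of_mem hfuv.2 (Ne.symm hfa)]

/-- Induction on the length: split off a label that is a sub; the pieces on both sides of it are
again in `τ.X ∩ m.Y`. -/
lemma IsCore.isConcat [Finite V] (hm : IsCore τ m) {u v : V} (hX : T.path u v ∈ τ.X)
    (hY : T.path u v ∈ m.Y) : T.IsConcat τ.lowerLab u v := by
  obtain ⟨n, hn⟩ : ∃ n, T.G.dist u v = n := ⟨_, rfl⟩
  induction n using Nat.strong_induction_on generalizing u v with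
  | _ n ih =>
  obtain ⟨d, hd, hsub⟩ := hm.exists_sub hX hY
  obtain ⟨a, b, hab, ha, hb, rfl⟩ := segment_in_path (seg_X (lowerLab_subset_X hd)) hsub.1
  have hauv := btw_left hb ha
  have hdab : T.G.dist a b ≠ 0 := fun h => hab (T.dist_eq_zero.1 h)
  have e1 := T.mem_path_iff.1 ha
  have e2 := T.mem_path_iff.1 hb
  have h1 : T.IsConcat τ.lowerLab u a := by
    by_cases hau : a = u
    · subst hau
      exact .refl _
    · obtain ⟨h1, h2⟩ := hm.initial_mem hX hY hd hsub ha hb hab hau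
      exact ih _ (by omega) h1 h2 rfl
  have h2 : T.IsConcat τ.lowerLab b v := by
    by_cases hbv : b = v
    · subst hbv
      exact .refl _
    · rw [T.path_comm u v] at hX hY hsub
      rw [T.path_comm a b] at hd hsub
      obtain ⟨h1, h2⟩ := hm.initial_mem hX hY hd hsub (mem_path_comm.1 hauv.2)
        (mem_path_comm.1 hauv.1) hab.symm hbv
      rw [T.path_comm v b] at h1 h2
      exact ih _ (by omega) h1 h2 rfl
  exact h1.append (.cons hd hauv.2 h2) hauv.1

lemma IsCore.mem_of_isConcat (hm : IsCore τ m) {u v : V} (h : T.IsConcat τ.lowerLab u v)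
    (hs : T.IsSegment (T.path u v)) : T.path u v ∈ τ.X ∧ T.path u v ∈ m.Y := by
  induction h with
  | refl => exact absurd rfl hs.ne
  | @cons u x v h hx h' ih =>
    have h1 : T.path u x ∈ τ.X ∧ T.path u x ∈ m.Y :=
      ⟨lowerLab_subset_X h, hm.lowerLab_subset h⟩
    by_cases hxv : x = v
    · subst hxv
      exact h1
    · have h2 := ih (hs.sub hx (T.right_mem _ _) hxv)
      exact ⟨concat_X hx h1.1 h2.1 hs, concat_Y hx h1.2 h2.2 hs⟩

end TorsionPair

/-- Two elements of a semibrick with a common end do not start along the same edge. -/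
lemma IsSemibrick.eq_of_nx_eq {D : Set (Set V)} (hD : T.IsSemibrick D) {x y z : V}
    (hy : T.path x y ∈ D) (hz : T.path x z ∈ D) (h : T.nx x y = T.nx x z) : y = z := by
  by_contra hyz
  have hsy := hD.1 _ hy
  have hsz := hD.1 _ hz
  have hne : T.path x y ≠ T.path x z := by
    intro he
    rcases path_endpoints he with ⟨-, h⟩ | ⟨h, -⟩
    exacts [hyz h, hsz.ne h]
  have hno : ¬ T.Hom (T.path x y) (T.path x z) := hD.2 _ hy _ hz hne
  have hno' : ¬ T.Hom (T.path x z) (T.path x y) := hD.2 _ hz _ hy hne.symm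
  -- The two segments separate at `m`. At `m` one of them turns left or ends while the other turns
  -- right or ends, so the common part `[x, m]` is a quotient of one and a sub of the other.
  obtain ⟨m, h1, h2, h3⟩ := exists_median (T := T) x y z
  have hmx : m ≠ x := by
    rintro rfl
    exact nx_ne h3 hsy.ne h
  have hw : T.IsSegment (T.path x m) := hsy.sub (T.left_mem _ _) h1 hmx.symm
  have qy := quo_path_iff (T.left_mem x m) h1 hmx.symm
  have sy := sub_path_iff (T.left_mem x m) h1 hmx.symm
  have qz := quo_path_iff (T.left_mem x m) h2 hmx.symm
  have sz := sub_path_iff (T.left_mem x m) h2 hmx.symm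
  simp only [ne_eq, not_true_eq_false, false_imp_iff, true_and] at qy sy qz sz
  have ty : m ≠ y → T.cw m (T.nx m x) = T.nx m y ∨ T.cw m (T.nx m y) = T.nx m x :=
    fun h => sharp_path_iff.1 hsy.sharp m h1 hmx h
  have tz : m ≠ z → T.cw m (T.nx m x) = T.nx m z ∨ T.cw m (T.nx m z) = T.nx m x :=
    fun h => sharp_path_iff.1 hsz.sharp m h2 hmx h
  have k1 : ¬ (T.Quo (T.path x m) (T.path x y) ∧ T.Sub (T.path x m) (T.path x z)) :=
    fun h => hno ⟨_, hw, h.1, h.2⟩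
  have k2 : ¬ (T.Quo (T.path x m) (T.path x z) ∧ T.Sub (T.path x m) (T.path x y)) :=
    fun h => hno' ⟨_, hw, h.1, h.2⟩
  rw [qy, sz] at k1
  rw [qz, sy] at k2
  by_cases hmy : m = y
  · have hmz : m ≠ z := fun h => hyz (hmy.symm.trans h)
    rcases tz hmz with h | h
    · exact k2 ⟨fun _ => h, fun h' => absurd hmy h'⟩
    · exact k1 ⟨fun h' => absurd hmy h', fun _ => h⟩
  by_cases hmz : m = z
  · rcases ty hmy with h | h
    · exact k1 ⟨fun _ => h, fun h' => absurd hmz h'⟩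
    · exact k2 ⟨fun h' => absurd hmz h', fun _ => h⟩
  have hnm := nx_ne h3 hmy
  rcases ty hmy with h | h <;> rcases tz hmz with h' | h'
  · exact hnm (h.symm.trans h')
  · exact k1 ⟨fun _ => h, fun _ => h'⟩
  · exact k2 ⟨fun _ => h', fun _ => h⟩
  · exact hnm ((T.cw m).injective (h.trans h'.symm))

/-- If prepending `[w, u]` makes the path turn back at `u`, then `[u, w]` and the first piece start
along the same edge, hence coincide and cancel. -/
lemma IsSemibrick.isConcat_cons {D : Set (Set V)} (hD : T.IsSemibrick D) {w u v : V}
    (h : T.path w u ∈ D) (h' : T.IsConcat D u v) : T.IsConcat D w v := by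
  cases h' with
  | refl => exact .cons h (T.right_mem _ _) (.refl _)
  | @cons _ x _ h1 hx h2 =>
    have hux := (hD.1 _ h1).ne
    by_cases he : T.nx u w = T.nx u x
    · rw [path_comm] at h
      rw [hD.eq_of_nx_eq h h1 he]
      exact h2
    · rw [nx_eq_of_mem hx hux.symm] at he
      exact .cons h (T.mem_of_nx_ne he) (.cons h1 hx h2)

/-! ### Arcs compatible with a torsion pair -/

lemma leaf_end {u v y : V} (h : T.IsLeaf y) (hy : y ∈ T.path u v) : y = u ∨ y = v := by
  by_contra hcon
  push Not at hcon
  exact not_leaf_of_mem hy hcon.1 hcon.2 h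

lemma nx_self (u : V) : T.nx u u = u := path_self_eq (nx_mem u u)

namespace TorsionPair

variable {τ σ : T.TorsionPair} {w p q : Set V}

/-- The arc `p` is orthogonal to the torsion pair `τ`. -/
def Compat (τ : T.TorsionPair) (p : Set V) : Prop :=
  T.IsArc p ∧ (∀ t ∈ τ.Y, ¬ T.Hom p t) ∧ ∀ s ∈ τ.X, ¬ T.Hom s p

lemma mirror_compat : τ.mirror.Compat p ↔ τ.Compat p := by
  simp only [Compat, mirror_isArc, mirror_hom]
  exact and_congr_right fun _ => and_comm

lemma Compat.quo_mem (hp : τ.Compat p) (hw : T.IsSegment w) (h : T.Quo w p) : w ∈ τ.X := by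
  by_contra hcon
  obtain ⟨w', hw', h'⟩ := exists_quo hw hcon
  exact hp.2.1 w' hw' ⟨w', seg_Y hw', h'.trans h, .refl _⟩

lemma Compat.sub_mem (hp : τ.Compat p) (hw : T.IsSegment w) (h : T.Sub w p) : w ∈ τ.Y :=
  (mirror_compat.2 hp).quo_mem (mirror_isSegment.2 hw) (mirror_quo.2 h)

lemma Compat.not_hom (hp : τ.Compat p) (hq : τ.Compat q) : ¬ T.Hom p q := by
  rintro ⟨w, hw, h1, h2⟩
  exact hq.2.2 w (hp.quo_mem hw h1) ⟨w, hw, .refl _, h2⟩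

/-- The path from `v` to `u` turns left after segments of `X` and right after segments of `Y`. -/
def IsRay (τ : T.TorsionPair) (v u : V) : Prop :=
  ∀ y ∈ T.path v u, y ≠ v → y ≠ u → (T.path v y ∈ τ.X ∧ T.cw y (T.nx y v) = T.nx y u) ∨
    (T.path v y ∈ τ.Y ∧ T.cw y (T.nx y u) = T.nx y v)

lemma mirror_isRay {v u : V} : τ.mirror.IsRay v u ↔ τ.IsRay v u := by
  simp only [IsRay, mirror_cw, mirror_path, mirror_nx]
  constructor <;> exact fun h y h1 h2 h3 => (h y h1 h2 h3).symm

lemma IsRay.sharp {v u : V} (h : τ.IsRay v u) : T.Sharp (T.path v u) :=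
  sharp_path_iff.2 fun y h1 h2 h3 => (h y h1 h2 h3).imp And.right And.right

lemma IsRay.left [Finite V] {v u y : V} (h : τ.IsRay v u) (hy : y ∈ T.path v u) (hv : y ≠ v)
    (hu : y ≠ u) (hl : T.cw y (T.nx y v) = T.nx y u) : T.path v y ∈ τ.X := by
  rcases h y hy hv hu with h' | h'
  · exact h'.1
  · exact (turn_not_both (nx_adj hv) (nx_adj hu) (nx_ne hy hv) hl h'.2).elim

lemma IsRay.right [Finite V] {v u y : V} (h : τ.IsRay v u) (hy : y ∈ T.path v u) (hv : y ≠ v)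
    (hu : y ≠ u) (hl : T.cw y (T.nx y u) = T.nx y v) : T.path v y ∈ τ.Y := by
  rcases h y hy hv hu with h' | h'
  · exact (turn_not_both (nx_adj hv) (nx_adj hu) (nx_ne hy hv) h'.2 hl).elim
  · exact h'.1

/-- If the ray continued after `b`, it would turn right there, so `[v, b]` would lie in `Y`, and
with it the sub `[a, b]`. -/
lemma IsRay.eq_of_sub_mem_X [Finite V] {v u a b : V} (h : τ.IsRay v u) (ha : a ∈ T.path v b)
    (hb : b ∈ T.path v u) (hab : a ≠ b) (hw : T.path a b ∈ τ.X)
    (hs : T.Sub (T.path a b) (T.path v u)) : b = u := by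
  by_contra hbu
  have hbv : b ≠ v := by
    rintro rfl
    exact hab (path_self_eq ha)
  have h1 := ((sub_path_iff ha hb hab).1 hs).2 hbu
  rw [nx_eq_of_mem (mem_path_comm.1 ha) hab] at h1
  have h2 := h.right hb hbv hbu h1
  exact disj hw (TorsionPair.sub_mem h2 (seg_X hw)
    (hs.restrict (path_subset_left hb) (path_subset_right ha)))

/-- Along a ray, the segments starting at its origin lie in `X` or `Y`. -/
lemma IsRay.mem [Finite V] {v u : V} (h : τ.IsRay v u) (hvu : v ≠ u) (hv : ¬ T.IsLeaf v)
    (hu : ¬ T.IsLeaf u) : T.path v u ∈ τ.X ∨ T.path v u ∈ τ.Y := by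
  have hs : T.IsSegment (T.path v u) := isSegment_path.2 ⟨hvu, hv, hu, h.sharp⟩
  by_contra hcon
  push Not at hcon
  obtain ⟨w, hw, h1⟩ := exists_sub hs hcon.2
  obtain ⟨w', hw', h2⟩ := exists_quo hs hcon.1
  obtain ⟨a, b, hab, ha, hb, rfl⟩ := segment_in_path (seg_X hw) h1.1
  obtain ⟨a', b', hab', ha', hb', rfl⟩ := segment_in_path (seg_Y hw') h2.1
  obtain rfl := h.eq_of_sub_mem_X ha hb hab hw h1
  obtain rfl := (mirror_isRay.2 h).eq_of_sub_mem_X ha' hb' hab' hw' (mirror_sub.2 h2)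
  -- The sub in `X` and the quotient in `Y` both reach the end of the ray, so one contains the
  -- other, and the shorter one lies in `X` and in `Y`.
  rcases btw_total ha ha' with h3 | h3
  · have h4 : T.path a' b' ⊆ T.path a b' := path_subset_right (btw_left ha' h3).2
    exact disj (quo_mem hw (seg_Y hw') (h2.restrict h1.1 h4)) hw'
  · have h4 : T.path a b' ⊆ T.path a' b' := path_subset_right (btw_left ha h3).2
    exact disj hw (TorsionPair.sub_mem hw' (seg_X hw) (h1.restrict h2.1 h4))

/-- A longest ray in the given direction ends at a leaf: at an interior end `u`, `IsRay.mem` puts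
`[v, u]` in `X` or in `Y`, which prescribes a turn and extends the ray. -/
lemma exists_ray [Finite V] {v e : V} (hv : ¬ T.IsLeaf v) (he : T.G.Adj v e) :
    ∃ l, T.IsLeaf l ∧ T.nx v l = e ∧ v ≠ l ∧ τ.IsRay v l := by
  have hne : {u | T.nx v u = e ∧ v ≠ u ∧ τ.IsRay v u}.Nonempty := by
    refine ⟨e, nx_of_adj he, he.ne, fun y hy h1 h2 => ?_⟩
    rw [mem_path_adj he] at hy
    exact absurd hy (not_or.2 ⟨h1, h2⟩)
  obtain ⟨u, ⟨h1, hvu, hr⟩, hmax⟩ :=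
    Set.exists_max_image _ (fun u => T.G.dist v u) (Set.toFinite _) hne
  refine ⟨u, ?_, h1, hvu, hr⟩
  by_contra hu
  have hx : T.G.Adj u (T.nx u v) := nx_adj hvu.symm
  obtain ⟨z, hz, hzn, hrule⟩ : ∃ z, T.G.Adj u z ∧ z ≠ T.nx u v ∧
      ((T.path v u ∈ τ.X ∧ T.cw u (T.nx u v) = z) ∨
        (T.path v u ∈ τ.Y ∧ T.cw u z = T.nx u v)) := by
    rcases hr.mem hvu hv hu with h | h
    · exact ⟨_, cw_adj hx, cw_ne hu hx, .inl ⟨h, rfl⟩⟩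
    · obtain ⟨z, hz, hc⟩ := exists_cw_eq hx
      refine ⟨z, hz, ?_, .inr ⟨h, hc⟩⟩
      rintro rfl
      exact cw_ne hu hz hc
  have huz : u ∈ T.path v z := by
    apply T.mem_of_nx_ne
    rw [nx_of_adj hz]
    exact hzn.symm
  have hvz : v ≠ z := by
    rintro rfl
    exact hvu (path_self_eq huz).symm
  have hlt : T.G.dist v u < T.G.dist v z := by
    rw [← T.mem_path_iff.1 huz, T.dist_adj hz]
    omega
  refine hlt.not_ge (hmax z ⟨?_, hvz, ?_⟩)
  · rw [← h1, nx_eq_of_mem huz hvu.symm]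
  · intro y hy hyv hyz
    rw [path_extend hz huz] at hy
    have hy := hy.resolve_left hyz
    by_cases hyu : y = u
    · subst hyu
      rwa [nx_of_adj hz]
    · rw [← nx_eq_of_mem (btw_left huz hy).2 (Ne.symm hyu)]
      exact hr y hy hyv hyu

/-- The arc from `a` to `b` consists of two rays starting at `v`. -/
structure Good (τ : T.TorsionPair) (v a b : V) : Prop where
  leaf_a : T.IsLeaf a
  leaf_b : T.IsLeaf b
  not_leaf : ¬ T.IsLeaf v
  turn : T.cw v (T.nx v a) = T.nx v b
  ray_a : τ.IsRay v a
  ray_b : τ.IsRay v b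

variable {v a b : V}

lemma Good.ne_a (h : τ.Good v a b) : v ≠ a := fun he => h.not_leaf (he ▸ h.leaf_a)

lemma Good.ne_b (h : τ.Good v a b) : v ≠ b := fun he => h.not_leaf (he ▸ h.leaf_b)

lemma Good.mirror (h : τ.Good v a b) : τ.mirror.Good v b a :=
  ⟨h.leaf_b, h.leaf_a, h.not_leaf, mirror_cw.2 h.turn, mirror_isRay.2 h.ray_b,
    mirror_isRay.2 h.ray_a⟩

lemma Good.mem [Finite V] (h : τ.Good v a b) : v ∈ T.path a b := by
  apply T.mem_of_nx_ne
  rw [← h.turn]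
  exact (cw_ne h.not_leaf (nx_adj h.ne_a)).symm

lemma Good.isArc [Finite V] (h : τ.Good v a b) : T.IsArc (T.path a b) := by
  refine ⟨a, b, ?_, h.leaf_a, h.leaf_b, rfl, ?_⟩
  · rintro rfl
    exact cw_ne h.not_leaf (nx_adj h.ne_a) h.turn
  · rw [sharp_path_iff]
    intro y hy hya hyb
    by_cases hyv : y = v
    · subst hyv
      exact .inl h.turn
    rcases T.mem_path_split h.mem hy with h' | h'
    · have h1 := nx_eq_of_mem (btw_left h.mem h').2 (Ne.symm hyv)
      rw [← h1]
      exact ((h.ray_a y (mem_path_comm.1 h') hyv hya).imp And.right And.right).symm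
    · have h1 := nx_eq_of_mem (mem_path_comm.1 (btw_right h.mem h').2) (Ne.symm hyv)
      rw [← h1]
      exact (h.ray_b y h' hyv hyb).imp And.right And.right

/-- At an end where the arc leaves `w` to the left while moving away from `v`, the ray rule puts the
segment from `v` to this end in `X`. If `v` is not strictly inside `w`, then `w` is a quotient of
such a segment; otherwise `w` is the concatenation of two of them. -/
lemma Good.quo_mem [Finite V] (h : τ.Good v a b) (hw : T.IsSegment w)
    (hq : T.Quo w (T.path a b)) : w ∈ τ.X := by
  obtain ⟨c, d, hcd, hc, hd, rfl⟩ := segment_in_path hw hq.1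
  have hcab := (btw_left hd hc).1
  have hcdb := (btw_left hd hc).2
  have hca : c ≠ a := fun he => hw.not_leaf (T.left_mem _ _) (he ▸ h.leaf_a)
  have hdb : d ≠ b := fun he => hw.not_leaf (T.right_mem _ _) (he ▸ h.leaf_b)
  have hq' := (quo_path_iff hc hd hcd).1 hq
  have key1 : c ∈ T.path a v → c ≠ v → T.nx c d = T.nx c v → T.path v c ∈ τ.X := by
    intro h1 h2 h3
    refine h.ray_a.left (mem_path_comm.1 h1) h2 hca ?_
    rw [← h3, hq'.1 hca]
  have key2 : d ∈ T.path v b → d ≠ v → T.nx d c = T.nx d v → T.path v d ∈ τ.X := by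
    intro h1 h2 h3
    refine h.ray_b.left h1 h2 hdb ?_
    rw [← h3, hq'.2 hdb]
  by_cases h1 : d ∈ T.path a v
  · have h2 := btw_left h1 hc
    have hcv : c ≠ v := by
      rintro rfl
      exact hcd (btw_antisymm hc h1)
    have h3 := key1 h2.1 hcv (nx_eq_of_mem h2.2 hcd.symm)
    refine TorsionPair.quo_mem h3 hw (hq.restrict ?_ ?_)
    · exact path_subset h.mem hcab
    · rw [T.path_comm v c]
      exact path_subset_left h2.2
  have hvd : v ∈ T.path a d := (btw_total h.mem hd).resolve_right h1
  have hdvb := (btw_left hd hvd).2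
  have hdv : d ≠ v := fun he => h1 (he ▸ T.right_mem _ _)
  by_cases h2 : v ∈ T.path a c
  · have h3 := btw_left hc h2
    have h4 := key2 hdvb hdv (nx_eq_of_mem (mem_path_comm.1 h3.2) hcd)
    refine TorsionPair.quo_mem h4 hw (hq.restrict ?_ ?_)
    · exact path_subset h.mem hd
    · exact path_subset_right h3.2
  have hcv : c ∈ T.path a v := (btw_total hcab h.mem).resolve_right h2
  have hcv' : c ≠ v := fun he => h2 (he ▸ T.right_mem _ _)
  have h3 := (btw_left hvd hcv).2
  have h4 := key1 hcv hcv' (nx_eq_of_mem h3 hcv'.symm).symm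
  have h5 := key2 hdvb hdv (nx_eq_of_mem (mem_path_comm.1 h3) hdv.symm).symm
  rw [T.path_comm v c] at h4
  exact concat_X h3 h4 h5 hw

lemma Good.compat [Finite V] (h : τ.Good v a b) : τ.Compat (T.path a b) := by
  refine ⟨h.isArc, ?_, ?_⟩
  · rintro t ht ⟨w, hw, h1, h2⟩
    exact disj (h.quo_mem hw h1) (TorsionPair.sub_mem ht hw h2)
  · rintro s hs ⟨w, hw, h1, h2⟩
    have h3 := h.mirror.quo_mem (mirror_isSegment.2 hw) (w := w)
      (by rw [mirror_path, T.path_comm]; exact mirror_quo.2 h2)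
    exact disj (TorsionPair.quo_mem hs hw h1) h3

lemma exists_good [Finite V] {e : V} (hv : ¬ T.IsLeaf v) (he : T.G.Adj v e) :
    ∃ a b, T.nx v a = e ∧ T.nx v b = T.cw v e ∧ τ.Good v a b := by
  obtain ⟨a, h1, h2, -, h3⟩ := exists_ray (τ := τ) hv he
  obtain ⟨b, h4, h5, -, h6⟩ := exists_ray (τ := τ) hv (cw_adj he)
  exact ⟨a, b, h2, h5, h1, h4, hv, by rw [h2, h5], h3, h6⟩

/-- Let one ray of a good arc at the end `a` of `w` start along `w`, and let `m` be the last vertex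
that it shares with `w`. If the ray turns left at `m`, then `[a, m]` is a quotient of the arc and a
sub of `w`. A right turn would put `[a, m]` in `Y`, although `w` itself or this quotient of `w` lies
in `X`. -/
lemma exists_compat_hom [Finite V] (hw : w ∈ τ.X) : ∃ p, τ.Compat p ∧ T.Hom p w := by
  obtain ⟨a, b, hab, rfl⟩ := exists_isSegment_ends (seg_X hw)
  have hs := seg_X hw
  have ha := hs.not_leaf (T.left_mem _ _)
  obtain ⟨l₁, l₂, h1, h2, hg⟩ := exists_good (τ := τ) ha (nx_adj hab)
  refine ⟨_, hg.compat, ?_⟩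
  rw [T.path_comm l₁ l₂]
  have hal := mem_path_comm.1 hg.mem
  obtain ⟨m, h3, h4, h5⟩ := exists_median (T := T) a b l₁
  have hma : m ≠ a := by
    rintro rfl
    exact nx_ne h5 hab h1.symm
  have hml : m ≠ l₁ := fun he => hs.not_leaf h3 (he ▸ hg.leaf_a)
  have hseg := hs.sub (T.left_mem _ _) h3 hma.symm
  have hquo : T.cw m (T.nx m a) = T.nx m l₁ → T.Quo (T.path a m) (T.path l₂ l₁) := by
    intro h
    rw [quo_path_iff (btw_right hal h4).2 (btw_right hal h4).1 hma.symm]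
    refine ⟨fun _ => ?_, fun _ => h⟩
    rw [nx_eq_of_mem h4 hma, hg.turn]
  by_cases hmb : m = b
  · subst hmb
    refine ⟨_, hseg, hquo ?_, .refl _⟩
    rcases hg.ray_a m h4 hma hml with h | h
    · exact h.2
    · exact (disj hw h.1).elim
  have hne := nx_ne h5 hmb
  rcases hg.ray_a m h4 hma hml with h | h
  · refine ⟨_, hseg, hquo h.2, ?_⟩
    rw [sub_path_iff (T.left_mem _ _) h3 hma.symm]
    refine ⟨fun h => absurd rfl h, fun _ => ?_⟩
    rcases sharp_path_iff.1 hs.sharp m h3 hma hmb with h' | h'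
    · exact absurd (h'.symm.trans h.2) hne
    · exact h'
  · refine (disj (TorsionPair.quo_mem hw hseg ?_) h.1).elim
    rw [quo_path_iff (T.left_mem _ _) h3 hma.symm]
    refine ⟨fun h => absurd rfl h, fun _ => ?_⟩
    rcases sharp_path_iff.1 hs.sharp m h3 hma hmb with h' | h'
    · exact h'
    · exact absurd ((T.cw m).injective (h'.trans h.2.symm)) hne

lemma exists_hom_compat [Finite V] (hw : w ∈ τ.Y) : ∃ p, τ.Compat p ∧ T.Hom w p := by
  obtain ⟨p, h1, h2⟩ := exists_compat_hom (τ := τ.mirror) hw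
  exact ⟨p, mirror_compat.1 h1, mirror_hom.1 h2⟩

/-- A map from `q` to an element of `Y` has its image in `Y`, and this image maps to some compatible
arc, so `q` does too; dually for `X`. This is what makes the facet of a torsion pair maximal. -/
lemma compat_of_forall [Finite V] (hq : T.IsArc q)
    (h : ∀ p, τ.Compat p → ¬ T.Hom p q ∧ ¬ T.Hom q p) : τ.Compat q := by
  refine ⟨hq, ?_, ?_⟩
  · rintro t ht ⟨w, hw, h1, h2⟩
    obtain ⟨p, hp, hh⟩ := exists_hom_compat (TorsionPair.sub_mem ht hw h2)
    exact (h p hp).2 (hh.of_quo h1)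
  · rintro s hs ⟨w, hw, h1, h2⟩
    obtain ⟨p, hp, hh⟩ := exists_compat_hom (TorsionPair.quo_mem hs hw h1)
    exact (h p hp).1 (hh.of_sub h2)

/-- Comparison of a good arc with a compatible arc through the same corner. -/
lemma Good.diverge_b [Finite V] {a' b' h : V} (hg : τ.Good v a b)
    (hc : τ.Compat (T.path a' b')) (ha' : T.nx v a' = T.nx v a) (hb' : T.nx v b' = T.nx v b)
    (hlb : T.IsLeaf b') (hva' : v ≠ a') (hh : h ∈ T.path v b) (hh' : h ∈ T.path v b')
    (hne : T.nx h b' ≠ T.nx h b) :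
    T.cw h (T.nx h v) = T.nx h b' ∧ T.cw h (T.nx h b) = T.nx h v := by
  have hv' : v ∈ T.path a' b' := by
    apply T.mem_of_nx_ne
    rw [ha', hb']
    exact nx_ne hg.mem hg.ne_a
  have hvb' : v ≠ b' := fun he => hg.not_leaf (he ▸ hlb)
  have hhv : h ≠ v := by
    rintro rfl
    exact hne hb'
  have hbh : h ≠ b := by
    rintro rfl
    rcases leaf_end hg.leaf_b hh' with he | he
    · exact hg.ne_b he.symm
    · subst he
      exact hne rfl
  have hbh' : h ≠ b' := by
    rintro rfl
    rcases leaf_end hlb hh with he | he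
    · exact hvb' he.symm
    · subst he
      exact hne rfl
  have hha' := btw_right hv' hh'
  have hseg : T.IsSegment (T.path v h) := isSegment_path.2 ⟨hhv.symm, hg.not_leaf,
    not_leaf_of_mem hh hhv hbh, hg.ray_b.sharp.mono (path_subset_left hh)⟩
  have hsh : T.Sharp (T.path a' b') := by
    obtain ⟨_, _, _, _, _, _, hsh⟩ := hc.1
    exact hsh
  have hnx : T.nx h a' = T.nx h v :=
    (nx_eq_of_mem (mem_path_comm.1 hha'.2) hhv.symm).symm
  have hturn : T.cw h (T.nx h v) = T.nx h b' ∨ T.cw h (T.nx h b') = T.nx h v := by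
    rw [← hnx]
    refine sharp_path_iff.1 hsh h hha'.1 ?_ hbh'
    rintro rfl
    exact hva' (path_self_eq hha'.2)
  -- If the ray turned left at `h`, then `[v, h]` would be in `X`, while the other arc, diverging by
  -- a right turn, would have `[v, h]` as a sub.
  rcases hg.ray_b h hh hhv hbh with h1 | h1
  · rcases hturn with h2 | h2
    · exact absurd (h2.symm.trans h1.2) hne
    · refine (hc.2.2 _ h1.1 ⟨_, hseg, .refl _, ?_⟩).elim
      rw [sub_path_iff hha'.2 hha'.1 hhv.symm]
      refine ⟨fun _ => ?_, fun _ => ?_⟩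
      · rw [nx_eq_of_mem hh' hhv, hb', ha', hg.turn]
      · exact h2
  · refine ⟨?_, h1.2⟩
    rcases hturn with h2 | h2
    · exact h2
    · exact absurd ((T.cw h).injective (h2.trans h1.2.symm)) hne

lemma Good.diverge [Finite V] {a' b' h : V} (hg : τ.Good v a b)
    (hc : τ.Compat (T.path a' b')) (ha' : T.nx v a' = T.nx v a) (hb' : T.nx v b' = T.nx v b)
    (hla : T.IsLeaf a') (hlb : T.IsLeaf b') (hh : h ∈ T.path a b) (hh' : h ∈ T.path a' b')
    (hne : T.nx h a' ≠ T.nx h a ∨ T.nx h b' ≠ T.nx h b) :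
    T.cw h (T.nx h a') = T.nx h b' ∧ T.cw h (T.nx h b) = T.nx h a := by
  have hva' : v ≠ a' := fun he => hg.not_leaf (he ▸ hla)
  have hvb' : v ≠ b' := fun he => hg.not_leaf (he ▸ hlb)
  have hnab := nx_ne hg.mem hg.ne_a
  have hv' : v ∈ T.path a' b' := by
    apply T.mem_of_nx_ne
    rwa [ha', hb']
  have hhv : h ≠ v := by
    rintro rfl
    exact hne.elim (fun h => h ha') (fun h => h hb')
  rcases T.mem_path_split hg.mem hh with h1 | h1
  · have h1' := mem_path_comm.1 h1
    have h2 : h ∈ T.path v a' := by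
      rcases T.mem_path_split hv' hh' with h2 | h2
      · exact mem_path_comm.1 h2
      · rw [← nx_eq_of_mem h1' hhv, nx_eq_of_mem h2 hhv, hb'] at hnab
        exact absurd rfl hnab
    have e1 := nx_eq_of_mem (btw_left hg.mem h1).2 hhv.symm
    have e2 := nx_eq_of_mem (btw_left hv' (mem_path_comm.1 h2)).2 hhv.symm
    have h3 := hg.mirror.diverge_b (a' := b') (b' := a') (h := h)
      (by rw [mirror_path, T.path_comm]; exact mirror_compat.2 hc) hb' ha' hla hvb' h1' h2
      (hne.resolve_right fun h => h (e2.symm.trans e1))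
    simp only [mirror_cw, mirror_nx] at h3
    rw [← e1, ← e2]
    exact h3
  · have h2 : h ∈ T.path v b' := by
      rcases T.mem_path_split hv' hh' with h2 | h2
      · rw [← nx_eq_of_mem h1 hhv, nx_eq_of_mem (mem_path_comm.1 h2) hhv, ha'] at hnab
        exact absurd rfl hnab
      · exact h2
    have e1 := nx_eq_of_mem (mem_path_comm.1 (btw_right hg.mem h1).2) hhv.symm
    have e2 := nx_eq_of_mem (mem_path_comm.1 (btw_right hv' h2).2) hhv.symm
    have h3 := hg.diverge_b hc ha' hb' hlb hva' h1 h2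
      (hne.resolve_left fun h => h (e2.symm.trans e1))
    rw [← e1, ← e2]
    exact h3

end TorsionPair

/-! ### The two sides of an arc -/

variable (T) in
/-- `g` is the vertex of the path from `a` to `b` which is closest to `x`. -/
def IsGate (a b x g : V) : Prop := g ∈ T.path a b ∧ g ∈ T.path a x ∧ g ∈ T.path b x

section Gate

variable {a b x y g o : V}

lemma exists_gate (a b x : V) : ∃ g, T.IsGate a b x g := exists_median a b x

lemma IsGate.symm (h : T.IsGate a b x g) : T.IsGate b a x g :=
  ⟨mem_path_comm.1 h.1, h.2.2, h.2.1⟩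

lemma IsGate.mem_path (h : T.IsGate a b x g) (ho : o ∈ T.path a b) : g ∈ T.path x o := by
  rcases T.mem_path_split h.1 ho with h' | h'
  · exact mem_path_comm.1 (btw_left h.2.1 h').2
  · exact mem_path_comm.1 (btw_left h.2.2 (mem_path_comm.1 h')).2

lemma IsGate.unique (h : T.IsGate a b x g) (h' : T.IsGate a b x o) : g = o :=
  btw_antisymm (h.mem_path h'.1) (h'.mem_path h.1)

lemma isGate_self (h : x ∈ T.path a b) : T.IsGate a b x x :=
  ⟨h, T.right_mem _ _, T.right_mem _ _⟩

lemma IsGate.eq_of_mem (h : T.IsGate a b x g) (ho : o ∈ T.path a b) (hog : o ∈ T.path x g) :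
    o = g := btw_antisymm hog (h.mem_path ho)

lemma IsGate.eq_self (h : T.IsGate a b x g) (hx : x ∈ T.path a b) : g = x :=
  h.unique (isGate_self hx)

/-- The projection to the arc is constant along edges off the arc; this is why being on one side of
the arc is locally constant. -/
lemma IsGate.adj (h : T.IsGate a b x g) (hxy : T.G.Adj x y)
    (hoff : ¬ (x ∈ T.path a b ∧ y ∈ T.path a b)) : T.IsGate a b y g := by
  have key : ∀ {x y : V}, T.G.Adj x y → x ∈ T.path a b → y ∉ T.path a b → T.IsGate a b y x := by
    intro x y hxy hx hy
    refine ⟨hx, ?_, ?_⟩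
    · rcases adj_dichotomy hxy a with h' | h'
      · exact absurd (path_subset hx (T.left_mem _ _) h') hy
      · exact mem_path_comm.1 h'
    · rcases adj_dichotomy hxy b with h' | h'
      · exact absurd (path_subset hx (T.right_mem _ _) h') hy
      · exact mem_path_comm.1 h'
  by_cases hx : x ∈ T.path a b
  · rw [h.eq_self hx]
    exact key hxy hx fun hy => hoff ⟨hx, hy⟩
  by_cases hy : y ∈ T.path a b
  · rw [h.unique (key hxy.symm hy hx)]
    exact isGate_self hy
  have key2 : ∀ c ∈ T.path a b, g ∈ T.path c x → g ∈ T.path c y := by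
    intro c hc hg
    rcases adj_dichotomy hxy c with h' | h'
    · rcases btw_total hg (mem_path_comm.1 h') with h1 | h1
      · exact h1
      · exact absurd (path_subset hc h.1 h1) hy
    · exact (btw_left (mem_path_comm.1 h') hg).1
  exact ⟨h.1, key2 a (T.left_mem _ _) h.2.1, key2 b (T.right_mem _ _) h.2.2⟩

lemma IsGate.not_leaf (h : T.IsGate a b x g) (hab : a ≠ b) (hxy : T.G.Adj x y)
    (hoff : ¬ (x ∈ T.path a b ∧ y ∈ T.path a b)) : ¬ T.IsLeaf g := by
  obtain ⟨z, hz, hgz⟩ : ∃ z ∈ T.path a b, T.G.Adj g z := by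
    by_cases hga : g = a
    · rw [hga]
      exact ⟨_, nx_mem _ _, nx_adj hab⟩
    · exact ⟨_, nx_mem_left h.1, nx_adj hga⟩
  by_cases hx : x ∈ T.path a b
  · obtain rfl := h.eq_self hx
    exact not_leaf_of_two hxy hgz fun he => hoff ⟨hx, he ▸ hz⟩
  · have hgx : g ≠ x := fun he => hx (he ▸ h.1)
    refine not_leaf_of_two (nx_adj hgx) hgz ?_
    rintro rfl
    exact (nx_adj hgx).ne (h.eq_of_mem hz (mem_path_comm.1 (nx_mem _ _))).symm

end Gate

variable (T) in
/-- The dart `d` has the right-hand side of the arc from `a` to `b` on its right. -/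
def SideR (a b : V) (d : T.G.Dart) : Prop :=
  (d.fst ∈ T.path a b ∧ d.snd ∈ T.path a b ∧ d.snd = T.nx d.fst b) ∨
  -- Off the arc: since the arc turns sharply at the gate, all other edges there lie on one side of
  -- it, the right one exactly when the turn is to the left.
  (¬ (d.fst ∈ T.path a b ∧ d.snd ∈ T.path a b) ∧
    ∃ g, T.IsGate a b d.fst g ∧ T.cw g (T.nx g a) = T.nx g b)

lemma sideR_on {a b : V} {d : T.G.Dart} (h1 : d.fst ∈ T.path a b) (h2 : d.snd ∈ T.path a b) :
    T.SideR a b d ↔ d.snd = T.nx d.fst b := by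
  simp [SideR, h1, h2]

lemma sideR_off {a b g : V} {d : T.G.Dart}
    (h : ¬ (d.fst ∈ T.path a b ∧ d.snd ∈ T.path a b)) (hg : T.IsGate a b d.fst g) :
    T.SideR a b d ↔ T.cw g (T.nx g a) = T.nx g b := by
  constructor
  · rintro (h' | ⟨-, g', h1, h2⟩)
    · exact absurd ⟨h'.1, h'.2.1⟩ h
    · rwa [hg.unique h1]
  · exact fun h' => .inr ⟨h, g, hg, h'⟩

lemma sideR_symm_off {a b : V} {d : T.G.Dart}
    (h : ¬ (d.fst ∈ T.path a b ∧ d.snd ∈ T.path a b)) :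
    T.SideR a b d.symm ↔ T.SideR a b d := by
  obtain ⟨g, hg⟩ := exists_gate (T := T) a b d.fst
  rw [sideR_off h hg, sideR_off (fun h' => h ⟨h'.2, h'.1⟩) (hg.adj d.adj h)]

lemma sideR_swap [Finite V] {a b : V} (hab : a ≠ b) (hs : T.Sharp (T.path a b)) (ha : T.IsLeaf a)
    (hb : T.IsLeaf b) (d : T.G.Dart) : T.SideR b a d ↔ ¬ T.SideR a b d := by
  by_cases h : d.fst ∈ T.path a b ∧ d.snd ∈ T.path a b
  · rw [sideR_on h.1 h.2, sideR_on (mem_path_comm.1 h.1) (mem_path_comm.1 h.2)]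
    rcases nbr_in_path h.1 h.2 d.adj with ⟨h1, h2⟩ | ⟨h1, h2⟩
    · simp only [h2, true_iff]
      exact nx_ne h.1 h1
    · simp only [h2, not_true_eq_false, iff_false]
      exact (nx_ne (mem_path_comm.1 h.1) h1)
  · obtain ⟨g, hg⟩ := exists_gate (T := T) a b d.fst
    have h' : ¬ (d.fst ∈ T.path b a ∧ d.snd ∈ T.path b a) := by rwa [T.path_comm b a]
    rw [sideR_off h hg, sideR_off h' hg.symm]
    have hgl := hg.not_leaf hab d.adj h
    have hga : g ≠ a := fun he => hgl (he ▸ ha)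
    have hgb : g ≠ b := fun he => hgl (he ▸ hb)
    have := sharp_path_iff.1 hs g hg.1 hga hgb
    constructor
    · exact fun h1 h2 => turn_not_both (nx_adj hga) (nx_adj hgb) (nx_ne hg.1 hga) h2 h1
    · exact fun h1 => this.resolve_left h1

/-- Invariance under this relation lets the side of a dart descend to faces. -/
lemma sideR_follows [Finite V] {a b : V} (hs : T.Sharp (T.path a b)) (ha : T.IsLeaf a)
    (hb : T.IsLeaf b) {d e : T.G.Dart} (h : T.FollowsOnRight d e) :
    T.SideR a b d ↔ T.SideR a b e := by
  obtain ⟨⟨x, w⟩, hxw⟩ := d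
  obtain ⟨⟨w', z⟩, hwz⟩ := e
  obtain ⟨hw, h1, h2⟩ := h
  simp only at hw h1 h2
  subst h1
  have hwx : T.G.Adj w' x := hxw.symm
  have hwz : T.G.Adj w' z := hwz
  by_cases hwp : w' ∈ T.path a b
  swap
  · obtain ⟨g, hg⟩ := exists_gate (T := T) a b w'
    rw [sideR_off (g := g) (fun h => hwp h.2) (hg.adj hwx (fun h => hwp h.1)),
      sideR_off (g := g) (fun h => hwp h.1) hg]
  have hwa : w' ≠ a := fun he => hw (he ▸ ha)
  have hwb : w' ≠ b := fun he => hw (he ▸ hb)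
  have hPN := nx_ne hwp hwa
  have hP : T.G.Adj w' (T.nx w' a) := nx_adj hwa
  have hN : T.G.Adj w' (T.nx w' b) := nx_adj hwb
  have hmem : ∀ {y}, T.G.Adj w' y → y ∈ T.path a b → y = T.nx w' a ∨ y = T.nx w' b :=
    fun hy hyp => (nbr_in_path hwp hyp hy).imp And.right And.right
  have hz_on : z ∈ T.path a b →
      (T.SideR a b ⟨(w', z), hwz⟩ ↔ z = T.nx w' b) := fun h => sideR_on hwp h
  have hz_off : z ∉ T.path a b →
      (T.SideR a b ⟨(w', z), hwz⟩ ↔ T.cw w' (T.nx w' a) = T.nx w' b) := fun h =>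
    sideR_off (fun h' => h h'.2) (isGate_self hwp)
  have hx_P : x = T.nx w' a → T.SideR a b ⟨(x, w'), hxw⟩ := by
    intro hx
    have hxm : x ∈ T.path a b := by rw [hx]; exact nx_mem_left hwp
    have hxa : x ∈ T.path a w' := by rw [hx]; exact mem_path_comm.1 (nx_mem _ _)
    exact (sideR_on (d := ⟨(x, w'), hxw⟩) hxm hwp).2 (nx_unique hxw (btw_left hwp hxa).2)
  have hx_N : x = T.nx w' b → ¬ T.SideR a b ⟨(x, w'), hxw⟩ := by
    intro hx h
    have hxm : x ∈ T.path a b := by rw [hx]; exact nx_mem_right hwp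
    have hxb : x ∈ T.path w' b := by rw [hx]; exact nx_mem _ _
    have h' : w' = T.nx x b := (sideR_on (d := ⟨(x, w'), hxw⟩) hxm hwp).1 h
    have h3 : T.nx x b ∈ T.path x b := nx_mem _ _
    rw [← h'] at h3
    exact adj_not_both hwx b hxb h3
  have hx_off : x ∉ T.path a b →
      (T.SideR a b ⟨(x, w'), hxw⟩ ↔ T.cw w' (T.nx w' a) = T.nx w' b) := fun h =>
    sideR_off (fun h' => h h'.1) ((isGate_self hwp).adj hwx fun h' => h h'.2)
  -- At a left turn the only corner at `w'` on the left of the arc is the one with `z = nx w' a`, `x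
  -- = nx w' b`; at a right turn the only corner on the right is the one with these two exchanged.
  rcases sharp_path_iff.1 hs w' hwp hwa hwb with ht | ht
  · have hd : x ≠ T.nx w' b → T.SideR a b ⟨(x, w'), hxw⟩ := by
      intro hx
      by_cases hxp : x ∈ T.path a b
      · exact hx_P ((hmem hwx hxp).resolve_right hx)
      · exact (hx_off hxp).2 ht
    by_cases hzP : z = T.nx w' a
    · have hxN : x = T.nx w' b := by rw [← h2, hzP, ht]
      have h3 := hz_on (hzP ▸ nx_mem_left hwp)
      rw [h3]
      exact iff_of_false (hx_N hxN) (fun h => hPN (hzP.symm.trans h))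
    · refine iff_of_true (hd ?_) ?_
      · intro hx
        exact hzP ((T.cw w').injective (h2.trans (hx.trans ht.symm)))
      · by_cases hzp : z ∈ T.path a b
        · exact (hz_on hzp).2 ((hmem hwz hzp).resolve_left hzP)
        · exact (hz_off hzp).2 ht
  · have hno : ¬ T.cw w' (T.nx w' a) = T.nx w' b := fun h =>
      turn_not_both hP hN hPN h ht
    have hd : x ≠ T.nx w' a → ¬ T.SideR a b ⟨(x, w'), hxw⟩ := by
      intro hx
      by_cases hxp : x ∈ T.path a b
      · exact hx_N ((hmem hwx hxp).resolve_left hx)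
      · exact fun h => hno ((hx_off hxp).1 h)
    by_cases hzN : z = T.nx w' b
    · have hxP : x = T.nx w' a := by rw [← h2, hzN, ht]
      exact iff_of_true (hx_P hxP) ((hz_on (hzN ▸ nx_mem_right hwp)).2 hzN)
    · refine iff_of_false (hd ?_) ?_
      · intro hx
        exact hzN ((T.cw w').injective (h2.trans (hx.trans ht.symm)))
      · by_cases hzp : z ∈ T.path a b
        · exact fun h => hzN ((hz_on hzp).1 h)
        · exact fun h => hno ((hz_off hzp).1 h)

/-! ### Regions -/

lemma rightFace_eq {x w z : V} (hxw : T.G.Adj x w) (hwz : T.G.Adj w z) (hw : ¬ T.IsLeaf w)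
    (h : T.cw w z = x) : T.rightFace ⟨(x, w), hxw⟩ = T.rightFace ⟨(w, z), hwz⟩ :=
  Quot.sound ⟨hw, rfl, h⟩

lemma eqvGen_symm_off {p : Set V} {x w : V} (h : T.G.Adj x w) (hoff : ¬ (x ∈ p ∧ w ∈ p)) :
    Relation.EqvGen (T.AdjacentOff p) (T.rightFace ⟨(x, w), h⟩) (T.rightFace ⟨(w, x), h.symm⟩) :=
  .rel _ _ ⟨⟨(x, w), h⟩, hoff, rfl, rfl⟩

lemma eqvGen_rotate {p : Set V} {w z : V} (hw : ¬ T.IsLeaf w) (hwz : T.G.Adj w z)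
    (hoff : ¬ (w ∈ p ∧ T.cw w z ∈ p)) : Relation.EqvGen (T.AdjacentOff p)
      (T.rightFace ⟨(w, z), hwz⟩) (T.rightFace ⟨(w, T.cw w z), cw_adj hwz⟩) := by
  rw [← rightFace_eq (cw_adj hwz).symm hwz hw rfl]
  exact eqvGen_symm_off _ fun h => hoff ⟨h.2, h.1⟩

lemma eqvGen_rotate_of_notMem [Finite V] {p : Set V} {w y z : V} (hw : w ∉ p)
    (hwy : T.G.Adj w y) (hwz : T.G.Adj w z) : Relation.EqvGen (T.AdjacentOff p)
      (T.rightFace ⟨(w, y), hwy⟩) (T.rightFace ⟨(w, z), hwz⟩) := by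
  by_cases hl : T.IsLeaf w
  · have : y = z := by
      by_contra hne
      exact not_leaf_of_two hwy hwz hne hl
    subst this
    exact .refl _
  obtain ⟨k, hk⟩ := exists_cw_pow hwy hwz
  induction k generalizing z with
  | zero =>
    obtain rfl : y = z := hk
    exact .refl _
  | succ k ih =>
    subst hk
    have h1 := ih (cw_pow_adj hwy k) rfl
    have h2 := eqvGen_rotate hl (cw_pow_adj hwy k) (p := p) (fun h => hw h.1)
    refine h1.trans _ _ _ ?_
    convert h2 using 4
    rw [pow_succ', Equiv.Perm.mul_apply]

/-- At a left turn, rotating clockwise from the outgoing edge crosses only edges off the arc until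
the incoming edge is reached. -/
lemma eqvGen_rotate_left [Finite V] {a b w z : V} (hw : w ∈ T.path a b) (hwa : w ≠ a)
    (hwb : w ≠ b) (ht : T.cw w (T.nx w a) = T.nx w b) (hwz : T.G.Adj w z) (hz : z ≠ T.nx w a) :
    Relation.EqvGen (T.AdjacentOff (T.path a b))
      (T.rightFace ⟨(w, T.nx w b), nx_adj hwb⟩) (T.rightFace ⟨(w, z), hwz⟩) := by
  have hl := not_leaf_of_mem hw hwa hwb
  have hN : T.G.Adj w (T.nx w b) := nx_adj hwb
  have key : ∀ k : ℕ, ∀ z, ∀ hwz : T.G.Adj w z, (T.cw w ^ k) (T.nx w b) = z → z ≠ T.nx w a →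
      Relation.EqvGen (T.AdjacentOff (T.path a b))
        (T.rightFace ⟨(w, T.nx w b), nx_adj hwb⟩) (T.rightFace ⟨(w, z), hwz⟩) := by
    intro k
    induction k with
    | zero =>
      rintro z hwz rfl -
      exact .refl _
    | succ k ih =>
      rintro z hwz hz hza
      by_cases hzb : z = T.nx w b
      · subst hzb
        exact .refl _
      rw [pow_succ', Equiv.Perm.mul_apply] at hz
      have h1 : (T.cw w ^ k) (T.nx w b) ≠ T.nx w a := by
        intro h
        rw [h, ht] at hz
        exact hzb hz.symm
      have h2 := ih _ (cw_pow_adj hN k) rfl h1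
      subst hz
      refine h2.trans _ _ _ (eqvGen_rotate hl (cw_pow_adj hN k) ?_)
      rintro ⟨-, h⟩
      rcases nbr_in_path hw h hwz with ⟨-, h'⟩ | ⟨-, h'⟩
      exacts [hza h', hzb h']
  obtain ⟨k, hk⟩ := exists_cw_pow hN hwz
  exact key k z hwz hk hz

/-- Induction along the arc: at a left turn one rotates around the vertex on the right-hand side, at
a right turn the two consecutive darts bound the same face. -/
lemma eqvGen_forward [Finite V] {a b : V} (hab : a ≠ b) (hs : T.Sharp (T.path a b)) {h : V}
    (hh : h ∈ T.path a b) (hhb : h ≠ b) : Relation.EqvGen (T.AdjacentOff (T.path a b))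
      (T.rightFace ⟨(h, T.nx h b), nx_adj hhb⟩) (T.rightFace ⟨(a, T.nx a b), nx_adj hab⟩) := by
  obtain ⟨n, hn⟩ : ∃ n, T.G.dist a h = n := ⟨_, rfl⟩
  induction n generalizing h with
  | zero =>
    obtain rfl := T.dist_eq_zero.1 hn
    exact .refl _
  | succ n ih =>
    have hha : h ≠ a := by
      rintro rfl
      simp at hn
    have hP : T.G.Adj h (T.nx h a) := nx_adj hha
    have hPm : T.nx h a ∈ T.path a h := mem_path_comm.1 (nx_mem _ _)
    have hPb := (btw_left hh hPm)
    have hPb' : T.nx h a ≠ b := by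
      intro he
      rw [he] at hPm
      exact hhb (btw_antisymm hh hPm)
    have hnx : h = T.nx (T.nx h a) b := nx_unique hP.symm hPb.2
    have h1 := ih hPb.1 hPb' (by
      have := T.mem_path_iff.1 hPm
      rw [T.dist_adj hP.symm] at this
      omega)
    have h1' : Relation.EqvGen (T.AdjacentOff (T.path a b))
        (T.rightFace ⟨(T.nx h a, h), hP.symm⟩) (T.rightFace ⟨(a, T.nx a b), nx_adj hab⟩) := by
      convert h1 using 4
    have hl := not_leaf_of_mem hh hha hhb
    rcases sharp_path_iff.1 hs h hh hha hhb with ht | ht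
    · obtain ⟨z, hz, hcz⟩ := exists_cw_eq hP
      have hzne : z ≠ T.nx h a := by
        rintro rfl
        exact cw_ne hl hP hcz
      have h2 := eqvGen_rotate_left hh hha hhb ht hz hzne
      rw [← rightFace_eq hP.symm hz hl hcz] at h2
      exact h2.trans _ _ _ h1'
    · rw [← rightFace_eq hP.symm (nx_adj hhb) hl ht]
      exact h1'

/-- Walk to the gate along edges off the arc, which do not separate regions. -/
lemma eqvGen_off [Finite V] {a b g : V} (hga : g ≠ a) (hgb : g ≠ b)
    (ht : T.cw g (T.nx g a) = T.nx g b) {x y : V} (hxy : T.G.Adj x y)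
    (hg : T.IsGate a b x g) (hoff : ¬ (x ∈ T.path a b ∧ y ∈ T.path a b)) :
    Relation.EqvGen (T.AdjacentOff (T.path a b))
      (T.rightFace ⟨(x, y), hxy⟩) (T.rightFace ⟨(g, T.nx g b), nx_adj hgb⟩) := by
  obtain ⟨n, hn⟩ : ∃ n, T.G.dist x g = n := ⟨_, rfl⟩
  induction n generalizing x y with
  | zero =>
    obtain rfl := T.dist_eq_zero.1 hn
    refine (eqvGen_rotate_left hg.1 hga hgb ht hxy ?_).symm _ _
    rintro rfl
    exact hoff ⟨hg.1, nx_mem_left hg.1⟩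
  | succ n ih =>
    have hxg : x ≠ g := by
      rintro rfl
      simp at hn
    have hx : x ∉ T.path a b := fun h => hxg (hg.eq_self h).symm
    have hadj : T.G.Adj x (T.nx x g) := nx_adj hxg
    have h1 := eqvGen_rotate_of_notMem hx hxy hadj
    have h2 := eqvGen_symm_off hadj (p := T.path a b) (fun h => hx h.1)
    have h3 := ih hadj.symm (hg.adj hadj fun h => hx h.1) (fun h => hx h.2) (by
      have := T.mem_path_iff.1 (nx_mem (T := T) x g)
      rw [T.dist_adj hadj] at this
      omega)
    exact (h1.trans _ _ _ h2).trans _ _ _ h3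

lemma eqvGen_of_sideR [Finite V] {a b : V} (hab : a ≠ b) (hs : T.Sharp (T.path a b))
    (ha : T.IsLeaf a) (hb : T.IsLeaf b) {d : T.G.Dart} (hd : T.SideR a b d) :
    Relation.EqvGen (T.AdjacentOff (T.path a b))
      (T.rightFace d) (T.rightFace ⟨(a, T.nx a b), nx_adj hab⟩) := by
  obtain ⟨⟨x, y⟩, hxy⟩ := d
  rcases hd with ⟨h1, h2, h3⟩ | ⟨h1, g, hg, ht⟩
  · simp only at h1 h2 h3
    subst h3
    have hxb : x ≠ b := by
      rintro rfl
      exact hxy.ne (nx_self x).symm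
    exact eqvGen_forward hab hs h1 hxb
  · have hgl := hg.not_leaf hab hxy h1
    have hga : g ≠ a := fun he => hgl (he ▸ ha)
    have hgb : g ≠ b := fun he => hgl (he ▸ hb)
    exact (eqvGen_off hga hgb ht hxy hg h1).trans _ _ _ (eqvGen_forward hab hs hg.1 hgb)

variable (T) in
/-- `a` and `b` are the ends of an arc. -/
structure ArcEnds (a b : V) : Prop where
  ne : a ≠ b
  leaf_a : T.IsLeaf a
  leaf_b : T.IsLeaf b
  sharp : T.Sharp (T.path a b)

lemma ArcEnds.symm {a b : V} (h : T.ArcEnds a b) : T.ArcEnds b a :=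
  ⟨h.ne.symm, h.leaf_b, h.leaf_a, by rw [T.path_comm]; exact h.sharp⟩

lemma IsArc.exists_ends {p : Set V} (h : T.IsArc p) : ∃ a b, T.ArcEnds a b ∧ p = T.path a b := by
  obtain ⟨a, b, h1, h2, h3, rfl, h4⟩ := h
  exact ⟨a, b, ⟨h1, h2, h3, h4⟩, rfl⟩

lemma isArc_path {a b : V} (h : T.IsArc (T.path a b)) : T.ArcEnds a b := by
  obtain ⟨u, v, h1, h2⟩ := h.exists_ends
  rcases path_endpoints h2 with ⟨rfl, rfl⟩ | ⟨rfl, rfl⟩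
  exacts [h1, h1.symm]

/-- The region to which a dart belongs is determined by its side. -/
lemma mem_reg_iff [Finite V] {a b : V} (h : T.ArcEnds a b) (d e : T.G.Dart) :
    T.rightFace e ∈ T.reg (T.path a b) (T.rightFace d) ↔ (T.SideR a b e ↔ T.SideR a b d) := by
  constructor
  · intro he
    -- The side is a function on faces that does not change across edges off the arc.
    let f : T.Face → Prop := Quot.lift (T.SideR a b)
      fun d e hde => propext (sideR_follows h.sharp h.leaf_a h.leaf_b hde)
    have key : ∀ F F', Relation.EqvGen (T.AdjacentOff (T.path a b)) F F' → (f F ↔ f F') := by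
      intro F F' hF
      induction hF with
      | rel F F' hF =>
        obtain ⟨d, h1, rfl, rfl⟩ := hF
        exact (sideR_symm_off h1).symm
      | refl => rfl
      | symm _ _ _ ih => exact ih.symm
      | trans _ _ _ _ _ ih ih' => exact ih.trans ih'
    exact (key _ _ he).symm
  · intro hde
    by_cases hd : T.SideR a b d
    · exact (eqvGen_of_sideR h.ne h.sharp h.leaf_a h.leaf_b hd).trans _ _ _
        ((eqvGen_of_sideR h.ne h.sharp h.leaf_a h.leaf_b (hde.2 hd)).symm _ _)
    -- The left-hand side is the right-hand side of the reversed arc.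
    · have h' := h.symm
      have hd' := (sideR_swap h.ne h.sharp h.leaf_a h.leaf_b d).2 hd
      have he' := (sideR_swap h.ne h.sharp h.leaf_a h.leaf_b e).2 (fun he => hd (hde.1 he))
      change Relation.EqvGen (T.AdjacentOff (T.path a b)) _ _
      rw [T.path_comm a b]
      exact (eqvGen_of_sideR h'.ne h'.sharp h'.leaf_a h'.leaf_b hd').trans _ _ _
        ((eqvGen_of_sideR h'.ne h'.sharp h'.leaf_a h'.leaf_b he').symm _ _)

/-! ### Two arcs traversing a common edge in the same direction -/

variable (T) in
/-- The paths from `a` to `b` and from `a'` to `b'` run along a common edge starting at `o`. -/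
structure Aligned (a b a' b' o : V) : Prop where
  mem : o ∈ T.path a b
  mem' : o ∈ T.path a' b'
  ne : o ≠ b
  ne' : o ≠ b'
  nx_eq : T.nx o b = T.nx o b'

section Aligned

variable {a b a' b' o x h : V}

lemma Aligned.symm (H : T.Aligned a b a' b' o) : T.Aligned a' b' a b o :=
  ⟨H.mem', H.mem, H.ne', H.ne, H.nx_eq.symm⟩

lemma Aligned.mem_right (H : T.Aligned a b a' b' o) (hx' : x ∈ T.path a' b')
    (h : x ∈ T.path o b) : x ∈ T.path o b' := by
  by_cases hxo : x = o
  · rw [hxo]; exact T.left_mem _ _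
  rcases T.mem_path_split H.mem' hx' with h' | h'
  · have h1 := nx_eq_of_mem h hxo
    have h2 := nx_eq_of_mem (mem_path_comm.1 h') hxo
    have hoa : o ≠ a' := by
      rintro rfl
      exact hxo (path_self_eq h')
    exact absurd (h2.symm.trans (h1.trans H.nx_eq)) (nx_ne H.mem' hoa)
  · exact h'

lemma Aligned.mem_left (H : T.Aligned a b a' b' o) (hx' : x ∈ T.path a' b')
    (h : x ∈ T.path a o) : x ∈ T.path a' o := by
  by_cases hxo : x = o
  · rw [hxo]; exact T.right_mem _ _
  rcases T.mem_path_split H.mem' hx' with h' | h'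
  · exact h'
  · have h1 := nx_eq_of_mem h' hxo
    have h2 := nx_eq_of_mem (mem_path_comm.1 h) hxo
    have hoa : o ≠ a := by
      rintro rfl
      exact hxo (path_self_eq h)
    exact absurd (h2.symm.trans (h1.trans H.nx_eq.symm)) (nx_ne H.mem hoa)

/-- Common vertices are left by both paths along a common edge, in one of the directions. -/
lemma Aligned.same_dir (H : T.Aligned a b a' b' o) (hx : x ∈ T.path a b)
    (hx' : x ∈ T.path a' b') :
    (T.nx x a = T.nx x a' ∧ x ≠ a ∧ x ≠ a') ∨ (T.nx x b = T.nx x b' ∧ x ≠ b ∧ x ≠ b') := by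
  by_cases hxo : x = o
  · rw [hxo]
    exact .inr ⟨H.nx_eq, H.ne, H.ne'⟩
  rcases T.mem_path_split H.mem hx with h | h
  · right
    have h' := H.mem_left hx' h
    have h1 := (btw_left H.mem h).2
    have h2 := (btw_left H.mem' h').2
    refine ⟨(nx_eq_of_mem h1 (Ne.symm hxo)).symm.trans (nx_eq_of_mem h2 (Ne.symm hxo)), ?_, ?_⟩
    · rintro rfl
      exact hxo (path_self_eq h1).symm
    · rintro rfl
      exact hxo (path_self_eq h2).symm
  · left
    have h' := H.mem_right hx' h
    have h1 := mem_path_comm.1 (btw_right H.mem h).2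
    have h2 := mem_path_comm.1 (btw_right H.mem' h').2
    refine ⟨(nx_eq_of_mem h1 (Ne.symm hxo)).symm.trans (nx_eq_of_mem h2 (Ne.symm hxo)), ?_, ?_⟩
    · rintro rfl
      exact hxo (path_self_eq h1).symm
    · rintro rfl
      exact hxo (path_self_eq h2).symm

lemma Aligned.order (H : T.Aligned a b a' b' o) (hx : x ∈ T.path a b)
    (hx' : x ∈ T.path a' b') (hh : h ∈ T.path a b) (hh' : h ∈ T.path a' b')
    (hxh : x ∈ T.path a h) : x ∈ T.path a' h := by
  by_cases hne : x = h
  · rw [hne]; exact T.right_mem _ _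
  rcases btw_total hx' hh' with h1 | h1
  · exact h1
  exfalso
  have e1 : T.nx h x = T.nx h a := nx_eq_of_mem (mem_path_comm.1 hxh) hne
  have e2 : T.nx h x = T.nx h b' := nx_eq_of_mem (btw_left hx' h1).2 hne
  have e3 : T.nx x h = T.nx x b := nx_eq_of_mem (btw_left hh hxh).2 (Ne.symm hne)
  have e4 : T.nx x h = T.nx x a' := nx_eq_of_mem (mem_path_comm.1 h1) (Ne.symm hne)
  have hha : h ≠ a := by
    rintro rfl
    exact hne (path_self_eq hxh)
  have hxa' : x ≠ a' := by
    rintro rfl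
    exact hne (path_self_eq h1).symm
  have n1 := nx_ne hh hha
  have n2 := nx_ne hx' hxa'
  by_cases hs : T.nx h a = T.nx h a' ∧ h ≠ a'
  · exact nx_ne hh' hs.2 (hs.1.symm.trans (e1.symm.trans e2))
  rcases H.same_dir hh hh' with k | k
  · exact hs ⟨k.1, k.2.2⟩
  · exact n1 (e1.symm.trans (e2.trans k.1.symm))

/-- Local comparison at a vertex where two aligned arcs diverge. -/
lemma Aligned.diverge (H : T.Aligned a b a' b' o) (hp : T.ArcEnds a b) (hq : T.ArcEnds a' b')
    (hh : h ∈ T.path a b) (hh' : h ∈ T.path a' b')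
    (hne : T.nx h a ≠ T.nx h a' ∨ T.nx h b ≠ T.nx h b') :
    ¬ T.IsLeaf h ∧
    ((T.cw h (T.nx h a) = T.nx h b ∧ T.cw h (T.nx h b') = T.nx h a') ∨
     (T.cw h (T.nx h b) = T.nx h a ∧ T.cw h (T.nx h a') = T.nx h b')) := by
  have hl : ¬ T.IsLeaf h := by
    intro hl
    have h1 := leaf_end hl hh
    have h2 := leaf_end hl hh'
    rcases H.same_dir hh hh' with k | k
    · have e1 := h1.resolve_left k.2.1
      have e2 := h2.resolve_left k.2.2
      subst e1 e2
      exact hne.elim (fun h => h k.1) (fun h => h rfl)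
    · have e1 := h1.resolve_right k.2.1
      have e2 := h2.resolve_right k.2.2
      subst e1 e2
      exact hne.elim (fun h => h rfl) (fun h => h k.1)
  have n1 : h ≠ a := fun he => hl (he ▸ hp.leaf_a)
  have n2 : h ≠ b := fun he => hl (he ▸ hp.leaf_b)
  have n3 : h ≠ a' := fun he => hl (he ▸ hq.leaf_a)
  have n4 : h ≠ b' := fun he => hl (he ▸ hq.leaf_b)
  refine ⟨hl, ?_⟩
  have t1 := sharp_path_iff.1 hp.sharp h hh n1 n2
  have t2 := sharp_path_iff.1 hq.sharp h hh' n3 n4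
  have inj := (T.cw h).injective
  rcases t1 with t1 | t1 <;> rcases t2 with t2 | t2
  · exfalso
    rcases H.same_dir hh hh' with k | k
    · exact hne.elim (fun h => h k.1) (fun h => h (by rw [← t1, ← t2, k.1]))
    · exact hne.elim (fun h => h (inj (by rw [t1, t2, k.1]))) (fun h => h k.1)
  · exact .inl ⟨t1, t2⟩
  · exact .inr ⟨t1, t2⟩
  · exfalso
    rcases H.same_dir hh hh' with k | k
    · exact hne.elim (fun h => h k.1) (fun h => h (inj (by rw [t1, t2, k.1])))
    · exact hne.elim (fun h => h (by rw [← t1, ← t2, k.1])) (fun h => h k.1)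

/-- Aligned arcs which do not diverge are equal. -/
lemma Aligned.eq_or_diverge (H : T.Aligned a b a' b' o) (hp : T.ArcEnds a b)
    (hq : T.ArcEnds a' b') : T.path a b = T.path a' b' ∨
      ∃ h ∈ T.path a b, h ∈ T.path a' b' ∧ (T.nx h a ≠ T.nx h a' ∨ T.nx h b ≠ T.nx h b') := by
  by_contra hcon
  push Not at hcon
  obtain ⟨hne, hcon⟩ := hcon
  have eb : b = b' := by
    obtain ⟨m, h1, h2, h3⟩ := exists_median (T := T) o b b'
    have m1 := (btw_right H.mem h1).1
    have m2 := (btw_right H.mem' h2).1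
    have e := (hcon m m1 m2).2
    by_cases hmb : m = b
    · subst hmb
      refine (leaf_end hp.leaf_b m2).resolve_left ?_
      rintro rfl
      exact H.ne (btw_antisymm (mem_path_comm.1 H.mem') (mem_path_comm.1 h2))
    · exact absurd e (nx_ne h3 hmb)
  have ea : a = a' := by
    obtain ⟨m, h1, h2, h3⟩ := exists_median (T := T) o a a'
    have m1 := (btw_left H.mem (mem_path_comm.1 h1)).1
    have m2 := (btw_left H.mem' (mem_path_comm.1 h2)).1
    have e := (hcon m m1 m2).1
    by_cases hma : m = a
    · subst hma
      refine (leaf_end hp.leaf_a m2).resolve_right ?_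
      rintro rfl
      exact H.ne' (btw_inter H.mem' (mem_path_comm.1 h2) (T.right_mem _ _)).symm
    · exact absurd e (nx_ne h3 hma)
  exact hne (by rw [ea, eb])

/-- If `p` turns left and `q` turns right whenever they diverge, then the right-hand side of `q`
is contained in the right-hand side of `p`. -/
lemma Aligned.sideR_mono [Finite V] (H : T.Aligned a b a' b' o) (hp : T.ArcEnds a b)
    (hq : T.ArcEnds a' b')
    (hN : ∀ h ∈ T.path a b, h ∈ T.path a' b' → (T.nx h a ≠ T.nx h a' ∨ T.nx h b ≠ T.nx h b') →
      T.cw h (T.nx h a) = T.nx h b ∧ T.cw h (T.nx h b') = T.nx h a')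
    {d : T.G.Dart} (hd : T.SideR a' b' d) : T.SideR a b d := by
  obtain ⟨⟨x, y⟩, hxy⟩ := d
  obtain ⟨h, hh⟩ := exists_gate (T := T) a b x
  -- When `x` lies on `q` but off `p`, its gate `h` is a vertex where the two arcs diverge, so the
  -- hypothesis gives a left turn of `p` there.
  have key : x ∈ T.path a' b' → x ≠ h →
      T.cw h (T.nx h a) = T.nx h b := by
    intro hx hxh
    have hh' : h ∈ T.path a' b' := path_subset hx H.mem' (hh.mem_path H.mem)
    have hxp : x ∉ T.path a b := fun h' => hxh (hh.eq_self h').symm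
    have hnx : T.nx h x ∉ T.path a b := by
      intro h'
      exact nx_ne_self hxh.symm (hh.eq_of_mem h' (mem_path_comm.1 (nx_mem _ _)))
    refine (hN h hh.1 hh' ?_).1
    rcases nbr_in_path hh' (path_subset hh' hx (nx_mem _ _)) (nx_adj hxh.symm) with
      ⟨-, e⟩ | ⟨-, e⟩
    · left
      rw [← e]
      intro e'
      exact hnx (e' ▸ nx_mem_left hh.1)
    · right
      rw [← e]
      intro e'
      exact hnx (e' ▸ nx_mem_right hh.1)
  rcases hd with ⟨h1, h2, h3⟩ | ⟨h1, k, hk, ht⟩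
  · simp only at h1 h2 h3
    have hxb' : x ≠ b' := by
      rintro rfl
      exact hxy.ne (h3.trans (nx_self x)).symm
    by_cases hon : x ∈ T.path a b ∧ y ∈ T.path a b
    · refine (sideR_on (d := ⟨(x, y), hxy⟩) hon.1 hon.2).2 ?_
      change y = T.nx x b
      rcases H.same_dir hon.1 h1 with k | k
      · rcases nbr_in_path hon.1 hon.2 hxy with ⟨-, e⟩ | ⟨-, e⟩
        · exact absurd (k.1.symm.trans (e.symm.trans h3)) (nx_ne h1 k.2.2)
        · exact e
      · rw [h3, k.1]
    · refine (sideR_off (d := ⟨(x, y), hxy⟩) hon hh).2 ?_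
      by_cases hxh : x = h
      · subst hxh
        refine (hN x hh.1 h1 (.inr ?_)).1
        rw [← h3]
        intro e
        exact hon ⟨hh.1, e ▸ nx_mem_right hh.1⟩
      · exact key h1 hxh
  · simp only at h1 hk
    have hkl := hk.not_leaf hq.ne hxy h1
    have ka' : k ≠ a' := fun he => hkl (he ▸ hq.leaf_a)
    have kb' : k ≠ b' := fun he => hkl (he ▸ hq.leaf_b)
    have hno : ¬ T.cw k (T.nx k b') = T.nx k a' := fun h =>
      turn_not_both (nx_adj ka') (nx_adj kb') (nx_ne hk.1 ka') ht h
    by_cases hkp : k ∈ T.path a b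
    -- A left turn of `q` at `k` rules out a divergence at `k`, so `p` passes `k` along the same two
    -- edges.
    · have heq : T.nx k a = T.nx k a' ∧ T.nx k b = T.nx k b' := by
        by_contra hcon
        rw [not_and_or] at hcon
        exact hno (hN k hkp hk.1 hcon).2
      have ka : k ≠ a := fun he => hkl (he ▸ hp.leaf_a)
      have kb : k ≠ b := fun he => hkl (he ▸ hp.leaf_b)
      have hmem : ∀ {z}, T.G.Adj k z → z ∈ T.path a b → z ∈ T.path a' b' := by
        intro z hkz hz
        rcases nbr_in_path hkp hz hkz with ⟨-, e⟩ | ⟨-, e⟩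
        · rw [e, heq.1]; exact nx_mem_left hk.1
        · rw [e, heq.2]; exact nx_mem_right hk.1
      have ht' : T.cw k (T.nx k a) = T.nx k b := by rw [heq.1, heq.2, ht]
      by_cases hxk : x = k
      · subst hxk
        refine (sideR_off (d := ⟨(x, y), hxy⟩) ?_ (isGate_self hkp)).2 ht'
        exact fun h' => h1 ⟨hk.1, hmem hxy h'.2⟩
      · have hnx : T.nx k x ∉ T.path a' b' := by
          intro h'
          exact nx_ne_self (Ne.symm hxk) (hk.eq_of_mem h' (mem_path_comm.1 (nx_mem _ _)))
        have hnx' : T.nx k x ∉ T.path a b := fun h' => hnx (hmem (nx_adj (Ne.symm hxk)) h')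
        have hg : T.IsGate a b x k := by
          refine ⟨hkp, T.mem_of_nx_ne ?_, T.mem_of_nx_ne ?_⟩
          · intro e
            exact hnx' (e ▸ nx_mem_left hkp)
          · intro e
            exact hnx' (e ▸ nx_mem_right hkp)
        refine (sideR_off (d := ⟨(x, y), hxy⟩) ?_ hg).2 ht'
        exact fun h' => hxk (hg.eq_self h'.1).symm
    -- The gate of `x` on `q` is off `p`; then the gate of `x` on `p` is the vertex where `q` leaves
    -- `p` towards `k`.
    · obtain ⟨g, hg⟩ := exists_gate (T := T) a b k
      have hgk : k ≠ g := fun he => hkp (he ▸ hg.1)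
      have hgq : g ∈ T.path a' b' := path_subset hk.1 H.mem' (hg.mem_path H.mem)
      have hkx : k ∈ T.path x g := hk.mem_path hgq
      have hhx : h ∈ T.path x g := hh.mem_path hg.1
      have hhg : h = g := by
        rcases T.mem_path_split hkx hhx with h' | h'
        · exact absurd (path_subset hh.1 hg.1 (btw_left hkx h').2) hkp
        · exact hg.eq_of_mem hh.1 h'
      subst hhg
      have hxp : x ∉ T.path a b := by
        intro h'
        exact hkp (path_subset h' hg.1 hkx)
      refine (sideR_off (d := ⟨(x, y), hxy⟩) (fun h' => hxp h'.1) hh).2 ?_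
      refine (hN h hh.1 hgq ?_).1
      have hnx : T.nx h k ∉ T.path a b := by
        intro h'
        exact nx_ne_self hgk.symm (hg.eq_of_mem h' (mem_path_comm.1 (nx_mem _ _)))
      rcases nbr_in_path hgq (path_subset hgq hk.1 (nx_mem _ _)) (nx_adj hgk.symm) with
        ⟨-, e⟩ | ⟨-, e⟩
      · left
        rw [← e]
        intro e'
        exact hnx (e' ▸ nx_mem_left hh.1)
      · right
        rw [← e]
        intro e'
        exact hnx (e' ▸ nx_mem_right hh.1)

/-- Strictness in `Aligned.sideR_mono`. -/
lemma exists_sideR_not_sideR [Finite V] (hp : T.ArcEnds a b) (hq : T.ArcEnds a' b')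
    (hh : h ∈ T.path a b) (hh' : h ∈ T.path a' b') (hl : ¬ T.IsLeaf h)
    (hne : T.nx h a ≠ T.nx h a' ∨ T.nx h b ≠ T.nx h b')
    (hs : (T.nx h a = T.nx h a') ∨ (T.nx h b = T.nx h b'))
    (h1 : T.cw h (T.nx h a) = T.nx h b) (h2 : T.cw h (T.nx h b') = T.nx h a') :
    ∃ d, T.SideR a b d ∧ ¬ T.SideR a' b' d := by
  have n1 : h ≠ a := fun he => hl (he ▸ hp.leaf_a)
  have n2 : h ≠ b := fun he => hl (he ▸ hp.leaf_b)
  have n3 : h ≠ a' := fun he => hl (he ▸ hq.leaf_a)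
  have n4 : h ≠ b' := fun he => hl (he ▸ hq.leaf_b)
  have hno : ¬ T.cw h (T.nx h a') = T.nx h b' := fun h' =>
    turn_not_both (nx_adj n3) (nx_adj n4) (nx_ne hh' n3) h' h2
  by_cases hb : T.nx h b = T.nx h b'
  · have ha : T.nx h a ≠ T.nx h a' := hne.resolve_right fun h => h hb
    refine ⟨⟨(h, T.nx h a'), nx_adj n3⟩, ?_, ?_⟩
    · refine (sideR_off ?_ (isGate_self hh)).2 h1
      rintro ⟨-, h'⟩
      rcases nbr_in_path hh h' (nx_adj n3) with ⟨-, e⟩ | ⟨-, e⟩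
      · exact ha e.symm
      · exact nx_ne hh' n3 (e.trans hb)
    · rw [sideR_on hh' (nx_mem_left hh')]
      exact nx_ne hh' n3
  · have ha := hs.resolve_right hb
    refine ⟨⟨(h, T.nx h b), nx_adj n2⟩, ?_, ?_⟩
    · exact (sideR_on hh (nx_mem_right hh)).2 rfl
    · rw [sideR_off ?_ (isGate_self hh')]
      · exact hno
      rintro ⟨-, h'⟩
      rcases nbr_in_path hh' h' (nx_adj n2) with ⟨-, e⟩ | ⟨-, e⟩
      · exact nx_ne hh n1 (ha.trans e.symm)
      · exact hb e

end Aligned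

/-! ### Crossing arcs -/

/-- A common segment can be traversed in the same direction. -/
lemma exists_aligned {a b a' b' : V} {w : Set V} (hw : T.IsSegment w) (hp : T.ArcEnds a b)
    (hq : T.ArcEnds a' b') (h1 : w ⊆ T.path a b) (h2 : w ⊆ T.path a' b') :
    ∃ a₁ b₁ c d, T.ArcEnds a₁ b₁ ∧ T.path a' b' = T.path a₁ b₁ ∧ c ≠ d ∧ w = T.path c d ∧
      c ∈ T.path a d ∧ d ∈ T.path a b ∧ c ∈ T.path a₁ d ∧ d ∈ T.path a₁ b₁ ∧
      T.Aligned a b a₁ b₁ c := by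
  obtain ⟨c, d, hcd, hc, hd, rfl⟩ := segment_in_path hw h1
  have hcb := btw_left hd hc
  have cb : c ≠ b := fun he => hw.not_leaf (T.left_mem _ _) (he ▸ hp.leaf_b)
  have key : ∀ a₁ b₁, T.ArcEnds a₁ b₁ → c ∈ T.path a₁ d → d ∈ T.path a₁ b₁ →
      T.Aligned a b a₁ b₁ c := by
    intro a₁ b₁ h h3 h4
    have h5 := btw_left h4 h3
    exact ⟨hcb.1, h5.1, cb, fun he => hw.not_leaf (T.left_mem _ _) (he ▸ h.leaf_b),
      (nx_eq_of_mem hcb.2 hcd.symm).symm.trans (nx_eq_of_mem h5.2 hcd.symm)⟩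
  have h3 := h2 (T.left_mem _ _)
  have h4 := h2 (T.right_mem _ _)
  rcases btw_total h3 h4 with h | h
  · exact ⟨a', b', c, d, hq, rfl, hcd, rfl, hc, hd, h, h4, key _ _ hq h h4⟩
  · have h5 := btw_left h3 h
    have h6 := mem_path_comm.1 h5.2
    have h7 := mem_path_comm.1 h5.1
    exact ⟨b', a', c, d, hq.symm, T.path_comm _ _, hcd, rfl, hc, hd, h6, h7,
      key _ _ hq.symm h6 h7⟩

/-- Two divergences of opposite kinds cut out a common segment, which `p` leaves to the left at both
ends and `q` to the right. -/
lemma hom_of_diverge {a b a' b' o h h' : V} (H : T.Aligned a b a' b' o)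
    (hp : T.ArcEnds a b) (hh : h ∈ T.path a b) (hh' : h ∈ T.path a' b')
    (kh : h' ∈ T.path a b) (kh' : h' ∈ T.path a' b') (hl : ¬ T.IsLeaf h) (hl' : ¬ T.IsLeaf h')
    (hord : h ∈ T.path a h') (hne : h ≠ h')
    (h1 : T.cw h (T.nx h b) = T.nx h a) (h2 : T.cw h (T.nx h a') = T.nx h b')
    (h3 : T.cw h' (T.nx h' a) = T.nx h' b) (h4 : T.cw h' (T.nx h' b') = T.nx h' a') :
    T.Hom (T.path a b) (T.path a' b') := by
  have hord' := H.order hh hh' kh kh' hord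
  have b1 := (btw_left kh hord).2
  have b2 := (btw_left kh' hord').2
  have hw : T.IsSegment (T.path h h') :=
    isSegment_path.2 ⟨hne, hl, hl', hp.sharp.mono (path_subset hh kh)⟩
  refine ⟨_, hw, ?_, ?_⟩
  · rw [quo_path_iff hord kh hne]
    refine ⟨fun _ => ?_, fun _ => ?_⟩
    · rw [nx_eq_of_mem b1 hne.symm, h1]
    · rw [nx_eq_of_mem (mem_path_comm.1 hord) hne, h3]
  · rw [sub_path_iff hord' kh' hne]
    refine ⟨fun _ => ?_, fun _ => ?_⟩
    · rw [nx_eq_of_mem b2 hne.symm, h2]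
    · rw [nx_eq_of_mem (mem_path_comm.1 hord') hne, h4]

lemma mem_regions_iff {p : Set V} {P : Set T.Face} :
    P ∈ T.regions p ↔ ∃ d : T.G.Dart, P = T.reg p (T.rightFace d) := by
  constructor
  · rintro ⟨F, rfl⟩
    obtain ⟨d, rfl⟩ := Quot.exists_rep F
    exact ⟨d, rfl⟩
  · rintro ⟨d, rfl⟩
    exact ⟨_, rfl⟩

lemma reg_subset_iff [Finite V] {a b a' b' : V} (hp : T.ArcEnds a b) (hq : T.ArcEnds a' b')
    (d e : T.G.Dart) :
    T.reg (T.path a b) (T.rightFace d) ⊆ T.reg (T.path a' b') (T.rightFace e) ↔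
      ∀ f, (T.SideR a b f ↔ T.SideR a b d) → (T.SideR a' b' f ↔ T.SideR a' b' e) := by
  constructor
  · intro h f hf
    exact (mem_reg_iff hq e f).1 (h ((mem_reg_iff hp d f).2 hf))
  · intro h F hF
    obtain ⟨f, rfl⟩ := Quot.exists_rep F
    exact (mem_reg_iff hq e f).2 (h f ((mem_reg_iff hp d f).1 hF))

lemma arcsCross_comm {p q : Set V} : T.ArcsCross p q ↔ T.ArcsCross q p := by
  constructor <;> rintro ⟨s, h1, h2, h3, h4⟩ <;>
    exact ⟨s, h1, h3, h2, fun P hP Q hQ => (h4 Q hQ P hP).symm⟩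

/-- Near the two ends of the common segment there are darts realising all four combinations of
sides, so neither arc has a region comparable with a region of the other. -/
lemma arcsCross_of_hom [Finite V] {p q : Set V} (hpA : T.IsArc p) (hqA : T.IsArc q)
    (h : T.Hom p q) : T.ArcsCross p q := by
  obtain ⟨w, hw, h1, h2⟩ := h
  obtain ⟨a, b, hp, rfl⟩ := hpA.exists_ends
  obtain ⟨a₀, b₀, hq, rfl⟩ := hqA.exists_ends
  obtain ⟨a', b', c, d, hq', e, hcd, rfl, hc, hd, hc', hd', H⟩ := exists_aligned hw hp hq h1.1 h2.1
  rw [e] at h2 ⊢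
  refine ⟨_, hw, h1.1, h2.1, ?_⟩
  have lc := hw.not_leaf (T.left_mem _ _)
  have ld := hw.not_leaf (T.right_mem _ _)
  have ca : c ≠ a := fun he => lc (he ▸ hp.leaf_a)
  have ca' : c ≠ a' := fun he => lc (he ▸ hq'.leaf_a)
  have cb' : c ≠ b' := fun he => lc (he ▸ hq'.leaf_b)
  have db : d ≠ b := fun he => ld (he ▸ hp.leaf_b)
  have db' : d ≠ b' := fun he => ld (he ▸ hq'.leaf_b)
  have da' : d ≠ a' := fun he => ld (he ▸ hq'.leaf_a)
  have q1 := (quo_path_iff hc hd hcd).1 h1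
  have q2 := (sub_path_iff hc' hd' hcd).1 h2
  have cb := btw_left hd hc
  have cb'' := btw_left hd' hc'
  have ec : T.nx c d = T.nx c b := nx_eq_of_mem cb.2 hcd.symm
  have ec' : T.nx c d = T.nx c b' := nx_eq_of_mem cb''.2 hcd.symm
  have ed : T.nx d c = T.nx d a := nx_eq_of_mem (mem_path_comm.1 hc) hcd
  have ed' : T.nx d c = T.nx d a' := nx_eq_of_mem (mem_path_comm.1 hc') hcd
  have p1 := q1.1 ca
  have p2 := q1.2 db
  have p3 := q2.1 ca'
  have p4 := q2.2 db'
  have adj1 : T.G.Adj c (T.nx c d) := nx_adj hcd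
  have adj2 : T.G.Adj d (T.nx d c) := nx_adj hcd.symm
  have m1 : T.nx c d ∈ T.path a b := by rw [ec]; exact nx_mem_right cb.1
  have m2 : T.nx c d ∈ T.path a' b' := by rw [ec']; exact nx_mem_right cb''.1
  have m3 : T.nx d c ∈ T.path a b := by rw [ed]; exact nx_mem_left hd
  have m4 : T.nx d c ∈ T.path a' b' := by rw [ed']; exact nx_mem_left hd'
  have noc : T.nx c a ∉ T.path a' b' := by
    intro h
    rcases nbr_in_path cb''.1 h (nx_adj ca) with ⟨-, e⟩ | ⟨-, e⟩
    · rw [← p3, ← e] at p1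
      exact cw_cw_ne lc (nx_adj ca) p1
    · rw [← ec'] at e
      exact cw_ne lc adj1 (p1.trans e)
  have nod : T.nx d b ∉ T.path a' b' := by
    intro h
    rcases nbr_in_path hd' h (nx_adj db) with ⟨-, e⟩ | ⟨-, e⟩
    · rw [← ed'] at e
      exact cw_ne ld adj2 (p2.trans e)
    · rw [← p4, ← e] at p2
      exact cw_cw_ne ld (nx_adj db) p2
  have quad : ∀ σ ρ : Prop, ∃ f, (T.SideR a b f ↔ σ) ∧ (T.SideR a' b' f ↔ ρ) := by
    intro σ ρ
    by_cases hσ : σ <;> by_cases hρ : ρ <;> simp only [hσ, hρ, iff_true, iff_false]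
    · exact ⟨⟨(c, T.nx c d), adj1⟩, (sideR_on cb.1 m1).2 ec,
        (sideR_on cb''.1 m2).2 ec'⟩
    · refine ⟨⟨(d, T.nx d b), nx_adj db⟩, (sideR_on hd (nx_mem_right hd)).2 rfl, ?_⟩
      rw [sideR_off (fun h => nod h.2) (isGate_self hd')]
      intro h
      rw [ed'] at p4
      exact turn_not_both (nx_adj da') (nx_adj db') (nx_ne hd' da') h p4
    · refine ⟨⟨(c, T.nx c a), nx_adj ca⟩, ?_, ?_⟩
      · rw [sideR_on cb.1 (nx_mem_left cb.1)]
        exact nx_ne cb.1 ca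
      · rw [sideR_off (fun h => noc h.2) (isGate_self cb''.1), ← ec']
        exact p3
    · refine ⟨⟨(d, T.nx d c), adj2⟩, ?_, ?_⟩
      · rw [sideR_on hd m3]
        change ¬ T.nx d c = T.nx d b
        rw [ed]
        exact nx_ne hd (fun he => ld (he ▸ hp.leaf_a))
      · rw [sideR_on hd' m4]
        change ¬ T.nx d c = T.nx d b'
        rw [ed']
        exact nx_ne hd' da'
  intro P hP Q hQ
  obtain ⟨d₁, rfl⟩ := mem_regions_iff.1 hP
  obtain ⟨d₂, rfl⟩ := mem_regions_iff.1 hQ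
  rw [reg_subset_iff hp hq', reg_subset_iff hq' hp]
  constructor
  · intro h
    obtain ⟨f, f1, f2⟩ := quad (T.SideR a b d₁) (¬ T.SideR a' b' d₂)
    have := h f f1
    tauto
  · intro h
    obtain ⟨f, f1, f2⟩ := quad (¬ T.SideR a b d₁) (T.SideR a' b' d₂)
    have := h f f2
    tauto

/-- If all divergences were of one kind, `Aligned.sideR_mono` would make two regions comparable. So
both kinds occur, and their order along the arcs decides the direction of the map. -/
lemma hom_of_arcsCross [Finite V] {p q : Set V} (hpA : T.IsArc p) (hqA : T.IsArc q)
    (h : T.ArcsCross p q) : T.Hom p q ∨ T.Hom q p := by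
  obtain ⟨w, hw, h1, h2, hreg⟩ := h
  obtain ⟨a, b, hp, rfl⟩ := hpA.exists_ends
  obtain ⟨a₀, b₀, hq, rfl⟩ := hqA.exists_ends
  obtain ⟨a', b', o, -, hq', e, -, -, -, -, -, -, H⟩ := exists_aligned hw hp hq h1 h2
  rw [e] at h2 hreg ⊢
  by_cases N1 : ∀ h ∈ T.path a b, h ∈ T.path a' b' →
      (T.nx h a ≠ T.nx h a' ∨ T.nx h b ≠ T.nx h b') →
      T.cw h (T.nx h a) = T.nx h b ∧ T.cw h (T.nx h b') = T.nx h a'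
  · have hm : ∀ d, T.SideR a' b' d → T.SideR a b d := fun d => H.sideR_mono hp hq' N1
    have hd₁ : T.SideR a' b' ⟨(a', T.nx a' b'), nx_adj hq'.ne⟩ :=
      (sideR_on (d := ⟨(a', T.nx a' b'), nx_adj hq'.ne⟩) (T.left_mem _ _) (nx_mem _ _)).2 rfl
    refine absurd ((reg_subset_iff hq' hp ⟨(a', T.nx a' b'), nx_adj hq'.ne⟩
      ⟨(a', T.nx a' b'), nx_adj hq'.ne⟩).2 ?_) (hreg _ ⟨_, rfl⟩ _ ⟨_, rfl⟩).2
    intro f hf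
    exact iff_of_true (hm f (hf.2 hd₁)) (hm _ hd₁)
  by_cases N2 : ∀ h ∈ T.path a' b', h ∈ T.path a b →
      (T.nx h a' ≠ T.nx h a ∨ T.nx h b' ≠ T.nx h b) →
      T.cw h (T.nx h a') = T.nx h b' ∧ T.cw h (T.nx h b) = T.nx h a
  · have hm : ∀ d, T.SideR a b d → T.SideR a' b' d := fun d => H.symm.sideR_mono hq' hp N2
    have hd₁ : T.SideR a b ⟨(a, T.nx a b), nx_adj hp.ne⟩ :=
      (sideR_on (d := ⟨(a, T.nx a b), nx_adj hp.ne⟩) (T.left_mem _ _) (nx_mem _ _)).2 rfl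
    refine absurd ((reg_subset_iff hp hq' ⟨(a, T.nx a b), nx_adj hp.ne⟩
      ⟨(a, T.nx a b), nx_adj hp.ne⟩).2 ?_) (hreg _ ⟨_, rfl⟩ _ ⟨_, rfl⟩).1
    intro f hf
    exact iff_of_true (hm f (hf.2 hd₁)) (hm _ hd₁)
  push Not at N1 N2
  obtain ⟨h, hh, hh', hne, hn⟩ := N1
  obtain ⟨k, kh', kh, kne, kn⟩ := N2
  obtain ⟨lh, dh⟩ := H.diverge hp hq' hh hh' hne
  obtain ⟨lk, dk⟩ := H.diverge hp hq' kh kh' (kne.imp Ne.symm Ne.symm)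
  replace dh := dh.resolve_left fun h' => hn h'.1 h'.2
  replace dk := dk.resolve_right fun h' => kn h'.2 h'.1
  have hhk : h ≠ k := by
    rintro rfl
    exact hn dk.1 dk.2
  rcases btw_total hh kh with ho | ho
  · exact .inl (hom_of_diverge H hp hh hh' kh kh' lh lk ho hhk dh.1 dh.2 dk.1 dk.2)
  · exact .inr (hom_of_diverge H.symm hq' kh' kh hh' hh lk lh (H.order kh kh' hh hh' ho) hhk.symm
      dk.2 dk.1 dh.2 dh.1)

/-- Crossing of arcs in terms of turns. -/
lemma arcsCross_iff [Finite V] {p q : Set V} (hp : T.IsArc p) (hq : T.IsArc q) :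
    T.ArcsCross p q ↔ T.Hom p q ∨ T.Hom q p :=
  ⟨hom_of_arcsCross hp hq, fun h => h.elim (arcsCross_of_hom hp hq)
    fun h => arcsCross_comm.1 (arcsCross_of_hom hq hp h)⟩

/-! ### Marked arcs -/

/-- Among the compatible arcs through a corner, the good arc has the largest region. -/
lemma TorsionPair.Good.reg_subset [Finite V] {τ : T.TorsionPair} {v a b a' b' : V}
    (hg : τ.Good v a b) (hc : τ.Compat (T.path a' b')) (ha : T.nx v a' = T.nx v a)
    (hb : T.nx v b' = T.nx v b) (hadj : T.G.Adj v (T.nx v a)) :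
    T.reg (T.path a' b') (T.rightFace ⟨(v, T.nx v a), hadj⟩) ⊆
      T.reg (T.path a b) (T.rightFace ⟨(v, T.nx v a), hadj⟩) ∧
    (T.reg (T.path a b) (T.rightFace ⟨(v, T.nx v a), hadj⟩) ⊆
      T.reg (T.path a' b') (T.rightFace ⟨(v, T.nx v a), hadj⟩) → T.path a' b' = T.path a b) := by
  have hp := isArc_path hg.isArc
  have hq := isArc_path hc.1
  have hnab := nx_ne hg.mem hg.ne_a
  have hv' : v ∈ T.path a' b' := T.mem_of_nx_ne (by rwa [ha, hb])
  have H : T.Aligned a' b' a b v :=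
    ⟨hv', hg.mem, fun he => hg.not_leaf (he ▸ hq.leaf_b), hg.ne_b, hb⟩
  have N : ∀ h ∈ T.path a' b', h ∈ T.path a b →
      (T.nx h a' ≠ T.nx h a ∨ T.nx h b' ≠ T.nx h b) →
      T.cw h (T.nx h a') = T.nx h b' ∧ T.cw h (T.nx h b) = T.nx h a := fun h hh' hh hne =>
    hg.diverge hc ha hb hq.leaf_a hq.leaf_b hh hh' hne
  have hd : ¬ T.SideR a b ⟨(v, T.nx v a), hadj⟩ := by
    rw [sideR_on hg.mem (nx_mem_left hg.mem)]
    exact hnab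
  have hd' : ¬ T.SideR a' b' ⟨(v, T.nx v a), hadj⟩ := by
    have hm : T.nx v a ∈ T.path a' b' := by rw [← ha]; exact nx_mem_left hv'
    rw [sideR_on hv' hm]
    change ¬ T.nx v a = T.nx v b'
    rw [hb]
    exact hnab
  rw [reg_subset_iff hq hp, reg_subset_iff hp hq]
  simp only [hd, hd', iff_false]
  refine ⟨fun f hf hf' => hf (H.sideR_mono hq hp N hf'), fun hall => ?_⟩
  rcases H.eq_or_diverge hq hp with h | ⟨h, hh', hh, hne⟩
  · exact h
  · obtain ⟨h1, h2⟩ := N h hh' hh hne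
    obtain ⟨hl, -⟩ := H.diverge hq hp hh' hh hne
    obtain ⟨d, hd1, hd2⟩ := exists_sideR_not_sideR hq hp hh' hh hl hne
      ((H.same_dir hh' hh).imp And.left And.left) h1 h2
    exact absurd hd1 (hall d hd2)

/-! ### Boundary arcs -/

/-- At the two ends of the common segment the arc `[a, b]` leaves `[a', b']`, which turns left at
one end and right at the other: the two departing edges are on different sides of `[a', b']`. -/
lemma quo_sub_off [Finite V] {a b a' b' c d : V} (hp : T.ArcEnds a b) (hq : T.ArcEnds a' b')
    (hw : T.IsSegment (T.path c d)) (hc : c ∈ T.path a d) (hd : d ∈ T.path a b)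
    (hc' : c ∈ T.path a' d) (hd' : d ∈ T.path a' b') (h1 : T.Quo (T.path c d) (T.path a b))
    (h2 : T.Sub (T.path c d) (T.path a' b')) :
    T.nx c a ∉ T.path a' b' ∧ T.nx d b ∉ T.path a' b' ∧ T.cw c (T.nx c a') = T.nx c b' ∧
      T.cw d (T.nx d b') = T.nx d a' := by
  have hcd := hw.ne
  have lc := hw.not_leaf (T.left_mem _ _)
  have ld := hw.not_leaf (T.right_mem _ _)
  have ca : c ≠ a := fun he => lc (he ▸ hp.leaf_a)
  have ca' : c ≠ a' := fun he => lc (he ▸ hq.leaf_a)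
  have db : d ≠ b := fun he => ld (he ▸ hp.leaf_b)
  have db' : d ≠ b' := fun he => ld (he ▸ hq.leaf_b)
  have q1 := (quo_path_iff hc hd hcd).1 h1
  have q2 := (sub_path_iff hc' hd' hcd).1 h2
  have cb'' := btw_left hd' hc'
  have ec' : T.nx c d = T.nx c b' := nx_eq_of_mem cb''.2 hcd.symm
  have ed' : T.nx d c = T.nx d a' := nx_eq_of_mem (mem_path_comm.1 hc') hcd
  have p1 := q1.1 ca
  have p2 := q1.2 db
  have p3 := q2.1 ca'
  have p4 := q2.2 db'
  refine ⟨?_, ?_, p3.trans ec', p4.trans ed'⟩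
  · intro h
    rcases nbr_in_path cb''.1 h (nx_adj ca) with ⟨-, e⟩ | ⟨-, e⟩
    · rw [← p3, ← e] at p1
      exact cw_cw_ne lc (nx_adj ca) p1
    · rw [← ec'] at e
      exact cw_ne lc (nx_adj hcd) (p1.trans e)
  · intro h
    rcases nbr_in_path hd' h (nx_adj db) with ⟨-, e⟩ | ⟨-, e⟩
    · rw [← ed'] at e
      exact cw_ne ld (nx_adj hcd.symm) (p2.trans e)
    · rw [← p4, ← e] at p2
      exact cw_cw_ne ld (nx_adj db) p2

lemma not_common_face [Finite V] {a b x y g h : V} (hp : T.ArcEnds a b) (hx : x ∉ T.path a b)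
    (hy : y ∉ T.path a b) (hg : T.IsGate a b x g) (hh : T.IsGate a b y h)
    (h1 : T.cw g (T.nx g a) = T.nx g b) (h2 : ¬ T.cw h (T.nx h a) = T.nx h b) (F : T.Face)
    (hxF : T.OnFace x F) (hyF : T.OnFace y F) : False := by
  have key : ∀ z k, z ∉ T.path a b → T.IsGate a b z k → ∀ d : T.G.Dart, (z = d.fst ∨ z = d.snd) →
      (T.SideR a b d ↔ T.cw k (T.nx k a) = T.nx k b) := by
    rintro z k hz hk d (rfl | rfl)
    · exact sideR_off (fun h => hz h.1) hk
    · exact sideR_off (fun h => hz h.2) (hk.adj d.adj.symm fun h => hz h.1)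
  obtain ⟨d, rfl, hd⟩ := hxF
  obtain ⟨e, he, he'⟩ := hyF
  have h3 := (mem_reg_iff hp d e).1 (he ▸ Relation.EqvGen.refl _)
  rw [key x g hx hg d hd, key y h hy hh e he'] at h3
  exact h2 (h3.2 h1)

/-- Each of the two arcs has vertices strictly on both sides of the other one, and no face meets
both sides away from an arc. -/
lemma not_boundary_of_quo_sub [Finite V] {p q w : Set V} (hpA : T.IsArc p) (hqA : T.IsArc q)
    (hw : T.IsSegment w) (h1 : T.Quo w p) (h2 : T.Sub w q) :
    ¬ T.IsBoundaryArc p ∧ ¬ T.IsBoundaryArc q := by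
  obtain ⟨a, b, hp, rfl⟩ := hpA.exists_ends
  obtain ⟨a₀, b₀, hq, rfl⟩ := hqA.exists_ends
  obtain ⟨a', b', c, d, hq', e, hcd, rfl, hc, hd, hc', hd', -⟩ := exists_aligned hw hp hq h1.1 h2.1
  rw [e] at h2 hqA ⊢
  have lc := hw.not_leaf (T.left_mem _ _)
  have ld := hw.not_leaf (T.right_mem _ _)
  have ca : c ≠ a := fun he => lc (he ▸ hp.leaf_a)
  have cb : c ≠ b := fun he => lc (he ▸ hp.leaf_b)
  have ca' : c ≠ a' := fun he => lc (he ▸ hq'.leaf_a)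
  have db : d ≠ b := fun he => ld (he ▸ hp.leaf_b)
  have da' : d ≠ a' := fun he => ld (he ▸ hq'.leaf_a)
  have db' : d ≠ b' := fun he => ld (he ▸ hq'.leaf_b)
  have mc := (btw_left hd hc).1
  have mc' := (btw_left hd' hc').1
  have hr : T.mirror.ArcEnds a b := isArc_path (mirror_isArc.2 hpA)
  have hr' : T.mirror.ArcEnds a' b' := isArc_path (mirror_isArc.2 hqA)
  obtain ⟨k1, k2, k3, k4⟩ := quo_sub_off hp hq' hw hc hd hc' hd' h1 h2
  obtain ⟨l1, l2, l3, l4⟩ := quo_sub_off hr' hr (mirror_isSegment.2 hw) hc' hd' hc hd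
    (mirror_quo.2 h2) (mirror_sub.2 h1)
  simp only [mirror_cw, mirror_nx, mirror_path] at l1 l2 l3 l4
  constructor
  · rintro ⟨-, F, hF⟩
    refine not_common_face hq' k1 k2 ((isGate_self mc').adj (nx_adj ca) fun h => k1 h.2)
      ((isGate_self hd').adj (nx_adj db) fun h => k2 h.2) k3 ?_ F (hF _ (nx_mem_left mc))
      (hF _ (nx_mem_right hd))
    exact fun h => turn_not_both (nx_adj da') (nx_adj db') (nx_ne hd' da') h k4
  · rintro ⟨-, F, hF⟩
    refine not_common_face hp l2 l1 ((isGate_self hd).adj (nx_adj db') fun h => l2 h.2)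
      ((isGate_self mc).adj (nx_adj ca') fun h => l1 h.2) l4 ?_ F (hF _ (nx_mem_right hd'))
      (hF _ (nx_mem_left mc'))
    exact fun h => turn_not_both (nx_adj ca) (nx_adj cb) (nx_ne mc ca) h l3

/-- Any `w` lies in the part `Y` of the smallest torsion pair, so it labels some cover `σ ⋖ z`. It
maps to an arc compatible with `σ`; the image lies in `z.X ∩ σ.Y`, hence is `w`. -/
lemma exists_sub_arc [Finite V] {w : Set V} (hw : T.IsSegment w) :
    ∃ q, T.IsArc q ∧ T.Sub w q := by
  have h0 : w ∈ (TorsionPair.ofX (T := T) ∅ (by simp)).Y :=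
    TorsionPair.mem_ofX_Y.2 ⟨hw, by simp⟩
  obtain ⟨σ, z, -, -, hlab, -, -⟩ := TorsionPair.exists_covBy_of_mem_Y h0
  obtain ⟨h1, h2⟩ := TorsionPair.label_mem hlab
  obtain ⟨p, hp, w', hw', h3, h4⟩ := TorsionPair.exists_hom_compat h2
  obtain rfl : w' = w := hlab.subset ⟨TorsionPair.quo_mem h1 hw' h3, hp.sub_mem hw' h4⟩
  exact ⟨p, hp.1, h4⟩

lemma exists_quo_arc [Finite V] {w : Set V} (hw : T.IsSegment w) :
    ∃ q, T.IsArc q ∧ T.Quo w q := by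
  obtain ⟨q, h1, h2⟩ := exists_sub_arc (T := T.mirror) (mirror_isSegment.2 hw)
  exact ⟨q, mirror_isArc.1 h1, mirror_sub.1 h2⟩

/-- With its dual, this shows that an arc involved in a `Hom` is never a boundary arc, so nothing is
lost in discarding the boundary arcs. -/
lemma not_boundary_of_quo [Finite V] {p w : Set V} (hp : T.IsArc p) (hw : T.IsSegment w)
    (h : T.Quo w p) : ¬ T.IsBoundaryArc p := by
  obtain ⟨q, h1, h2⟩ := exists_sub_arc hw
  exact (not_boundary_of_quo_sub hp h1 hw h h2).1

lemma not_boundary_of_sub [Finite V] {p w : Set V} (hp : T.IsArc p) (hw : T.IsSegment w)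
    (h : T.Sub w p) : ¬ T.IsBoundaryArc p := by
  obtain ⟨q, h1, h2⟩ := exists_quo_arc hw
  exact (not_boundary_of_quo_sub h1 hp hw h2 h).2

/-! ### Facets and torsion pairs -/

namespace TorsionPair

variable {τ σ : T.TorsionPair} {w p q : Set V}

/-- The compatible arcs which are not boundary arcs. -/
def facetSet (τ : T.TorsionPair) : Set (Set V) := {p | τ.Compat p ∧ ¬ T.IsBoundaryArc p}

lemma facetSet_maximal [Finite V] (τ : T.TorsionPair) : Maximal T.IsReducedFace τ.facetSet := by
  refine ⟨⟨fun p hp => ⟨hp.1.1, hp.2⟩, fun p hp q hq h => ?_⟩, fun S hS hle q hq => ?_⟩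
  · rcases (arcsCross_iff hp.1.1 hq.1.1).1 h with h | h
    exacts [hp.1.not_hom hq.1 h, hq.1.not_hom hp.1 h]
  · have hqa := hS.1 q hq
    refine ⟨compat_of_forall hqa.1 fun p hp => ?_, hqa.2⟩
    constructor
    · intro h
      obtain ⟨w, hw, h1, -⟩ := id h
      exact hS.2 p (hle ⟨hp, not_boundary_of_quo hp.1 hw h1⟩) q hq
        ((arcsCross_iff hp.1 hqa.1).2 (.inl h))
    · intro h
      obtain ⟨w, hw, -, h1⟩ := id h
      exact hS.2 p (hle ⟨hp, not_boundary_of_sub hp.1 hw h1⟩) q hq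
        ((arcsCross_iff hp.1 hqa.1).2 (.inr h))

/-- The facet of a torsion pair. -/
def toFacet [Finite V] (τ : T.TorsionPair) : T.Facet := ⟨τ.facetSet, τ.facetSet_maximal⟩

/-- For `w ∈ τ.X ∩ σ.Y`, an arc compatible with `τ` that maps to `w` cannot be compatible with `σ`.
-/
lemma le_of_facetSet [Finite V] (h : τ.facetSet ⊆ σ.facetSet) : τ ≤ σ := by
  by_contra hcon
  obtain ⟨w, h1, h2⟩ := exists_inter hcon
  obtain ⟨p, hp, hh⟩ := exists_compat_hom h1
  obtain ⟨w', hw', h3, -⟩ := id hh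
  exact (h ⟨hp, not_boundary_of_quo hp.1 hw' h3⟩).1.2.1 w h2 hh

lemma toFacet_injective [Finite V] : Function.Injective (toFacet (T := T)) := by
  intro τ σ h
  have h' : τ.facetSet = σ.facetSet := congrArg Subtype.val h
  exact le_antisymm (le_of_facetSet h'.le) (le_of_facetSet h'.ge)

/-- Let `Y` be generated by the segments that receive no map from `F`. All arcs of `F` are
compatible with this torsion pair because they do not map to each other, and maximality of `F` gives
equality. -/
lemma toFacet_surjective [Finite V] : Function.Surjective (toFacet (T := T)) := by
  rintro ⟨F, hF⟩
  have hseg : ∀ t ∈ {t | T.IsSegment t ∧ ∀ p ∈ F, ¬ T.Hom p t}, T.IsSegment t := fun _ ht => ht.1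
  have hcross : ∀ p ∈ F, ∀ q ∈ F, ¬ T.Hom p q := fun p hp q hq h =>
    hF.1.2 p hp q hq ((arcsCross_iff (hF.1.1 p hp).1 (hF.1.1 q hq).1).2 (.inl h))
  refine ⟨ofY _ hseg, Subtype.ext (hF.eq_of_subset (facetSet_maximal _).1 ?_).symm⟩
  intro p hp
  refine ⟨⟨(hF.1.1 p hp).1, ?_, ?_⟩, (hF.1.1 p hp).2⟩
  · rintro t ht ⟨w, hw, h1, h2⟩
    have hX : w ∈ (ofY _ hseg).X := ⟨hw, fun t ht h => ht.2 p hp (Hom.of_quo h1 h)⟩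
    exact disj hX (TorsionPair.sub_mem ht hw h2)
  · rintro s hs ⟨w, hw, h1, h2⟩
    refine disj (TorsionPair.quo_mem hs hw h1) (subset_ofY ⟨hw, fun f hf h => ?_⟩)
    exact hcross f hf p hp (Hom.of_sub h2 h)

/-! ### Marked arcs of the facet of a torsion pair -/

lemma _root_.PlaneTree.corner_ends [Finite V] {c : T.Corner} (hp : T.IsArc p)
    (hc : T.ContainsCorner p c) : ∃ a b, T.ArcEnds a b ∧ p = T.path a b ∧
      T.nx c.1.fst a = c.1.snd ∧ T.nx c.1.fst b = T.cw c.1.fst c.1.snd := by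
  obtain ⟨h1, h2, h3⟩ := hc
  obtain ⟨a, b, hab, rfl⟩ := hp.exists_ends
  have hadj := c.1.adj
  have hne := cw_ne c.2 hadj
  rcases nbr_in_path h1 h2 hadj with ⟨-, e⟩ | ⟨-, e⟩ <;>
    rcases nbr_in_path h1 h3 (cw_adj hadj) with ⟨-, e'⟩ | ⟨-, e'⟩
  · exact absurd (e'.trans e.symm) hne
  · exact ⟨a, b, hab, rfl, e.symm, e'.symm⟩
  · exact ⟨b, a, hab.symm, T.path_comm _ _, e.symm, e'.symm⟩
  · exact absurd (e'.trans e.symm) hne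

lemma Good.containsCorner [Finite V] {v a b : V} (h : τ.Good v a b) {c : T.Corner}
    (hv : c.1.fst = v) (ha : T.nx v a = c.1.snd) : T.ContainsCorner (T.path a b) c := by
  subst hv
  refine ⟨h.mem, ?_, ?_⟩
  · rw [← ha]; exact nx_mem_left h.mem
  · rw [← ha, h.turn]; exact nx_mem_right h.mem

/-- The good arcs of `τ` are the marked arcs of its facet. -/
lemma marked_iff [Finite V] {c : T.Corner} : T.Marked τ.facetSet p c ↔ ¬ T.IsBoundaryArc p ∧
    ∃ a b, p = T.path a b ∧ τ.Good c.1.fst a b ∧ T.nx c.1.fst a = c.1.snd := by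
  obtain ⟨⟨⟨v, e⟩, hadj⟩, hv⟩ := c
  change T.G.Adj v e at hadj
  change ¬ T.IsLeaf v at hv
  constructor
  · rintro ⟨hp, hc, hmax⟩
    refine ⟨hp.2, ?_⟩
    obtain ⟨a', b', hq, rfl, ha', hb'⟩ := corner_ends hp.1.1 hc
    change T.nx v a' = e at ha'
    change T.nx v b' = T.cw v e at hb'
    obtain ⟨a, b, ha, hb, hg⟩ := exists_good (τ := τ) hv hadj
    subst ha
    refine ⟨a, b, ?_, hg, rfl⟩
    have hmem : v ∈ T.path a' b' := hc.1
    have H : T.Aligned a' b' a b v := ⟨hmem, hg.mem, fun he => hv (he ▸ hq.leaf_b), hg.ne_b,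
      hb'.trans hb.symm⟩
    rcases H.eq_or_diverge hq (isArc_path hg.isArc) with h | ⟨h, hh', hh, hne⟩
    · exact h
    have hl := (H.diverge hq (isArc_path hg.isArc) hh' hh hne).1
    have hd := hg.diverge hp.1 ha' (hb'.trans hb.symm) hq.leaf_a hq.leaf_b hh hh' hne
    -- The good arc at the corner belongs to the facet: diverging from the marked arc at `h`, it has
    -- the segment between `v` and `h` as a quotient or a sub, so it is not a boundary arc. Being
    -- largest at the corner, it must equal the marked arc.
    have hnb : ¬ T.IsBoundaryArc (T.path a b) := by
      have hhv : h ≠ v := by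
        rintro rfl
        exact hne.elim (fun h => h ha') (fun h => h (hb'.trans hb.symm))
      have hvs : T.IsSegment (T.path v h) := isSegment_path.2
        ⟨hhv.symm, hv, hl, (isArc_path hg.isArc).sharp.mono (path_subset hg.mem hh)⟩
      rcases T.mem_path_split hg.mem hh with h1 | h1
      · have h2 := (btw_left hg.mem h1).2
        rw [T.path_comm] at hvs
        refine not_boundary_of_quo hg.isArc hvs ((quo_path_iff h1 hg.mem hhv).2
          ⟨fun _ => ?_, fun _ => ?_⟩)
        · rw [nx_eq_of_mem h2 hhv.symm, hd.2]
        · rw [nx_eq_of_mem (mem_path_comm.1 h1) hhv, hg.turn]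
      · have h2 := btw_right hg.mem h1
        refine not_boundary_of_sub hg.isArc hvs ((sub_path_iff h2.2 hh hhv.symm).2
          ⟨fun _ => ?_, fun _ => ?_⟩)
        · rw [nx_eq_of_mem h1 hhv, hg.turn]
        · rw [nx_eq_of_mem (mem_path_comm.1 h2.2) hhv.symm, hd.2]
    exact (hg.reg_subset hp.1 ha' (hb'.trans hb.symm) hadj).2
      (hmax _ ⟨hg.compat, hnb⟩ (hg.containsCorner rfl rfl))
  · rintro ⟨hnb, a, b, rfl, hg, ha⟩
    change T.nx v a = e at ha
    change τ.Good v a b at hg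
    subst ha
    refine ⟨⟨hg.compat, hnb⟩, hg.containsCorner rfl rfl, ?_⟩
    rintro q hq hqc
    obtain ⟨a', b', hq', rfl, ha', hb'⟩ := corner_ends hq.1.1 hqc
    change T.nx v a' = T.nx v a at ha'
    change T.nx v b' = T.cw v (T.nx v a) at hb'
    exact (hg.reg_subset hq.1 ha' (hb'.trans hg.turn) hadj).1

end TorsionPair

namespace TorsionPair

variable {τ τ' σ : T.TorsionPair} {w p q s : Set V} {v u a b a' b' : V}

/-! ### Arcs which are marked at two corners -/

/-- The ray rule at `u` seen from `v`, and at `v` seen from `u`, must agree with the turns of the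
arc. Only opposite orientations survive, with a right turn at `u` and `[v, u]` in `Y`. Hence an arc
is marked at no more than two corners. -/
lemma Good.right [Finite V] (h : τ.Good v a b) (h' : τ.Good u a' b')
    (hp : T.path a b = T.path a' b') (hu : u ∈ T.path v b) (hne : u ≠ v) :
    a' = b ∧ b' = a ∧ T.path v u ∈ τ.Y := by
  have hub : u ≠ b := fun he => h'.not_leaf (he ▸ h.leaf_b)
  have hua : u ≠ a := fun he => h'.not_leaf (he ▸ h.leaf_a)
  have huab := btw_right h.mem hu
  have hab := nx_ne huab.1 hua
  have e1 : T.nx u v = T.nx u a := nx_eq_of_mem (mem_path_comm.1 huab.2) hne.symm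
  have e2 : T.nx v u = T.nx v b := nx_eq_of_mem hu hne
  have no := turn_not_both (nx_adj hua) (nx_adj hub) hab
  rcases h.ray_b u hu hne hub with ⟨hX, ht⟩ | ⟨hY, ht⟩ <;>
    rcases path_endpoints hp with ⟨rfl, rfl⟩ | ⟨rfl, rfl⟩ <;> rw [e1] at ht
  · rcases h'.ray_a v (mem_path_comm.1 huab.2) hne.symm h.ne_a with ⟨-, h1⟩ | ⟨h1, -⟩
    · rw [e2] at h1
      exact (turn_not_both (nx_adj h.ne_a) (nx_adj h.ne_b) (nx_ne h.mem h.ne_a) h.turn h1).elim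
    · rw [T.path_comm] at h1
      exact (disj hX h1).elim
  · exact (no ht h'.turn).elim
  · exact (no h'.turn ht).elim
  · exact ⟨rfl, rfl, hY⟩

lemma Good.unique [Finite V] (h : τ.Good v a b) (h' : τ.Good u a b) : u = v := by
  by_contra hne
  have hab := (isArc_path h.isArc).ne
  rcases T.mem_path_split h.mem h'.mem with h1 | h1
  · exact hab (h'.right h rfl (btw_left h.mem h1).2 (Ne.symm hne)).1
  · exact hab (h.right h' rfl h1 hne).1

lemma Good.ne [Finite V] (h : τ.Good v a b) (h' : τ.Good u b a) : u ≠ v := by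
  rintro rfl
  exact turn_not_both (nx_adj h.ne_a) (nx_adj h.ne_b) (nx_ne h.mem h.ne_a) h.turn h'.turn

lemma Good.mem_or_mem [Finite V] (h : τ.Good v a b) (h' : τ.Good u b a) :
    (u ∈ T.path v b ∧ T.path v u ∈ τ.Y) ∨ (u ∈ T.path v a ∧ T.path v u ∈ τ.X) := by
  rcases T.mem_path_split h.mem (T.path_comm b a ▸ h'.mem) with h1 | h1
  · exact .inr ⟨mem_path_comm.1 h1, (h.mirror.right h'.mirror (T.path_comm b a)
      (mem_path_comm.1 h1) (h.ne h')).2.2⟩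
  · exact .inl ⟨h1, (h.right h' (T.path_comm a b) h1 (h.ne h')).2.2⟩

/-- At a divergence, comparison with the good arc at `v` and with the same arc seen from `u` would
make this arc turn in opposite ways. -/
lemma Good.eq_of_two [Finite V] (h : τ.Good v a b) (h' : τ.Good u b a)
    (hr : τ.Compat (T.path a' b')) (h1 : T.nx v a' = T.nx v a) (h2 : T.nx v b' = T.nx v b)
    (h3 : T.nx u a' = T.nx u a) (h4 : T.nx u b' = T.nx u b) : T.path a' b' = T.path a b := by
  have hr' := isArc_path hr.1
  have hp := isArc_path h.isArc
  have hv' : v ∈ T.path a' b' := by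
    apply T.mem_of_nx_ne
    rw [h1, h2]
    exact nx_ne h.mem h.ne_a
  have H : T.Aligned a b a' b' v :=
    ⟨h.mem, hv', h.ne_b, fun he => h.not_leaf (he ▸ hr'.leaf_b), h2.symm⟩
  rcases H.eq_or_diverge hp hr' with he | ⟨g, hg, hg', hne⟩
  · exact he.symm
  exfalso
  have hl := (H.diverge hp hr' hg hg' hne).1
  have hne' := hne.imp Ne.symm Ne.symm
  have k1 := h.diverge hr h1 h2 hr'.leaf_a hr'.leaf_b hg hg' hne'
  have k2 := h'.diverge (T.path_comm a' b' ▸ hr) h4 h3 hr'.leaf_b hr'.leaf_a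
    (mem_path_comm.1 hg) (mem_path_comm.1 hg') hne'.symm
  have hga : g ≠ a := fun he => hl (he ▸ hp.leaf_a)
  have hgb : g ≠ b := fun he => hl (he ▸ hp.leaf_b)
  exact turn_not_both (nx_adj hga) (nx_adj hgb) (nx_ne hg hga) k2.2 k1.2

lemma marked_pair [Finite V] {c c' : T.Corner} (hc : T.Marked τ.facetSet p c)
    (hc' : T.Marked τ.facetSet p c') (hne : c ≠ c') : ∃ a b, p = T.path a b ∧
      τ.Good c.1.fst a b ∧ τ.Good c'.1.fst b a ∧ T.nx c.1.fst a = c.1.snd ∧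
        T.nx c'.1.fst b = c'.1.snd := by
  obtain ⟨-, a, b, rfl, h1, h2⟩ := marked_iff.1 hc
  obtain ⟨-, a', b', h3, h4, h5⟩ := marked_iff.1 hc'
  rcases path_endpoints h3 with ⟨rfl, rfl⟩ | ⟨rfl, rfl⟩
  · have he := h1.unique h4
    refine absurd (Subtype.ext (SimpleGraph.Dart.ext _ _ (Prod.ext he.symm ?_))) hne
    change c.1.snd = c'.1.snd
    rw [← h2, ← h5, he]
  · exact ⟨a, b, rfl, h1, h4, h2, h5⟩

/-! ### Exchanges of arcs -/

/-- The facet of `τ'` arises from the facet of `τ` by an exchange of arcs along `path v u`. -/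
structure Exchange (τ τ' : T.TorsionPair) (v u a b a' b' : V) : Prop where
  good_v : τ.Good v a b
  good_u : τ.Good u b a
  mem : u ∈ T.path v b
  good_v' : τ'.Good v a' b'
  good_u' : τ'.Good u b' a'
  mem' : u ∈ T.path v a'
  notMem : T.path a' b' ∉ τ.facetSet
  facetSet_eq : τ'.facetSet = insert (T.path a' b') (τ.facetSet \ {T.path a b})

lemma Good.sub [Finite V] (h : τ.Good v a b) (h' : τ.Good u b a) (hu : u ∈ T.path v b) :
    T.Sub (T.path v u) (T.path a b) := by
  have hne := h.ne h'
  have h1 := btw_right h.mem hu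
  rw [sub_path_iff h1.2 h1.1 hne.symm]
  refine ⟨fun _ => ?_, fun _ => ?_⟩
  · rw [h.turn, nx_eq_of_mem hu hne]
  · rw [h'.turn, nx_eq_of_mem (mem_path_comm.1 h1.2) hne.symm]

lemma Good.quo [Finite V] (h : τ.Good v a b) (h' : τ.Good u b a) (hu : u ∈ T.path v a) :
    T.Quo (T.path v u) (T.path a b) := by
  have := h.mirror.sub h'.mirror hu
  rw [mirror_sub, mirror_path, mirror_path, T.path_comm b a] at this
  exact this

namespace Exchange

lemma isSegment [Finite V] (h : Exchange τ τ' v u a b a' b') : T.IsSegment (T.path v u) :=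
  isSegment_path.2 ⟨(h.good_v.ne h.good_u).symm, h.good_v.not_leaf, h.good_u.not_leaf,
    h.good_v.ray_b.sharp.mono (path_subset_left h.mem)⟩

lemma mem_Y [Finite V] (h : Exchange τ τ' v u a b a' b') : T.path v u ∈ τ.Y :=
  h.good_v.compat.sub_mem h.isSegment (h.good_v.sub h.good_u h.mem)

lemma mem_X [Finite V] (h : Exchange τ τ' v u a b a' b') : T.path v u ∈ τ'.X :=
  h.good_v'.compat.quo_mem h.isSegment (h.good_v'.quo h.good_u' h.mem')

lemma mem_facetSet [Finite V] (h : Exchange τ τ' v u a b a' b') : T.path a b ∈ τ.facetSet :=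
  ⟨h.good_v.compat, not_boundary_of_sub h.good_v.isArc h.isSegment
    (h.good_v.sub h.good_u h.mem)⟩

lemma mem_facetSet' (h : Exchange τ τ' v u a b a' b') : T.path a' b' ∈ τ'.facetSet := by
  rw [h.facetSet_eq]
  exact .inl rfl

lemma notMem' [Finite V] (h : Exchange τ τ' v u a b a' b') : T.path a b ∉ τ'.facetSet := by
  rw [h.facetSet_eq]
  rintro (h1 | h1)
  · exact h.notMem (h1 ▸ h.mem_facetSet)
  · exact h1.2 rfl

lemma ne [Finite V] (h : Exchange τ τ' v u a b a' b') : u ≠ v := h.good_v.ne h.good_u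

lemma nx_v [Finite V] (h : Exchange τ τ' v u a b a' b') : T.nx v a' = T.nx v b := by
  rw [← nx_eq_of_mem h.mem h.ne, ← nx_eq_of_mem h.mem' h.ne]

lemma nx_u [Finite V] (h : Exchange τ τ' v u a b a' b') : T.nx u b' = T.nx u a := by
  rw [← nx_eq_of_mem (mem_path_comm.1 (btw_right h.good_v.mem h.mem).2) h.ne.symm,
    ← nx_eq_of_mem (btw_left h.good_v'.mem (mem_path_comm.1 h.mem')).2 h.ne.symm]

lemma flip [Finite V] (h : Exchange τ τ' v u a b a' b') :
    τ.toFacet.Flip (T.path v u) τ'.toFacet := by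
  have hb := h.mem_facetSet.2
  have hb' := h.mem_facetSet'.2
  refine ⟨_, _, h.mem_facetSet, h.notMem, h.facetSet_eq,
    ⟨⟨(v, T.nx v a), nx_adj h.good_v.ne_a⟩, h.good_v.not_leaf⟩,
    ⟨⟨(u, T.nx u b), nx_adj h.good_u.ne_a⟩, h.good_u.not_leaf⟩, ?_, ?_, ?_, ?_, ?_, rfl⟩
  · intro he
    exact h.ne.symm (congrArg (fun c : T.Corner => c.1.fst) he)
  · exact marked_iff.2 ⟨hb, a, b, rfl, h.good_v, rfl⟩
  · exact marked_iff.2 ⟨hb, b, a, T.path_comm _ _, h.good_u, rfl⟩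
  · exact marked_iff.2 ⟨hb', a', b', rfl, h.good_v', h.nx_v.trans h.good_v.turn.symm⟩
  · exact marked_iff.2 ⟨hb', b', a', T.path_comm _ _, h.good_u', h.nx_u.trans h.good_u.turn.symm⟩

end Exchange

lemma exists_exchange_of_flip [Finite V] (h : τ.toFacet.Flip s τ'.toFacet) :
    ∃ v u a b a' b', s = T.path v u ∧ Exchange τ τ' v u a b a' b' := by
  obtain ⟨p, q, hp, hq, hF, ⟨⟨⟨v, e⟩, he⟩, hv⟩, ⟨⟨⟨u, f⟩, hf⟩, hu⟩, hne, h1, h2, h3, h4, rfl⟩ := h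
  obtain ⟨a, b, rfl, g1, g2, g3, g4⟩ := marked_pair h1 h2 hne
  have huv : u ≠ v := g1.ne g2
  obtain ⟨a', b', rfl, k1, k2, k3, k4⟩ := marked_pair h3 h4
    (fun he => huv (congrArg (fun c : T.Corner => c.1.fst) he).symm)
  change τ'.Good v a' b' at k1
  change τ'.Good u b' a' at k2
  change T.nx v a = e at g3
  change T.nx v a' = T.cw v e at k3
  refine ⟨v, u, a, b, a', b', rfl, ?_⟩
  change τ.Good v a b at g1
  change τ.Good u b a at g2
  have e1 : T.nx v a' = T.nx v b := by rw [k3, ← g3, g1.turn]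
  -- The clockwise move makes the new arc use the edges of the old one towards `b` at `v`, so the
  -- position of `u` switches from the `b`-side of the old arc to the `a'`-side of the new one; the
  -- other three combinations give impossible turns.
  rcases g1.mem_or_mem g2 with ⟨h5, -⟩ | ⟨h5, -⟩ <;>
    rcases k1.mem_or_mem k2 with ⟨h6, -⟩ | ⟨h6, -⟩
  · exfalso
    refine nx_ne k1.mem k1.ne_a ?_
    rw [e1, ← nx_eq_of_mem h5 huv, nx_eq_of_mem h6 huv]
  · exact ⟨g1, g2, h5, k1, k2, h6, hq, hF⟩
  · exfalso
    refine cw_cw_ne hv (nx_adj g1.ne_a) ?_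
    rw [g1.turn, ← e1, k1.turn, ← nx_eq_of_mem h6 huv, nx_eq_of_mem h5 huv]
  · exfalso
    refine nx_ne g1.mem g1.ne_a ?_
    rw [← e1, ← nx_eq_of_mem h5 huv, nx_eq_of_mem h6 huv]

/-! ### Covering relations are exchanges -/

/-- Suppose the ray left the label at `m` before `u`. A left turn puts `[v, m]` in `X`, although it
is a sub of the label in `Y`; a right turn makes `[v, m]` a second element of `τ'.X ∩ τ.Y`. -/
lemma IsRay.mem_of_label [Finite V] (hr : τ.IsRay v b) (hb : T.IsLeaf b)
    (hnx : T.nx v b = T.nx v u) (hs : τ'.X ∩ τ.Y = {T.path v u}) :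
    u ∈ T.path v b ∧ T.cw u (T.nx u b) = T.nx u v := by
  obtain ⟨hX, hY⟩ := label_mem hs
  have hseg := seg_X hX
  have hvu := hseg.ne
  have hvb : v ≠ b := fun he => hseg.not_leaf (T.left_mem _ _) (he ▸ hb)
  have hub : u ≠ b := fun he => hseg.not_leaf (T.right_mem _ _) (he ▸ hb)
  obtain ⟨m, h1, h2, h3⟩ := exists_median (T := T) v u b
  have hmv : m ≠ v := by
    rintro rfl
    exact nx_ne h3 hvu hnx.symm
  have hmb : m ≠ b := fun he => hseg.not_leaf h1 (he ▸ hb)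
  have hmu : m = u := by
    by_contra hmu
    have hne := nx_ne h3 hmu
    have hms := hseg.sub (T.left_mem _ _) h1 hmv.symm
    rcases hr m h2 hmv hmb with ⟨k1, k2⟩ | ⟨k1, k2⟩
    · refine disj k1 (TorsionPair.sub_mem hY hms ?_)
      rw [sub_path_iff (T.left_mem _ _) h1 hmv.symm]
      refine ⟨fun h => absurd rfl h, fun _ => ?_⟩
      rcases sharp_path_iff.1 hseg.sharp m h1 hmv hmu with h' | h'
      · exact absurd (h'.symm.trans k2) hne
      · exact h'
    · have k3 : T.path v m ∈ τ'.X := by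
        refine TorsionPair.quo_mem hX hms ?_
        rw [quo_path_iff (T.left_mem _ _) h1 hmv.symm]
        refine ⟨fun h => absurd rfl h, fun _ => ?_⟩
        rcases sharp_path_iff.1 hseg.sharp m h1 hmv hmu with h' | h'
        · exact h'
        · exact absurd ((T.cw m).injective (h'.trans k2.symm)) hne
      rcases path_endpoints (hs.subset ⟨k3, k1⟩) with ⟨-, h⟩ | ⟨h, -⟩
      · exact hmu h
      · exact hvu h
  subst hmu
  refine ⟨h2, ?_⟩
  rcases hr m h2 hmv hmb with ⟨k1, -⟩ | ⟨-, k2⟩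
  · exact (disj k1 hY).elim
  · exact k2

/-- Beyond `u`, the rays from `v` and from `u` follow the same rule: concatenating the label, which
lies in `τ.Y` and `τ'.X`, with `[u, m]` excludes different turns at `m`. -/
lemma ray_end_eq [Finite V] {b₂ : V} (hr : τ.IsRay v b) (hr' : τ.IsRay u b₂) (hb : T.IsLeaf b)
    (hb₂ : T.IsLeaf b₂) (hu : u ∈ T.path v b) (hnx : T.nx u b = T.nx u b₂) (h : τ ≤ τ')
    (hs : τ'.X ∩ τ.Y = {T.path v u}) : b = b₂ := by
  obtain ⟨hX, hY⟩ := label_mem hs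
  have hseg := seg_X hX
  have hvu := hseg.ne
  have hub : u ≠ b := fun he => hseg.not_leaf (T.right_mem _ _) (he ▸ hb)
  have hub₂ : u ≠ b₂ := fun he => hseg.not_leaf (T.right_mem _ _) (he ▸ hb₂)
  obtain ⟨m, h1, h2, h3⟩ := exists_median (T := T) u b b₂
  have hmu : m ≠ u := by
    rintro rfl
    exact nx_ne h3 hub hnx
  by_cases hmb : m = b
  · subst hmb
    exact (leaf_end hb h2).resolve_left hub.symm
  by_cases hmb₂ : m = b₂
  · subst hmb₂
    exact ((leaf_end hb₂ h1).resolve_left hub₂.symm).symm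
  exfalso
  have hne := nx_ne h3 hmb
  have hmv := btw_right hu h1
  have hmv' : m ≠ v := by
    rintro rfl
    exact hvu (path_self_eq hmv.2).symm
  have e1 : T.nx m v = T.nx m u := (nx_eq_of_mem (mem_path_comm.1 hmv.2) hmu.symm).symm
  have k1 := hr m hmv.1 hmv' hmb
  rw [e1] at k1
  have hms : T.IsSegment (T.path v m) := isSegment_path.2 ⟨hmv'.symm,
    hseg.not_leaf (T.left_mem _ _), not_leaf_of_mem h1 hmu hmb,
    hr.sharp.mono (path_subset_left hmv.1)⟩
  rcases k1 with ⟨k1, k2⟩ | ⟨k1, k2⟩ <;> rcases hr' m h2 hmu hmb₂ with ⟨k3, k4⟩ | ⟨k3, k4⟩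
  · exact hne (k2.symm.trans k4)
  · exact disj k1 (concat_Y hmv.2 hY k3 hms)
  · rcases path_endpoints (hs.subset ⟨concat_X hmv.2 hX (h k3) hms, k1⟩) with ⟨-, h⟩ | ⟨h, -⟩
    · exact hmu h
    · exact hvu h
  · exact hne ((T.cw m).injective (k2.trans k4.symm))

/-- Take the good arcs at `v` and at `u` through the corners whose clockwise edge is the edge of the
label. Both run along the whole label and then coincide beyond it on either side. -/
lemma exists_good_pair [Finite V] (h : τ ≤ τ') (hs : τ'.X ∩ τ.Y = {T.path v u}) :
    ∃ a b, τ.Good v a b ∧ τ.Good u b a ∧ u ∈ T.path v b := by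
  have hs' : τ'.X ∩ τ.Y = {T.path u v} := by rw [hs, T.path_comm]
  have hseg := seg_X (label_mem hs).1
  have hvu := hseg.ne
  obtain ⟨e, he, hce⟩ := exists_cw_eq (nx_adj hvu : T.G.Adj v (T.nx v u))
  obtain ⟨f, hf, hcf⟩ := exists_cw_eq (nx_adj hvu.symm : T.G.Adj u (T.nx u v))
  obtain ⟨a, b, h1, h2, hg⟩ := exists_good (τ := τ) (hseg.not_leaf (T.left_mem _ _)) he
  obtain ⟨b₂, a₂, h3, h4, hg'⟩ := exists_good (τ := τ) (hseg.not_leaf (T.right_mem _ _)) hf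
  rw [hce] at h2
  rw [hcf] at h4
  obtain ⟨k1, k2⟩ := hg.ray_b.mem_of_label hg.leaf_b h2 hs
  obtain ⟨k3, k4⟩ := hg'.ray_b.mem_of_label hg'.leaf_b h4 hs'
  have e1 : b = b₂ := ray_end_eq hg.ray_b hg'.ray_a hg.leaf_b hg'.leaf_a k1
    ((T.cw u).injective (by rw [k2, h3, hcf])) h hs
  have e2 : a₂ = a := ray_end_eq hg'.ray_b hg.ray_a hg'.leaf_b hg.leaf_a k3
    ((T.cw v).injective (by rw [k4, h1, hce])) h hs'
  subst e1 e2
  exact ⟨_, _, hg, hg', k1⟩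

/-- If an element of `τ'.X` maps to `r`, the image lies in `τ'.X ∩ τ.Y` and so is the label. Then
`r` uses both marked corners of `[a, b]`, hence is equal to it. -/
lemma compat_of_ne [Finite V] (h : τ ≤ τ') (hs : τ'.X ∩ τ.Y = {T.path v u})
    (hg : τ.Good v a b) (hg' : τ.Good u b a) (hu : u ∈ T.path v b)
    {r : Set V} (hr : τ.Compat r) (hne : r ≠ T.path a b) : τ'.Compat r := by
  refine ⟨hr.1, fun t ht => hr.2.1 t (le_iff_Y.1 h ht), ?_⟩
  rintro x hx ⟨w, hw, h1, h2⟩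
  refine hne ?_
  obtain rfl : w = T.path v u := hs.subset ⟨TorsionPair.quo_mem hx hw h1, hr.sub_mem hw h2⟩
  have hvu := hw.ne
  obtain ⟨a', b', hab', rfl⟩ := hr.1.exists_ends
  have key : ∀ {a' b' : V}, T.ArcEnds a' b' → τ.Compat (T.path a' b') → v ∈ T.path a' u →
      u ∈ T.path a' b' → T.Sub (T.path v u) (T.path a' b') → T.path a' b' = T.path a b := by
    intro a' b' hab' hr h3 h4 h2
    have h5 := (sub_path_iff h3 h4 hvu).1 h2
    have h6 := h5.1 fun he => hw.not_leaf (T.left_mem _ _) (he ▸ hab'.leaf_a)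
    have h7 := h5.2 fun he => hw.not_leaf (T.right_mem _ _) (he ▸ hab'.leaf_b)
    have e1 := nx_eq_of_mem hu hvu.symm
    have e2 : T.nx v u = T.nx v b' := nx_eq_of_mem (btw_left h4 h3).2 hvu.symm
    have e3 := nx_eq_of_mem (mem_path_comm.1 (btw_right hg.mem hu).2) hvu
    have e4 : T.nx u v = T.nx u a' := nx_eq_of_mem (mem_path_comm.1 h3) hvu
    refine hg.eq_of_two hg' hr ((T.cw v).injective ?_) (e2.symm.trans e1) (e4.symm.trans e3)
      ((T.cw u).injective ?_)
    · rw [h6, hg.turn, e1]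
    · rw [h7, hg'.turn, e3]
  obtain ⟨c, d, h3, h4, h5, h6⟩ := path_order (h2.1 (T.left_mem v u)) (h2.1 (T.right_mem v u))
  rcases h6 with ⟨rfl, rfl⟩ | ⟨rfl, rfl⟩
  · exact key hab' hr h3 h4 h2
  · have h7 := btw_left h4 h3
    rw [T.path_comm a' b'] at hr h2 ⊢
    exact key hab'.symm hr (mem_path_comm.1 h7.2) (mem_path_comm.1 h7.1) h2

/-- The removed arc is found in `τ` and, by reflection, the new arc in `τ'`; all others are common
to the two facets. -/
lemma exists_exchange [Finite V] (h : τ ≤ τ') (hs : τ'.X ∩ τ.Y = {T.path v u}) :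
    ∃ a b a' b', Exchange τ τ' v u a b a' b' := by
  obtain ⟨a, b, g1, g2, g3⟩ := exists_good_pair h hs
  have hs' : τ.mirror.X ∩ τ'.mirror.Y = {T.path v u} := by
    rw [← hs, Set.inter_comm]; rfl
  obtain ⟨b', a', k1, k2, k3⟩ := exists_good_pair (mirror_le.2 h) hs'
  have k1' := k1.mirror
  have k2' := k2.mirror
  change τ'.Good v a' b' at k1'
  change τ'.Good u b' a' at k2'
  have hseg := seg_X (label_mem hs).1
  have hsub := g1.sub g2 g3
  have hquo := k1'.quo k2' k3
  have hq : T.path a' b' ∈ τ'.facetSet := ⟨k1'.compat, not_boundary_of_quo k1'.isArc hseg hquo⟩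
  have hq' : T.path a' b' ∉ τ.facetSet := fun hq =>
    hq.1.2.1 _ (label_mem hs).2 ⟨_, hseg, hquo, .refl _⟩
  have hp' : T.path a b ∉ τ'.facetSet := fun hq =>
    hq.1.2.2 _ (label_mem hs).1 ⟨_, hseg, .refl _, hsub⟩
  refine ⟨a, b, a', b', g1, g2, g3, k1', k2', k3, hq', Set.Subset.antisymm ?_ ?_⟩
  · intro r hr
    by_cases he : r = T.path a' b'
    · exact .inl he
    · exact .inr ⟨⟨mirror_compat.1 (compat_of_ne (mirror_le.2 h) hs' k1 k2 k3
        (mirror_compat.2 hr.1) (by rwa [mirror_path, T.path_comm])), hr.2⟩,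
        fun he => hp' (he ▸ hr)⟩
  · exact Set.insert_subset hq fun r hr => ⟨compat_of_ne h hs g1 g2 g3 hr.1.1 hr.2, hr.1.2⟩

lemma exists_exchange_of_covBy [Finite V] (h : τ ⋖ τ') :
    ∃ v u a b a' b', Exchange τ τ' v u a b a' b' := by
  obtain ⟨s, hs⟩ := exists_label h
  obtain ⟨v, u, -, rfl⟩ := exists_isSegment_ends (seg_X (label_mem hs).1)
  obtain ⟨a, b, a', b', h'⟩ := exists_exchange h.le hs
  exact ⟨v, u, a, b, a', b', h'⟩

/-! ### Exchanges are covering relations -/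

namespace Exchange

lemma inter_subset [Finite V] (h : Exchange τ τ' v u a b a' b') :
    T.path a b ∩ T.path a' b' ⊆ T.path v u := by
  have key : ∀ {τ τ' : T.TorsionPair} {v u a b a' b' : V}, τ.Good v a b → τ'.Good v a' b' →
      T.nx v a' = T.nx v b → ∀ x ∈ T.path a v, x ∈ T.path a' b' → x = v := by
    intro τ τ' v u a b a' b' g g' hnx x hx hx'
    by_contra hne
    have e1 := nx_eq_of_mem (mem_path_comm.1 hx) hne
    rcases T.mem_path_split g'.mem hx' with h1 | h1
    · have e2 := nx_eq_of_mem (mem_path_comm.1 h1) hne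
      exact nx_ne g.mem g.ne_a (e1.symm.trans (e2.trans hnx))
    · have e2 := nx_eq_of_mem h1 hne
      refine cw_cw_ne g.not_leaf (nx_adj g.ne_a) ?_
      rw [g.turn, ← hnx, g'.turn, ← e2, e1]
  rintro x ⟨hx, hx'⟩
  have hu := btw_right h.good_v.mem h.mem
  rcases T.mem_path_split h.good_v.mem hx with h1 | h1
  · rw [key (u := u) h.good_v h.good_v' h.nx_v x h1 hx']
    exact T.left_mem _ _
  rcases T.mem_path_split h.mem h1 with h2 | h2
  · exact h2
  · rw [key (u := u) h.good_u h.good_u' h.nx_u x (mem_path_comm.1 h2) (mem_path_comm.1 hx')]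
    exact T.right_mem _ _

/-- The image would lie inside `[v, u]`, which is a sub of the old arc and a quotient of the new
one; so it would be all of `[v, u]`, and then all of the old arc, which has leaves. -/
lemma not_hom [Finite V] (h : Exchange τ τ' v u a b a' b') :
    ¬ T.Hom (T.path a b) (T.path a' b') := by
  rintro ⟨w, hw, h1, h2⟩
  have h3 : w ⊆ T.path v u := fun x hx => h.inter_subset ⟨h1.1 hx, h2.1 hx⟩
  have hsub := h.good_v.sub h.good_u h.mem
  have hquo := h.good_v'.quo h.good_u' h.mem'
  obtain rfl := quo_sub_eq hw (h1.restrict hsub.1 h3) (h2.restrict hquo.1 h3)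
  have h4 := quo_sub_eq hw h1 hsub
  exact hw.not_leaf (h4 ▸ T.left_mem a b) h.good_v.leaf_a

/-- From a segment in `τ.X ∩ τ'.Y`, an arc of `τ` mapping to it must be the removed one, and an arc
of `τ'` receiving a map from the image must be the new one. The composite contradicts `not_hom`. -/
lemma le [Finite V] (h : Exchange τ τ' v u a b a' b') : τ ≤ τ' := by
  by_contra hcon
  obtain ⟨w, h1, h2⟩ := exists_inter hcon
  obtain ⟨p, hp, hh⟩ := exists_compat_hom h1
  obtain ⟨x, hx, h3, h4⟩ := id hh
  have hpF : p ∈ τ.facetSet := ⟨hp, not_boundary_of_quo hp.1 hx h3⟩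
  obtain rfl : p = T.path a b := by
    by_contra hne
    have : p ∈ τ'.facetSet := h.facetSet_eq ▸ .inr ⟨hpF, hne⟩
    exact this.1.2.1 w h2 hh
  have h5 := TorsionPair.sub_mem h2 hx h4
  have h6 := hp.quo_mem hx h3
  obtain ⟨q, hq, hh'⟩ := exists_hom_compat h5
  obtain ⟨y, hy, -, h7⟩ := id hh'
  have hqF : q ∈ τ'.facetSet := ⟨hq, not_boundary_of_sub hq.1 hy h7⟩
  rw [h.facetSet_eq] at hqF
  rcases hqF with rfl | hqF
  · exact h.not_hom (hh'.of_quo h3)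
  · exact hqF.1.1.2.2 x h6 hh'

/-- The marked corners of the shared arc are determined by the middle torsion pair, but the first
exchange puts `u` on one side of `v` along this arc and the second one puts it on the other side. -/
lemma not_consecutive [Finite V] {τ₁ τ₂ τ₃ : T.TorsionPair} {v₁ u₁ a₁ b₁ c₁ d₁ v₂ u₂ a₂ b₂ c₂ d₂ : V}
    (h : Exchange τ₁ τ₂ v₁ u₁ a₁ b₁ c₁ d₁) (h' : Exchange τ₂ τ₃ v₂ u₂ a₂ b₂ c₂ d₂)
    (he : T.path c₁ d₁ = T.path a₂ b₂) : False := by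
  rcases path_endpoints he with ⟨rfl, rfl⟩ | ⟨rfl, rfl⟩
  · obtain rfl := h.good_v'.unique h'.good_v
    obtain rfl := h.good_u'.unique h'.good_u
    exact h.ne (btw_inter h'.good_v.mem (mem_path_comm.1 h.mem') h'.mem)
  · obtain rfl := h.good_v'.unique h'.good_u
    obtain rfl := h.good_u'.unique h'.good_v
    exact h.ne (btw_antisymm (mem_path_comm.1 h'.mem) (mem_path_comm.1 h.mem')).symm

/-- All arcs common to `τ` and `τ'` persist throughout the interval. So the first step of a longer
chain removes `[a, b]`, and the second would have to remove the arc just created. -/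
lemma covBy [Finite V] (h : Exchange τ τ' v u a b a' b') : τ ⋖ τ' := by
  have hlt : τ < τ' := lt_of_le_not_ge h.le fun h' => disj (h' h.mem_X) h.mem_Y
  have hmid : ∀ {r σ}, r ∈ τ.facetSet → r ≠ T.path a b → τ ≤ σ → σ ≤ τ' → r ∈ σ.facetSet := by
    intro r σ hr hne h1 h2
    have hr' : r ∈ τ'.facetSet := h.facetSet_eq ▸ .inr ⟨hr, hne⟩
    exact ⟨⟨hr.1.1, fun t ht => hr.1.2.1 t (le_iff_Y.1 h1 ht),
      fun t ht => hr'.1.2.2 t (h2 ht)⟩, hr.2⟩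
  obtain ⟨σ, h1, h2⟩ := exists_covBy_le_of_lt hlt
  rcases h2.eq_or_lt with rfl | h3
  · exact h1
  exfalso
  obtain ⟨ρ, h4, h5⟩ := exists_covBy_le_of_lt h3
  obtain ⟨v₁, u₁, a₁, b₁, c₁, d₁, e₁⟩ := exists_exchange_of_covBy h1
  obtain ⟨v₂, u₂, a₂, b₂, c₂, d₂, e₂⟩ := exists_exchange_of_covBy h4
  refine e₁.not_consecutive e₂ ?_
  have h6 : T.path a₁ b₁ = T.path a b := by
    by_contra hne
    exact e₁.notMem' (hmid e₁.mem_facetSet hne h1.le h2)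
  have h7 := e₂.mem_facetSet
  rw [e₁.facetSet_eq] at h7
  rcases h7 with h7 | h7
  · exact h7.symm
  · refine (e₂.notMem' (hmid h7.1 ?_ (h1.le.trans h4.le) h5)).elim
    exact fun he => h7.2 (he.trans h6.symm)

lemma label [Finite V] (h : Exchange τ τ' v u a b a' b') : τ'.X ∩ τ.Y = {T.path v u} := by
  obtain ⟨s, hs⟩ := exists_label h.covBy
  rw [hs, hs.subset ⟨h.mem_X, h.mem_Y⟩]

end Exchange

/-- The labelled edges of the oriented flip graph. -/
lemma flip_iff [Finite V] : τ.toFacet.Flip s τ'.toFacet ↔ τ ⋖ τ' ∧ τ'.X ∩ τ.Y = {s} := by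
  constructor
  · intro h
    obtain ⟨v, u, a, b, a', b', rfl, h'⟩ := exists_exchange_of_flip h
    exact ⟨h'.covBy, h'.label⟩
  · rintro ⟨h, hs⟩
    obtain ⟨v, u, -, rfl⟩ := exists_isSegment_ends (seg_X (label_mem hs).1)
    obtain ⟨a, b, a', b', h'⟩ := exists_exchange h.le hs
    exact h'.flip

lemma toFacet_le_iff [Finite V] : τ.toFacet ≤ τ'.toFacet ↔ τ ≤ τ' := by
  constructor
  · intro h
    change Relation.ReflTransGen (fun F G : T.Facet => ∃ s, F.Flip s G) _ _ at h
    generalize hF : τ.toFacet = F at h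
    generalize hG : τ'.toFacet = G at h
    induction h generalizing τ' with
    | refl => exact (toFacet_injective (hF.trans hG.symm)).le
    | @tail G' _ _ h2 ih =>
      obtain ⟨σ, rfl⟩ := toFacet_surjective G'
      obtain ⟨s, h2⟩ := h2
      subst hG
      exact (ih rfl).trans (flip_iff.1 h2).1.le
  · intro h
    induction τ using WellFoundedGT.induction with
    | _ τ ih =>
    rcases h.eq_or_lt with rfl | h1
    · exact le_rfl
    · obtain ⟨σ, h2, h3⟩ := exists_covBy_le_of_lt h1
      obtain ⟨s, hs⟩ := exists_label h2
      exact Relation.ReflTransGen.head ⟨s, flip_iff.2 ⟨h2, hs⟩⟩ (ih σ h2.lt h3)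

end TorsionPair

/-! ### Order and labels carried over from torsion pairs to facets -/

namespace Facet

lemma exists_toFacet [Finite V] (F : T.Facet) : ∃ τ : T.TorsionPair, τ.toFacet = F :=
  TorsionPair.toFacet_surjective F

end Facet

namespace TorsionPair

variable {τ τ' : T.TorsionPair}

/-- The oriented flip graph is isomorphic to the lattice of torsion pairs. -/
noncomputable def facetIso (T : PlaneTree V) [Finite V] : T.TorsionPair ≃o T.Facet where
  toEquiv := Equiv.ofBijective toFacet ⟨toFacet_injective, toFacet_surjective⟩
  map_rel_iff' := toFacet_le_iff

lemma toFacet_covBy_iff [Finite V] : τ.toFacet ⋖ τ'.toFacet ↔ τ ⋖ τ' :=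
  apply_covBy_apply_iff (facetIso T)

lemma lowerLabels_toFacet [Finite V] : τ.toFacet.lowerLabels = τ.lowerLab := by
  ext s
  constructor
  · rintro ⟨F, h⟩
    obtain ⟨σ, rfl⟩ := F.exists_toFacet
    exact ⟨σ, flip_iff.1 h⟩
  · rintro ⟨σ, h⟩
    exact ⟨_, flip_iff.2 h⟩

lemma upperLabels_toFacet [Finite V] : τ.toFacet.upperLabels = τ.upperLab := by
  ext s
  constructor
  · rintro ⟨F, h⟩
    obtain ⟨σ, rfl⟩ := F.exists_toFacet
    exact ⟨σ, flip_iff.1 h⟩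
  · rintro ⟨σ, h⟩
    exact ⟨_, flip_iff.2 h⟩

lemma isGLB_toFacet_iff [Finite V] {m : T.TorsionPair} {S : Set T.TorsionPair} :
    IsGLB (toFacet '' S) m.toFacet ↔ IsGLB S m := (facetIso T).isGLB_image'

lemma isLUB_toFacet_iff [Finite V] {m : T.TorsionPair} {S : Set T.TorsionPair} :
    IsLUB (toFacet '' S) m.toFacet ↔ IsLUB S m := (facetIso T).isLUB_image'

lemma shardSet_toFacet [Finite V] : τ.toFacet.shardSet = {s | ∃ m : T.TorsionPair,
    IsGLB {σ | σ ⋖ τ} m ∧ ∃ w z, m ≤ w ∧ w ⋖ z ∧ z ≤ τ ∧ z.X ∩ w.Y = {s}} := by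
  have himg : {F | F ⋖ τ.toFacet} = toFacet '' {σ | σ ⋖ τ} := by
    ext F
    obtain ⟨σ, rfl⟩ := F.exists_toFacet
    exact ⟨fun h => ⟨σ, toFacet_covBy_iff.1 h, rfl⟩, fun ⟨σ', h, he⟩ =>
      he ▸ toFacet_covBy_iff.2 h⟩
  ext s
  constructor
  · rintro ⟨m, w, z, h1, h2, h3, h4, h5⟩
    obtain ⟨m, rfl⟩ := m.exists_toFacet
    obtain ⟨w, rfl⟩ := w.exists_toFacet
    obtain ⟨z, rfl⟩ := z.exists_toFacet
    rw [himg, isGLB_toFacet_iff] at h1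
    exact ⟨m, h1, w, z, toFacet_le_iff.1 h2, (flip_iff.1 h5).1, toFacet_le_iff.1 h4,
      (flip_iff.1 h5).2⟩
  · rintro ⟨m, h1, w, z, h2, h3, h4, h5⟩
    refine ⟨m.toFacet, w.toFacet, z.toFacet, ?_, toFacet_le_iff.2 h2, toFacet_covBy_iff.2 h3,
      toFacet_le_iff.2 h4, flip_iff.2 ⟨h3, h5⟩⟩
    rwa [himg, isGLB_toFacet_iff]

end TorsionPair

/-! ### Noncrossing segments -/

section Red

variable {s t : Set V} {d e : V → ℝ} {x y z m m' : V}

lemma IsSegment.nbr_eq (hs : T.IsSegment s) (hy : y ∈ s) (hx : x ∈ s) (hz : z ∈ s) (hm : m ∈ s)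
    (hyx : T.G.Adj y x) (hyz : T.G.Adj y z) (hym : T.G.Adj y m) (hxz : x ≠ z) :
    m = x ∨ m = z := by
  obtain ⟨a, b, -, rfl⟩ := exists_isSegment_ends hs
  rcases nbr_in_path hy hx hyx with ⟨-, h1⟩ | ⟨-, h1⟩ <;>
    rcases nbr_in_path hy hz hyz with ⟨-, h2⟩ | ⟨-, h2⟩ <;>
    rcases nbr_in_path hy hm hym with ⟨-, h3⟩ | ⟨-, h3⟩ <;> simp_all

lemma not_isEndpoint (hy : y ∈ s) (hx : x ∈ s) (hz : z ∈ s) (hyx : T.G.Adj y x)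
    (hyz : T.G.Adj y z) (hxz : x ≠ z) : ¬ T.IsEndpoint s y := by
  rintro ⟨c, rfl⟩
  rcases nbr_in_path hy hx hyx with ⟨h, -⟩ | ⟨-, h1⟩
  · exact h rfl
  rcases nbr_in_path hy hz hyz with ⟨h, -⟩ | ⟨-, h2⟩
  · exact h rfl
  exact hxz (h1.trans h2.symm)

lemma IsSegment.exists_other (hs : T.IsSegment s) (hy : y ∈ s) (h : ¬ T.IsEndpoint s y) (x : V) :
    ∃ z ∈ s, T.G.Adj y z ∧ z ≠ x := by
  obtain ⟨a, b, -, rfl⟩ := exists_isSegment_ends hs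
  have ha : y ≠ a := fun he => h ⟨b, by rw [he]⟩
  have hb : y ≠ b := fun he => h ⟨a, by rw [he, T.path_comm]⟩
  by_cases hx : T.nx y a = x
  · refine ⟨_, nx_mem_right hy, nx_adj hb, ?_⟩
    rw [← hx]
    exact (nx_ne hy ha).symm
  · exact ⟨_, nx_mem_left hy, nx_adj ha, hx⟩

lemma IsRedCurve.one_le (hd : T.IsRedCurve s d) (hy : y ∈ s) : 1 ≤ d y := by
  by_cases h : T.IsEndpoint s y
  · exact ((hd y hy).1 h).ge
  · exact ((hd y hy).2 h).le

/-- The value `1` is the offset of a curve ending at `y`. A curve passing `y` on the right has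
larger offset, one passing on the left has negative offset; the next estimates record this. -/
lemma offset_le_one (hd : T.IsRedCurve s d) (hy : y ∈ s) (hR : T.cw y x ∉ s) :
    T.offset s d y x ≤ 1 := by
  have h1 := hd.one_le hy
  rw [offset]
  split_ifs with h
  · exact ((hd y hy).1 (h.resolve_right hR)).le
  · linarith

lemma one_le_offset (hs : T.IsSegment s) (hd : T.IsRedCurve s d) (hy : y ∈ s) (hx : x ∈ s)
    (hyx : T.G.Adj y x) (hL : ∀ z ∈ s, T.cw y z ≠ x) : 1 ≤ T.offset s d y x := by
  have h1 := hd.one_le hy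
  rw [offset, if_pos]
  · exact h1
  by_cases h : T.IsEndpoint s y
  · exact .inl h
  obtain ⟨z, hz, hyz, hzx⟩ := hs.exists_other hy h x
  rcases hs.sharp y hy x hx z hz hyx hyz hzx.symm with h | h
  · exact .inr (h ▸ hz)
  · exact absurd h (hL z hz)

lemma one_lt_offset [Finite V] (hs : T.IsSegment s) (hd : T.IsRedCurve s d) (hy : y ∈ s)
    (hx : x ∈ s) (hyx : T.G.Adj y x) (hR : T.cw y x ∈ s) : 1 < T.offset s d y x := by
  rw [offset, if_pos (.inr hR)]
  exact (hd y hy).2 (not_isEndpoint hy hx hR hyx (cw_adj hyx) (cw_ne (hs.not_leaf hy) hyx).symm)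

lemma adj_of_cw_eq (hyx : T.G.Adj y x) (h : T.cw y z = x) : T.G.Adj y z := by
  obtain ⟨z', hz', h'⟩ := exists_cw_eq hyx
  rwa [(T.cw y).injective (h.trans h'.symm)]

lemma cw_notMem [Finite V] (hs : T.IsSegment s) (hy : y ∈ s) (hx : x ∈ s)
    (hz : z ∈ s) (hyx : T.G.Adj y x) (h : T.cw y z = x) : T.cw y x ∉ s := by
  intro hR
  have hyz := adj_of_cw_eq hyx h
  have hl := hs.not_leaf hy
  have hzx : z ≠ x := fun he => cw_ne hl hyz (h.trans he.symm)
  rcases hs.nbr_eq hy hx hz hR hyx hyz (cw_adj hyx) hzx.symm with h1 | h1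
  · exact cw_ne hl hyx h1
  · exact turn_not_both hyx hyz hzx.symm h1 h

lemma offset_lt_one [Finite V] (hs : T.IsSegment s) (hd : T.IsRedCurve s d) (hy : y ∈ s)
    (hx : x ∈ s) (hz : z ∈ s) (hyx : T.G.Adj y x) (hL : T.cw y z = x) :
    T.offset s d y x < 1 := by
  have hyz := adj_of_cw_eq hyx hL
  have hzx : z ≠ x := fun he => cw_ne (hs.not_leaf hy) hyz (hL.trans he.symm)
  rw [offset, if_neg]
  · linarith [hd.one_le hy]
  · rintro (h | h)
    · exact not_isEndpoint hy hx hz hyx hyz hzx.symm h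
    · exact cw_notMem hs hy hx hz hyx hL h

/-- The right of the edge to `x` and the right of the edge to `z` are opposite sides of the path at
`y`, so the comparison of two curves reverses when passing a common inner vertex. -/
lemma offset_neg [Finite V] (hs : T.IsSegment s) (d : V → ℝ) (hy : y ∈ s) (hx : x ∈ s)
    (hz : z ∈ s) (hyx : T.G.Adj y x) (hyz : T.G.Adj y z) (hxz : x ≠ z) :
    T.offset s d y x = - T.offset s d y z := by
  have he := not_isEndpoint hy hx hz hyx hyz hxz
  rcases hs.sharp y hy x hx z hz hyx hyz hxz with h | h
  · rw [offset, offset, if_pos (.inr (h ▸ hz)), if_neg (not_or.2 ⟨he, cw_notMem hs hy hz hx hyz h⟩),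
      neg_neg]
  · rw [offset, offset, if_neg (not_or.2 ⟨he, cw_notMem hs hy hx hz hyx h⟩),
      if_pos (.inr (h ▸ hx))]

lemma path_induction {u v : V} {P : V → Prop} (h0 : P u)
    (hstep : ∀ y ∈ T.path u v, y ≠ v → P y → P (T.nx y v)) : ∀ y ∈ T.path u v, P y := by
  intro y hy
  obtain ⟨n, hn⟩ : ∃ n, T.G.dist u y = n := ⟨_, rfl⟩
  induction n generalizing y with
  | zero => rwa [← T.dist_eq_zero.1 hn]
  | succ n ih =>
    have hyu : y ≠ u := by
      rintro rfl
      rw [SimpleGraph.dist_self] at hn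
      omega
    have h1 : T.nx y u ∈ T.path y u := nx_mem y u
    have h2 := btw_left hy (mem_path_comm.1 h1)
    have hadj : T.G.Adj y (T.nx y u) := nx_adj hyu
    have h3 := T.mem_path_iff.1 (mem_path_comm.1 h1)
    rw [T.dist_adj hadj.symm] at h3
    have h4 : T.nx y u ≠ v := by
      intro he
      have := T.mem_path_iff.1 hy
      rw [he] at h3
      omega
    have h5 := hstep _ h2.1 h4 (ih _ h2.1 (by omega))
    rwa [← nx_eq_of_mem h2.2 hadj.ne, nx_of_adj hadj.symm] at h5

lemma RedNoncrossing.symm (h : T.RedNoncrossing s t) : T.RedNoncrossing t s := by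
  obtain ⟨d, e, hd, he, h⟩ := h
  exact ⟨e, d, he, hd, fun y x h1 h2 h3 h4 h5 => (h y x h3 h4 h1 h2 h5).symm⟩

lemma Quo.cw_ne_nx [Finite V] (hmm : m ≠ m') (hl : ¬ T.IsLeaf m) (h : T.Quo (T.path m m') s) :
    ∀ z ∈ s, T.cw m z ≠ T.nx m m' := by
  intro z hz he
  have hadj : T.G.Adj m (T.nx m m') := nx_adj hmm
  have hmz := adj_of_cw_eq hadj he
  have hne : T.nx m m' ≠ z := fun h => cw_ne hl hmz (he.trans h)
  have hzw : z ∉ T.path m m' := by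
    intro hzw
    rcases nbr_in_path (T.left_mem m m') hzw hmz with ⟨h, -⟩ | ⟨-, h⟩
    · exact h rfl
    · exact hne h.symm
  exact turn_not_both hadj hmz hne (h.2 m (T.left_mem _ _) _ (nx_mem _ _) z hz hzw hadj hmz) he

lemma Sub.cw_nx_notMem [Finite V] (hmm : m ≠ m') (hl : ¬ T.IsLeaf m)
    (h : T.Sub (T.path m m') s) : T.cw m (T.nx m m') ∉ s := by
  intro hz
  have hadj : T.G.Adj m (T.nx m m') := nx_adj hmm
  exact Quo.cw_ne_nx (T := T.mirror) hmm hl (mirror_quo.2 h) _ hz (mirror_cw.2 rfl)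

/-- At `m` the curve of `s` cannot be to the left of the curve of `t`. Noncrossing carries this
order strictly along the common edges up to `m'`, where `Quo` and `Sub` force the opposite order. -/
lemma RedNoncrossing.not_hom [Finite V] (hs : T.IsSegment s) (ht : T.IsSegment t)
    (h : T.RedNoncrossing s t) : ¬ T.Hom s t := by
  rintro ⟨w, hw, hq, hsub⟩
  obtain ⟨d, e, hd, he, hnc⟩ := h
  obtain ⟨m, m', hmm, rfl⟩ := exists_isSegment_ends hw
  have hl := hw.not_leaf (T.left_mem m m')
  have hl' := hw.not_leaf (T.right_mem m m')
  have ends : ∀ {m m' : V}, m ≠ m' → ¬ T.IsLeaf m → T.Quo (T.path m m') s →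
      T.Sub (T.path m m') t → T.offset t e m (T.nx m m') ≤ T.offset s d m (T.nx m m') := by
    intro m m' hmm hl hq hsub
    exact (offset_le_one he (hsub.1 (T.left_mem _ _)) (hsub.cw_nx_notMem hmm hl)).trans
      (one_le_offset hs hd (hq.1 (T.left_mem _ _)) (hq.1 (nx_mem _ _)) (nx_adj hmm)
        (hq.cw_ne_nx hmm hl))
  have key := path_induction (T := T) (u := m) (v := m')
    (P := fun y => (y ≠ m' → T.offset t e y (T.nx y m') ≤ T.offset s d y (T.nx y m')) ∧
      (y ≠ m → T.offset s d y (T.nx y m) < T.offset t e y (T.nx y m)))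
    ⟨fun _ => ends hmm hl hq hsub, fun h => absurd rfl h⟩ ?_ m' (T.right_mem _ _)
  · have h1 := key.2 hmm.symm
    rw [T.path_comm] at hq hsub
    exact h1.not_ge (ends hmm.symm hl' hq hsub)
  · rintro y hy hym' ⟨h1, -⟩
    have hx := nx_mem_right hy
    have hadj : T.G.Adj y (T.nx y m') := nx_adj hym'
    set x := T.nx y m' with hxdef
    rcases hnc y x (hq.1 hy) (hq.1 hx) (hsub.1 hy) (hsub.1 hx) hadj with h2 | h2
    · exact absurd (h1 hym') h2.1.not_ge
    have hyx : y ∈ T.path m x := (btw_right hy (nx_mem y m')).2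
    have e1 : T.nx x m = y := by
      rw [← nx_eq_of_mem (mem_path_comm.1 hyx) hadj.ne, nx_of_adj hadj.symm]
    rw [e1]
    refine ⟨fun hxm' => ?_, fun _ => h2.2⟩
    have hadj' : T.G.Adj x (T.nx x m') := nx_adj hxm'
    have hx' := nx_mem_right hx
    have hne : y ≠ T.nx x m' := by
      rw [← e1]
      refine nx_ne hx ?_
      intro he
      rw [he] at hyx hadj
      exact hadj.ne (path_self_eq hyx)
    have h3 := offset_neg hs d (hq.1 hx) (hq.1 hy) (hq.1 hx') hadj.symm hadj' hne
    have h4 := offset_neg ht e (hsub.1 hx) (hsub.1 hy) (hsub.1 hx') hadj.symm hadj' hne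
    linarith [h2.2]

lemma quo_of_cw_ne (hs : T.IsSegment s) (hmm : m ≠ m') (hm : m ∈ s) (hm' : m' ∈ s)
    (h1 : ∀ z ∈ s, T.cw m z ≠ T.nx m m') (h2 : ∀ z ∈ s, T.cw m' z ≠ T.nx m' m) :
    T.Quo (T.path m m') s := by
  obtain ⟨a, b, -, rfl⟩ := exists_isSegment_ends hs
  have key : ∀ {m m' : V}, m ≠ m' → m ∈ T.path a m' → m' ∈ T.path a b →
      (∀ z ∈ T.path a b, T.cw m z ≠ T.nx m m') → (∀ z ∈ T.path a b, T.cw m' z ≠ T.nx m' m) →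
      T.Quo (T.path m m') (T.path a b) := by
    intro m m' hmm h3 h4 h1 h2
    have h5 := btw_left h4 h3
    rw [quo_path_iff h3 h4 hmm]
    constructor
    · intro hma
      have hmb : m ≠ b := by
        rintro rfl
        exact hmm (path_self_eq h5.2).symm
      rw [nx_eq_of_mem h5.2 hmm.symm] at h1 ⊢
      exact (sharp_path_iff.1 hs.sharp m h5.1 hma hmb).resolve_left
        (h1 _ (nx_mem_left h5.1))
    · intro hmb
      have hma : m' ≠ a := by
        rintro rfl
        exact hmm (path_self_eq h3)
      rw [nx_eq_of_mem (mem_path_comm.1 h3) hmm] at h2 ⊢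
      exact (sharp_path_iff.1 hs.sharp m' h4 hma hmb).resolve_right
        (h2 _ (nx_mem_right h4))
  rcases btw_total hm hm' with h | h
  · exact key hmm h hm' h1 h2
  · rw [T.path_comm]
    exact key hmm.symm h hm h2 h1

lemma sub_of_cw_notMem (hs : T.IsSegment s) (hmm : m ≠ m') (hm : m ∈ s) (hm' : m' ∈ s)
    (h1 : T.cw m (T.nx m m') ∉ s) (h2 : T.cw m' (T.nx m' m) ∉ s) :
    T.Sub (T.path m m') s := by
  refine mirror_quo.1 (quo_of_cw_ne (mirror_isSegment.2 hs) hmm hm hm' ?_ ?_)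
  · intro z hz he
    exact h1 (mirror_cw.1 he ▸ hz)
  · intro z hz he
    exact h2 (mirror_cw.1 he ▸ hz)

lemma redNoncrossing_of_inter [Finite V] (hs : T.IsSegment s) (ht : T.IsSegment t)
    (hst : s ∩ t = T.path m m') (hmm : m ≠ m')
    (h0 : (∃ z ∈ s, T.cw m z = T.nx m m') ∨ T.cw m (T.nx m m') ∈ t)
    (h1 : (∃ z ∈ t, T.cw m' z = T.nx m' m) ∨ T.cw m' (T.nx m' m) ∈ s) :
    T.RedNoncrossing s t := by
  classical
  -- The curve of `t` is placed to the right of that of `s`, going from `m` to `m'`: farther out (`2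
  -- > 3/2`) in the corners on the right, closer in (`5/4 < 3/2`) in the others.
  let d : V → ℝ := fun y => if T.IsEndpoint s y then 1 else 3 / 2
  let e : V → ℝ := fun y => if T.IsEndpoint t y then 1 else
    if T.cw y (T.nx y m') ∈ t then 2 else 5 / 4
  have hd : T.IsRedCurve s d := by
    intro y _
    refine ⟨fun h => if_pos h, fun h => ?_⟩
    simp only [d, if_neg h]
    norm_num
  have he : T.IsRedCurve t e := by
    intro y _
    refine ⟨fun h => if_pos h, fun h => ?_⟩
    simp only [e, if_neg h]
    split_ifs <;> norm_num
  have hws : T.path m m' ⊆ s := hst ▸ Set.inter_subset_left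
  have hwt : T.path m m' ⊆ t := hst ▸ Set.inter_subset_right
  have ends : ∀ {s t : Set V} {m m' : V} {d e : V → ℝ}, T.IsSegment s → T.IsSegment t →
      T.IsRedCurve s d → T.IsRedCurve t e → s ∩ t = T.path m m' → m ≠ m' →
      ((∃ z ∈ s, T.cw m z = T.nx m m') ∨ T.cw m (T.nx m m') ∈ t) →
      T.offset s d m (T.nx m m') < T.offset t e m (T.nx m m') := by
    intro s t m m' d e hs ht hd he hst hmm h0
    have hws : T.path m m' ⊆ s := hst ▸ Set.inter_subset_left
    have hwt : T.path m m' ⊆ t := hst ▸ Set.inter_subset_right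
    have hadj : T.G.Adj m (T.nx m m') := nx_adj hmm
    have hm := T.left_mem m m'
    have hn := nx_mem (T := T) m m'
    have hl := hs.not_leaf (hws hm)
    have huniq : ∀ z ∈ s, z ∈ t → T.G.Adj m z → z = T.nx m m' := by
      intro z h1 h2 h3
      rcases nbr_in_path hm (hst.subset ⟨h1, h2⟩) h3 with ⟨h, -⟩ | ⟨-, h⟩
      · exact absurd rfl h
      · exact h
    rcases h0 with ⟨z, hz, hc⟩ | h0
    · refine (offset_lt_one hs hd (hws hm) (hws hn) hz hadj hc).trans_le
        (one_le_offset ht he (hwt hm) (hwt hn) hadj ?_)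
      intro z' hz' hc'
      obtain rfl := (T.cw m).injective (hc'.trans hc.symm)
      have := adj_of_cw_eq hadj hc
      exact cw_ne hl this (hc.trans (huniq _ hz hz' this).symm)
    · refine (offset_le_one hd (hws hm) ?_).trans_lt
        (one_lt_offset ht he (hwt hm) (hwt hn) hadj h0)
      exact fun h => cw_ne hl hadj (huniq _ h h0 (cw_adj hadj))
  have inner : ∀ y ∈ T.path m m', y ≠ m → y ≠ m' →
      T.offset s d y (T.nx y m') < T.offset t e y (T.nx y m') := by
    intro y hy hym hym'
    have ha := nx_mem_left hy
    have hb := nx_mem_right hy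
    have hya : T.G.Adj y (T.nx y m) := nx_adj hym
    have hyb : T.G.Adj y (T.nx y m') := nx_adj hym'
    have hab := nx_ne hy hym
    have n1 := not_isEndpoint (hws hy) (hws ha) (hws hb) hya hyb hab
    have n2 := not_isEndpoint (hwt hy) (hwt ha) (hwt hb) hya hyb hab
    rcases hs.sharp y (hws hy) _ (hws ha) _ (hws hb) hya hyb hab with h | h
    · have h3 := cw_notMem hs (hws hy) (hws hb) (hws ha) hyb h
      have h4 := cw_notMem ht (hwt hy) (hwt hb) (hwt ha) hyb h
      simp only [offset, d, e, n1, n2, h3, h4, or_self, if_false]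
      norm_num
    · have h3 : T.cw y (T.nx y m') ∈ s := h ▸ hws ha
      have h4 : T.cw y (T.nx y m') ∈ t := h ▸ hwt ha
      simp only [offset, d, e, n1, n2, h3, h4, or_true, if_true, if_false]
      norm_num
  have fwd : ∀ y ∈ T.path m m', y ≠ m' →
      T.offset s d y (T.nx y m') < T.offset t e y (T.nx y m') := by
    intro y hy hym'
    by_cases hym : y = m
    · subst hym
      exact ends hs ht hd he hst hmm h0
    · exact inner y hy hym hym'
  have bwd : ∀ y ∈ T.path m m', y ≠ m →
      T.offset t e y (T.nx y m) < T.offset s d y (T.nx y m) := by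
    intro y hy hym
    by_cases hym' : y = m'
    · subst hym'
      exact ends ht hs he hd (by rw [Set.inter_comm, hst, T.path_comm]) hmm.symm h1
    · have h2 := inner y hy hym hym'
      have ha := nx_mem_left hy
      have hb := nx_mem_right hy
      rw [offset_neg hs d (hws hy) (hws ha) (hws hb) (nx_adj hym) (nx_adj hym') (nx_ne hy hym),
        offset_neg ht e (hwt hy) (hwt ha) (hwt hb) (nx_adj hym) (nx_adj hym') (nx_ne hy hym)]
      linarith
  have back : ∀ {m m' y : V}, y ∈ T.path m m' → y ≠ m' → T.nx (T.nx y m') m = y := by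
    intro m m' y hy hym'
    have hadj : T.G.Adj y (T.nx y m') := nx_adj hym'
    rw [← nx_eq_of_mem (mem_path_comm.1 (btw_right hy (nx_mem y m')).2) hadj.ne,
      nx_of_adj hadj.symm]
  refine ⟨d, e, hd, he, fun y x hys hxs hyt hxt hyx => ?_⟩
  have hy := hst.subset ⟨hys, hyt⟩
  have hx := hst.subset ⟨hxs, hxt⟩
  rcases nbr_in_path hy hx hyx with ⟨hne, rfl⟩ | ⟨hne, rfl⟩
  · right
    have hb := back (mem_path_comm.1 hy) hne
    have hxm' : T.nx y m ≠ m' := by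
      intro he
      rw [he, nx_self] at hb
      exact hyx.ne (hb.symm.trans he.symm)
    have := fwd _ hx hxm'
    rw [hb] at this
    exact ⟨bwd y hy hne, this⟩
  · left
    have hb := back hy hne
    have hxm' : T.nx y m' ≠ m := by
      intro he
      rw [he, nx_self] at hb
      exact hyx.ne (hb.symm.trans he.symm)
    have := bwd _ hx hxm'
    rw [hb] at this
    exact ⟨fwd y hy hne, this⟩

/-- Segments are noncrossing if and only if they are `Hom`-orthogonal. -/
lemma redNoncrossing_iff [Finite V] (hs : T.IsSegment s) (ht : T.IsSegment t) :
    T.RedNoncrossing s t ↔ ¬ T.Hom s t ∧ ¬ T.Hom t s := by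
  refine ⟨fun h => ⟨h.not_hom hs ht, h.symm.not_hom ht hs⟩, fun ⟨h1, h2⟩ => ?_⟩
  by_cases hcom : ∃ y x, y ∈ s ∧ x ∈ s ∧ y ∈ t ∧ x ∈ t ∧ T.G.Adj y x
  · obtain ⟨y, x, hys, hxs, hyt, hxt, hyx⟩ := hcom
    obtain ⟨m, m', hst⟩ : ∃ m m', s ∩ t = T.path m m' := by
      obtain ⟨a, b, -, rfl⟩ := exists_isSegment_ends hs
      obtain ⟨a', b', -, rfl⟩ := exists_isSegment_ends ht
      obtain ⟨m, m', -, -, h⟩ := exists_path_of_convex (T := T) Set.inter_subset_left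
        ⟨y, hys, hyt⟩ inter_convex
      exact ⟨m, m', h⟩
    have hmm : m ≠ m' := by
      rintro rfl
      exact hyx.ne ((path_self_eq (hst.subset ⟨hys, hyt⟩)).trans
        (path_self_eq (hst.subset ⟨hxs, hxt⟩)).symm)
    have hms := hst.superset (T.left_mem m m')
    have hms' := hst.superset (T.right_mem m m')
    have hl := hs.not_leaf hms.1
    have hl' := hs.not_leaf hms'.1
    have hw := hs.sub hms.1 hms'.1 hmm
    -- Unless `t` can be put strictly to the right of `s` at one end of the intersection, looking
    -- along it from that end, the intersection is a quotient of `s` and a sub of `t`.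
    have key : ∀ {s t : Set V}, T.IsSegment s → T.IsSegment t → m ∈ s ∩ t → m' ∈ s ∩ t →
        ¬ T.Hom s t → ((∃ z ∈ s, T.cw m z = T.nx m m') ∨ T.cw m (T.nx m m') ∈ t) ∨
          ((∃ z ∈ s, T.cw m' z = T.nx m' m) ∨ T.cw m' (T.nx m' m) ∈ t) := by
      intro s t hs ht hm hm' hh
      by_contra hcon
      push Not at hcon
      obtain ⟨⟨k1, k2⟩, k3, k4⟩ := hcon
      exact hh ⟨_, hw, quo_of_cw_ne hs hmm hm.1 hm'.1 k1 k3,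
        sub_of_cw_notMem ht hmm hm.2 hm'.2 k2 k4⟩
    -- The two segments cannot each be on the right of the other at the same end, so the conditions
    -- for the two missing maps hold at different ends and describe one consistent order of the
    -- curves.
    have excl : ∀ {m m' : V}, m ≠ m' → s ∩ t = T.path m m' →
        ((∃ z ∈ s, T.cw m z = T.nx m m') ∨ T.cw m (T.nx m m') ∈ t) →
        ((∃ z ∈ t, T.cw m z = T.nx m m') ∨ T.cw m (T.nx m m') ∈ s) → False := by
      intro m m' hmm hst k1 k2
      have hm := hst.superset (T.left_mem m m')
      have hn := hst.superset (nx_mem m m')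
      have hadj : T.G.Adj m (T.nx m m') := nx_adj hmm
      have hl := hs.not_leaf hm.1
      have huniq : ∀ z ∈ s, z ∈ t → T.G.Adj m z → z = T.nx m m' := by
        intro z h1 h2 h3
        rcases nbr_in_path (T.left_mem m m') (hst.subset ⟨h1, h2⟩) h3 with ⟨h, -⟩ | ⟨-, h⟩
        · exact absurd rfl h
        · exact h
      rcases k1 with ⟨z, hz, hc⟩ | k1 <;> rcases k2 with ⟨z', hz', hc'⟩ | k2
      · obtain rfl := (T.cw m).injective (hc'.trans hc.symm)
        have := adj_of_cw_eq hadj hc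
        exact cw_ne hl this (hc.trans (huniq _ hz hz' this).symm)
      · exact cw_notMem hs hm.1 hn.1 hz hadj hc k2
      · exact cw_notMem ht hm.2 hn.2 hz' hadj hc' k1
      · exact cw_ne hl hadj (huniq _ k2 k1 (cw_adj hadj))
    have hst' : s ∩ t = T.path m' m := by rw [hst, T.path_comm]
    rcases key hs ht hms hms' h1 with k1 | k1 <;>
      rcases key ht hs hms.symm hms'.symm h2 with k2 | k2
    · exact (excl hmm hst k1 k2).elim
    · exact redNoncrossing_of_inter hs ht hst hmm k1 k2
    · exact (redNoncrossing_of_inter ht hs (by rw [Set.inter_comm, hst]) hmm k2 k1).symm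
    · exact (excl hmm.symm hst' k1 k2).elim
  · classical
    refine ⟨fun y => if T.IsEndpoint s y then 1 else 2, fun y => if T.IsEndpoint t y then 1 else 2,
      ?_, ?_, fun y x k1 k2 k3 k4 k5 => (hcom ⟨y, x, k1, k2, k3, k4, k5⟩).elim⟩ <;>
    · intro y _
      refine ⟨fun h => if_pos h, fun h => ?_⟩
      simp only [if_neg h]
      norm_num

end Red

/-! ### Noncrossing tree partitions and semibricks -/

section Partitions

variable {D : Set (Set V)} {P : Setoid T.Interior} {s : Set V}

variable (T) in
/-- The partition of the interior vertices into the components of the graph with edges `D`. -/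
def components (D : Set (Set V)) : Setoid T.Interior :=
  Relation.EqvGen.setoid (fun u v => T.path u.1 v.1 ∈ D)

/-- A walk in the graph with edges `D` becomes a concatenation by cancelling its backtracking, see
`IsSemibrick.isConcat_cons`. -/
lemma IsSemibrick.isConcat_of_rel (hD : T.IsSemibrick D) {u v : T.Interior}
    (h : T.components D u v) : T.IsConcat D u.1 v.1 := by
  have h1 : Relation.ReflTransGen (fun u v : T.Interior => T.path u.1 v.1 ∈ D) u v := by
    change Relation.EqvGen _ u v at h
    induction h with
    | rel _ _ h => exact .single h
    | refl => exact .refl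
    | symm _ _ _ ih =>
      have : Std.Symm (fun u v : T.Interior => T.path u.1 v.1 ∈ D) :=
        ⟨fun _ _ h => by rwa [T.path_comm]⟩
      exact symm ih
    | trans _ _ _ _ _ ih ih' => exact ih.trans ih'
  clear h
  induction h1 using Relation.ReflTransGen.head_induction_on with
  | refl => exact .refl _
  | head h1 _ ih => exact hD.isConcat_cons h1 ih

lemma IsConcat.rel (hD : T.IsSemibrick D) {u v : V} (h : T.IsConcat D u v) (hu : ¬ T.IsLeaf u)
    (hv : ¬ T.IsLeaf v) : T.components D ⟨u, hu⟩ ⟨v, hv⟩ := by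
  induction h with
  | refl => exact Setoid.refl' _ _
  | cons h _ _ ih =>
    have hx := (hD.1 _ h).not_leaf (T.right_mem _ _)
    exact Setoid.trans' _ (.rel _ ⟨_, hx⟩ h) (ih hx hv)

/-- The concatenation from `u` to `x` begins with an element of `D` starting along the same edge as
`[u, v]`, hence with `[u, v]` itself. So elements of `D` contain no further vertex of their block.
-/
lemma IsSemibrick.eq_or_eq_of_rel (hD : T.IsSemibrick D) {u v x : T.Interior}
    (h : T.path u.1 v.1 ∈ D) (hx : x.1 ∈ T.path u.1 v.1) (hux : T.components D u x) :
    x = u ∨ x = v := by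
  have h1 := hD.isConcat_of_rel hux
  obtain ⟨u, hu⟩ := u
  obtain ⟨x, hx'⟩ := x
  change x ∈ T.path u v.1 at hx
  change T.IsConcat D u x at h1
  cases h1 with
  | refl => exact .inl rfl
  | @cons _ z _ h1 h2 h3 =>
    have hne := (hD.1 _ h1).ne
    have h4 := (btw_left hx h2).1
    obtain rfl := hD.eq_of_nx_eq h1 h (nx_eq_of_mem h4 hne.symm)
    exact .inr (Subtype.ext (btw_antisymm hx h2))

lemma IsSemibrick.mem_segs (hD : T.IsSemibrick D) {B : Set T.Interior} {u v : T.Interior}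
    (hB : B ∈ (T.components D).classes) (hu : u ∈ B) (h : T.path u.1 v.1 ∈ D) :
    v ∈ B ∧ T.path u.1 v.1 ∈ T.segs B := by
  obtain ⟨w, rfl⟩ := hB
  have huv : T.components D u v := .rel _ _ h
  have hv : T.components D v w := Setoid.trans' _ (Setoid.symm' _ huv) hu
  refine ⟨hv, ⟨hD.1 _ h, u, hu, v, hv, rfl⟩, ?_⟩
  rintro s ⟨hs, x, hx, y, hy, rfl⟩ hle
  have hx' : T.components D u x := Setoid.trans' _ hu (Setoid.symm' _ hx)
  have hy' : T.components D u y := Setoid.trans' _ hu (Setoid.symm' _ hy)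
  rcases hD.eq_or_eq_of_rel h (hle (T.left_mem _ _)) hx' with rfl | rfl <;>
    rcases hD.eq_or_eq_of_rel h (hle (T.right_mem _ _)) hy' with rfl | rfl
  · exact absurd rfl hs.ne
  · exact le_rfl
  · exact (T.path_comm _ _).le
  · exact absurd rfl hs.ne

/-- A minimal segment of a block is a concatenation of elements of `D`; its first piece has both
ends in the block, so by minimality it is the whole segment. -/
lemma IsSemibrick.partSegs_components (hD : T.IsSemibrick D) :
    T.partSegs (T.components D) = D := by
  ext s
  simp only [partSegs, Set.mem_iUnion]
  constructor
  · rintro ⟨B, ⟨w, rfl⟩, ⟨hs, u, hu, v, hv, rfl⟩, hmin⟩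
    have huv := hD.isConcat_of_rel (Setoid.trans' _ hu (Setoid.symm' _ hv))
    obtain ⟨u, hu'⟩ := u
    change T.IsConcat D u v.1 at huv
    cases huv with
    | refl => exact absurd rfl hs.ne
    | @cons _ z _ h1 h2 h3 =>
      have hz := (hD.1 _ h1).not_leaf (T.right_mem _ _)
      have huz : T.components D ⟨u, hu'⟩ ⟨z, hz⟩ := .rel _ _ h1
      have hle : T.path u v.1 ⊆ T.path u z := hmin ⟨hD.1 _ h1, ⟨u, hu'⟩, hu, ⟨z, hz⟩,
        Setoid.trans' _ (Setoid.symm' _ huz) hu, rfl⟩ (path_subset_left h2)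
      rw [hle.antisymm (path_subset_left h2)]
      exact h1
  · intro h
    obtain ⟨u, v, -, hu, hv, rfl, -⟩ := hD.1 s h
    exact ⟨_, ⟨⟨u, hu⟩, rfl⟩, (hD.mem_segs (u := ⟨u, hu⟩) (v := ⟨v, hv⟩) ⟨⟨u, hu⟩, rfl⟩
      ((T.components D).refl' _) h).2⟩

lemma IsSemibrick.isNCP_components [Finite V] (hD : T.IsSemibrick D) :
    T.IsNCP (T.components D) := by
  constructor
  · rw [hD.partSegs_components]
    intro s hs t ht hst
    exact (redNoncrossing_iff (hD.1 s hs) (hD.1 t ht)).2 ⟨hD.2 s hs t ht hst,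
      hD.2 t ht s hs hst.symm⟩
  · rintro B hB u hu v hv
    obtain ⟨w, rfl⟩ := id hB
    have huv := hD.isConcat_of_rel (Setoid.trans' _ hu (Setoid.symm' _ hv))
    obtain ⟨u, hu'⟩ := u
    obtain ⟨v, hv'⟩ := v
    change T.IsConcat D u v at huv
    induction huv with
    | refl => exact .refl
    | @cons u z v h1 h2 h3 ih =>
      have hz := (hD.1 _ h1).not_leaf (T.right_mem _ _)
      have h4 := hD.mem_segs hB hu (v := ⟨z, hz⟩) h1
      exact .head ⟨hu, h4.1, h4.2⟩ (ih hz h4.1 hv' hv)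

lemma IsNCP.isSemibrick [Finite V] (hP : T.IsNCP P) : T.IsSemibrick (T.partSegs P) := by
  have hseg : ∀ s ∈ T.partSegs P, T.IsSegment s := by
    intro s hs
    simp only [partSegs, Set.mem_iUnion] at hs
    obtain ⟨B, hB, h⟩ := hs
    exact h.1.1
  exact ⟨hseg, fun s hs t ht hst =>
    ((redNoncrossing_iff (hseg s hs) (hseg t ht)).1 (hP.1 s hs t ht hst)).1⟩

lemma IsNCP.components_partSegs (hP : T.IsNCP P) : T.components (T.partSegs P) = P := by
  apply le_antisymm
  · refine Setoid.eqvGen_le fun u v h => ?_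
    simp only [partSegs, Set.mem_iUnion] at h
    obtain ⟨_, ⟨w, rfl⟩, ⟨-, x, hx, y, hy, h⟩, -⟩ := h
    have hxy : P x y := Setoid.trans' _ hx (Setoid.symm' _ hy)
    rcases path_endpoints h with ⟨h1, h2⟩ | ⟨h1, h2⟩
    · rwa [Subtype.ext h1, Subtype.ext h2]
    · rw [Subtype.ext h1, Subtype.ext h2]
      exact Setoid.symm' _ hxy
  · intro u v h
    have hB : {x | P x v} ∈ P.classes := ⟨v, rfl⟩
    have h1 := hP.2 _ hB u h v (Setoid.refl' _ _)
    induction h1 using Relation.ReflTransGen.head_induction_on with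
    | refl => exact Setoid.refl' _ _
    | head h1 _ ih =>
      refine Setoid.trans' _ (.rel _ _ ?_) (ih h1.2.1)
      simp only [partSegs, Set.mem_iUnion]
      exact ⟨_, hB, h1.2.2⟩

end Partitions

/-! ### The bijections -/

namespace Facet

variable {F G : T.Facet}

lemma isSemibrick_lowerLabels [Finite V] (F : T.Facet) : T.IsSemibrick F.lowerLabels := by
  obtain ⟨τ, rfl⟩ := F.exists_toFacet
  rw [TorsionPair.lowerLabels_toFacet]
  exact TorsionPair.lowerLab_isSemibrick

lemma isSemibrick_upperLabels [Finite V] (F : T.Facet) : T.IsSemibrick F.upperLabels := by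
  obtain ⟨τ, rfl⟩ := F.exists_toFacet
  rw [TorsionPair.upperLabels_toFacet]
  exact TorsionPair.upperLab_isSemibrick

lemma lowerLabels_injective [Finite V] : Function.Injective (lowerLabels (T := T)) := by
  intro F G h
  obtain ⟨τ, rfl⟩ := F.exists_toFacet
  obtain ⟨σ, rfl⟩ := G.exists_toFacet
  rw [TorsionPair.lowerLabels_toFacet, TorsionPair.lowerLabels_toFacet] at h
  rw [TorsionPair.lowerLab_injective h]

lemma upperLabels_injective [Finite V] : Function.Injective (upperLabels (T := T)) := by
  intro F G h
  obtain ⟨τ, rfl⟩ := F.exists_toFacet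
  obtain ⟨σ, rfl⟩ := G.exists_toFacet
  rw [TorsionPair.upperLabels_toFacet, TorsionPair.upperLabels_toFacet] at h
  rw [TorsionPair.upperLab_injective h]

lemma exists_lowerLabels_eq [Finite V] {D : Set (Set V)} (hD : T.IsSemibrick D) :
    ∃ F : T.Facet, F.lowerLabels = D :=
  ⟨(TorsionPair.ofX D hD.1).toFacet, by
    rw [TorsionPair.lowerLabels_toFacet, TorsionPair.lowerLab_ofX hD]⟩

lemma partSegs_rho [Finite V] (F : T.Facet) : T.partSegs (T.rho F) = F.lowerLabels :=
  F.isSemibrick_lowerLabels.partSegs_components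

lemma isNCP_rho [Finite V] (F : T.Facet) : T.IsNCP (T.rho F) :=
  F.isSemibrick_lowerLabels.isNCP_components

lemma rho_injective [Finite V] : Function.Injective T.rho := fun F G h =>
  lowerLabels_injective (by rw [← F.partSegs_rho, ← G.partSegs_rho, h])

lemma exists_rho_eq [Finite V] {P : Setoid T.Interior} (hP : T.IsNCP P) :
    ∃ F : T.Facet, T.rho F = P := by
  obtain ⟨F, hF⟩ := exists_lowerLabels_eq hP.isSemibrick
  refine ⟨F, ?_⟩
  change T.components F.lowerLabels = P
  rw [hF, hP.components_partSegs]

/-- The elements of `shardSet F` are the segments joining vertices of the same block of `rho F`. -/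
lemma mem_shardSet_iff [Finite V] {s : Set V} : s ∈ F.shardSet ↔
    T.IsSegment s ∧ ∃ u v : T.Interior, s = T.path u.1 v.1 ∧ T.rho F u v := by
  have hD := F.isSemibrick_lowerLabels
  change _ ↔ T.IsSegment s ∧ ∃ u v : T.Interior, s = T.path u.1 v.1 ∧
    T.components F.lowerLabels u v
  obtain ⟨τ, rfl⟩ := F.exists_toFacet
  rw [TorsionPair.lowerLabels_toFacet] at hD ⊢
  rw [TorsionPair.shardSet_toFacet]
  constructor
  · rintro ⟨m, hm, w, z, h1, h2, h3, h4⟩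
    have hX := h3 (TorsionPair.label_mem h4).1
    have hcore := TorsionPair.isCore_of_isGLB hm (TorsionPair.lowerLab_nonempty hX)
    obtain ⟨hX, hY⟩ := (TorsionPair.shard_mem_iff hcore).1 ⟨w, z, h1, h2, h3, h4⟩
    refine ⟨TorsionPair.seg_X hX, ?_⟩
    obtain ⟨u, v, -, hu, hv, rfl, -⟩ := TorsionPair.seg_X hX
    exact ⟨⟨u, hu⟩, ⟨v, hv⟩, rfl, (hcore.isConcat hX hY).rel hD hu hv⟩
  · rintro ⟨hs, u, v, rfl, h⟩
    have h1 := hD.isConcat_of_rel h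
    have hne : τ.lowerLab.Nonempty := by
      obtain ⟨u, hu⟩ := u
      change T.IsConcat τ.lowerLab u v.1 at h1
      cases h1 with
      | refl => exact absurd rfl hs.ne
      | cons h1 _ _ => exact ⟨_, h1⟩
    obtain ⟨m, hm, -⟩ := TorsionPair.exists_isGLB {σ | σ ⋖ τ}
    have hcore := TorsionPair.isCore_of_isGLB hm hne
    exact ⟨m, hm, (TorsionPair.shard_mem_iff hcore).2 (hcore.mem_of_isConcat h1 hs)⟩

lemma shardSet_subset_iff [Finite V] : F.shardSet ⊆ G.shardSet ↔ T.rho F ≤ T.rho G := by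
  constructor
  · refine fun h => Setoid.eqvGen_le fun u v huv => ?_
    obtain ⟨-, x, y, hxy, hr⟩ := mem_shardSet_iff.1 (h (mem_shardSet_iff.2
      ⟨F.isSemibrick_lowerLabels.1 _ huv, u, v, rfl, .rel _ _ huv⟩))
    rcases path_endpoints hxy with ⟨h1, h2⟩ | ⟨h1, h2⟩
    · rwa [Subtype.ext h1, Subtype.ext h2]
    · rw [Subtype.ext h1, Subtype.ext h2]
      exact Setoid.symm' _ hr
  · intro h s hs
    obtain ⟨h1, u, v, rfl, h2⟩ := mem_shardSet_iff.1 hs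
    exact mem_shardSet_iff.2 ⟨h1, u, v, rfl, h h2⟩

lemma psi_bijective [Finite V] : Function.Bijective T.psi := by
  refine ⟨fun F G h => rho_injective ?_, ?_⟩
  · have h' : F.shardSet = G.shardSet := congrArg Subtype.val h
    exact le_antisymm (shardSet_subset_iff.1 h'.le) (shardSet_subset_iff.1 h'.ge)
  · rintro ⟨X, F, rfl⟩
    exact ⟨F, rfl⟩

variable (T) in
/-- The map `psi` as an equivalence. -/
noncomputable def psiEquiv [Finite V] : T.Facet ≃ T.ShardOrder :=
  Equiv.ofBijective T.psi psi_bijective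

variable (T) in
/-- The map `rho` as an equivalence. -/
noncomputable def rhoEquiv [Finite V] : T.Facet ≃ T.NCP :=
  Equiv.ofBijective (fun F => ⟨T.rho F, F.isNCP_rho⟩)
    ⟨fun _ _ h => rho_injective (congrArg Subtype.val h), fun P =>
      (exists_rho_eq P.2).imp fun _ h => Subtype.ext h⟩

variable (T) in
/-- The isomorphism between the shard intersection order and the noncrossing tree partitions. -/
noncomputable def shardIso [Finite V] : T.ShardOrder ≃o T.NCP where
  toEquiv := (psiEquiv T).symm.trans (rhoEquiv T)
  map_rel_iff' := by
    intro X Y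
    obtain ⟨F, rfl⟩ := (psiEquiv T).surjective X
    obtain ⟨G, rfl⟩ := (psiEquiv T).surjective Y
    simp only [Equiv.trans_apply, Equiv.symm_apply_apply]
    exact shardSet_subset_iff.symm

lemma shardIso_psiEquiv [Finite V] (F : T.Facet) : shardIso T (psiEquiv T F) = rhoEquiv T F :=
  congrArg (rhoEquiv T) ((psiEquiv T).symm_apply_apply F)

/-- The upper labels form a semibrick, hence are the lower labels of some facet. The resulting map
is injective because upper labels determine the facet, and bijective because there are finitely many
facets. -/
lemma exists_kreweras [Finite V] : ∃ kr : T.Facet ≃ T.Facet, ∀ F : T.Facet, F.Kreweras (kr F) := by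
  choose kr hkr using fun F : T.Facet => exists_lowerLabels_eq F.isSemibrick_upperLabels
  have hinj : Function.Injective kr := fun F G h =>
    upperLabels_injective (by rw [← hkr F, ← hkr G, h])
  have : Finite T.Facet := Finite.of_surjective _ TorsionPair.toFacet_surjective
  exact ⟨Equiv.ofBijective kr (Finite.injective_iff_bijective.1 hinj), fun F => (hkr F).symm⟩

lemma exists_isGLB_pair [Finite V] (F G : T.Facet) : ∃ m, IsGLB {F, G} m := by
  obtain ⟨τ, rfl⟩ := F.exists_toFacet
  obtain ⟨σ, rfl⟩ := G.exists_toFacet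
  obtain ⟨m, hm, -⟩ := TorsionPair.exists_isGLB {τ, σ}
  refine ⟨m.toFacet, ?_⟩
  rwa [← Set.image_pair, TorsionPair.isGLB_toFacet_iff]

lemma exists_isLUB_pair [Finite V] (F G : T.Facet) : ∃ j, IsLUB {F, G} j := by
  obtain ⟨τ, rfl⟩ := F.exists_toFacet
  obtain ⟨σ, rfl⟩ := G.exists_toFacet
  obtain ⟨m, hm⟩ := TorsionPair.exists_isLUB {τ, σ}
  refine ⟨m.toFacet, ?_⟩
  rwa [← Set.image_pair, TorsionPair.isLUB_toFacet_iff]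

lemma antisymm [Finite V] (h : F ≤ G) (h' : G ≤ F) : F = G := by
  obtain ⟨τ, rfl⟩ := F.exists_toFacet
  obtain ⟨σ, rfl⟩ := G.exists_toFacet
  rw [TorsionPair.toFacet_le_iff] at h h'
  rw [le_antisymm h h']

lemma covBy_iff [Finite V] : F ⋖ G ↔ ∃ s, F.Flip s G := by
  obtain ⟨τ, rfl⟩ := F.exists_toFacet
  obtain ⟨σ, rfl⟩ := G.exists_toFacet
  rw [TorsionPair.toFacet_covBy_iff]
  exact ⟨fun h => (TorsionPair.exists_label h).imp fun s hs => TorsionPair.flip_iff.2 ⟨h, hs⟩,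
    fun ⟨_, h⟩ => (TorsionPair.flip_iff.1 h).1⟩

lemma flip_label [Finite V] {s t : Set V} (hs : F.Flip s G) (ht : F.Flip t G) :
    T.IsSegment s ∧ s = t := by
  obtain ⟨τ, rfl⟩ := F.exists_toFacet
  obtain ⟨σ, rfl⟩ := G.exists_toFacet
  have h1 := (TorsionPair.flip_iff.1 hs).2
  have h2 := (TorsionPair.flip_iff.1 ht).2
  exact ⟨TorsionPair.seg_X (TorsionPair.label_mem h1).1,
    Set.singleton_injective (h1.symm.trans h2)⟩

end Facet

end PlaneTree

/-! ### The main theorem -/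

theorem theorem5p15 {V : Type*} [Finite V] (T : PlaneTree V) :
    -- the oriented flip graph is the Hasse diagram of a lattice, with well-defined labels
    (∀ F G : T.Facet, F ≤ G → G ≤ F → F = G) ∧
    (∀ F G : T.Facet, (∃ m, IsGLB {F, G} m) ∧ ∃ j, IsLUB {F, G} j) ∧
    (∀ F G : T.Facet, F ⋖ G ↔ ∃ s, F.Flip s G) ∧
    (∀ F G : T.Facet, ∀ s t, F.Flip s G → F.Flip t G → T.IsSegment s ∧ s = t) ∧
    -- `ψ` is a bijection onto the shard intersection order, `ρ` is a bijection onto `NCP(T)`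
    Function.Bijective T.psi ∧
    Set.BijOn T.rho Set.univ {P | T.IsNCP P} ∧
    (∀ F : T.Facet, T.partSegs (T.rho F) = F.lowerLabels) ∧
    -- `e = ρ ∘ ψ⁻¹` is an isomorphism of posets
    ∃ e : T.ShardOrder ≃o T.NCP,
      (∀ F : T.Facet, (e (T.psi F)).1 = T.rho F) ∧
      -- the Kreweras complementations are well-defined bijections, and `e` commutes with them
      ∃ (kr : T.Facet ≃ T.Facet) (krS : T.ShardOrder ≃ T.ShardOrder) (krN : T.NCP ≃ T.NCP),
        (∀ F G, F.Kreweras G ↔ kr F = G) ∧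
        (∀ X Y, T.ShardKreweras X Y ↔ krS X = Y) ∧
        (∀ P Q, T.NCPKreweras P Q ↔ krN P = Q) ∧
        ∀ X, e (krS X) = krN (e X) := by
  obtain ⟨kr, hkr⟩ := PlaneTree.Facet.exists_kreweras (T := T)
  let eψ := PlaneTree.Facet.psiEquiv T
  let eρ := PlaneTree.Facet.rhoEquiv T
  have hkr_iff : ∀ F G : T.Facet, F.Kreweras G ↔ kr F = G := fun F G =>
    ⟨fun h => PlaneTree.Facet.lowerLabels_injective ((hkr F).symm.trans h), fun h => h ▸ hkr F⟩
  refine ⟨fun _ _ => PlaneTree.Facet.antisymm, fun F G =>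
    ⟨PlaneTree.Facet.exists_isGLB_pair F G, PlaneTree.Facet.exists_isLUB_pair F G⟩,
    fun _ _ => PlaneTree.Facet.covBy_iff, fun _ _ _ _ => PlaneTree.Facet.flip_label,
    PlaneTree.Facet.psi_bijective,
    ⟨fun F _ => F.isNCP_rho, PlaneTree.Facet.rho_injective.injOn, fun P hP =>
      (PlaneTree.Facet.exists_rho_eq hP).imp fun F h => ⟨trivial, h⟩⟩,
    PlaneTree.Facet.partSegs_rho, PlaneTree.Facet.shardIso T,
    fun F => congrArg Subtype.val (PlaneTree.Facet.shardIso_psiEquiv F),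
    kr, eψ.symm.trans (kr.trans eψ), eρ.symm.trans (kr.trans eρ), hkr_iff, ?_, ?_, ?_⟩
  · intro X Y
    constructor
    · rintro ⟨F, G, rfl, rfl, h⟩
      change eψ (kr (eψ.symm (eψ F))) = eψ G
      rw [eψ.symm_apply_apply, (hkr_iff F G).1 h]
    · rintro rfl
      exact ⟨eψ.symm X, kr (eψ.symm X), eψ.apply_symm_apply X, rfl, hkr _⟩
  · intro P Q
    constructor
    · rintro ⟨F, hF, hQ⟩
      obtain rfl : eρ F = P := Subtype.ext hF
      change eρ (kr (eρ.symm (eρ F))) = Q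
      rw [eρ.symm_apply_apply]
      refine Subtype.ext ?_
      -- A noncrossing tree partition is recovered from its segments, so `Q` is the partition into
      -- components of the lower labels of `kr F`.
      rw [← Q.2.components_partSegs, hQ, hkr F]
      rfl
    · rintro rfl
      refine ⟨eρ.symm P, congrArg Subtype.val (eρ.apply_symm_apply P), ?_⟩
      rw [hkr]
      exact PlaneTree.Facet.partSegs_rho _
  · intro X
    obtain ⟨F, rfl⟩ := eψ.surjective X
    change PlaneTree.Facet.shardIso T (eψ (kr (eψ.symm (eψ F)))) =
      eρ (kr (eρ.symm (PlaneTree.Facet.shardIso T (eψ F))))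
    rw [eψ.symm_apply_apply, PlaneTree.Facet.shardIso_psiEquiv,
      PlaneTree.Facet.shardIso_psiEquiv, eρ.symm_apply_apply]
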